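/- Let $N\ge 2$ and let $\Omega\subset\mathbb R^N$ be a bounded domain with smooth boundary. For every $\epsilon>0$ let $\Omega_\epsilon\subset\Omega$ be open with Lipschitz boundary, and put $D_\epsilon=\Omega\setminus\Omega_\epsilon$; assume that $\overline{D_\epsilon}\cap\partial\Omega=\emptyset$, that the interior of $D_\epsilon$ is non-empty with Lipschitz boundary, and that $\mathbf 1_{\Omega_\epsilon}\to 1$ in $L^2(\Omega)$ as $\epsilon\to0$. Let $\alpha>0$, let $\alpha_\epsilon>0$ converge as $\epsilon\to 0$, and let $g\in L^2(\partial\Omega)$, $g^\epsilon\in L^2(\partial\Omega_\epsilon)$ satisfy $g^\epsilon|_{\partial\Omega}\to g$ in $L^2(\partial\Omega)$ and $\limsup_{\epsilon\to0}\alpha_\epsilon\|g^\epsilon\|_{L^2(\partial D_\epsilon)}<\infty$. Boundary values of Sobolev functions are traces, taken from $\Omega_\epsilon$ on $\partial D_\epsilon$. For $v_1,v_2\in H^1(\Omega_\epsilon)$ let $$a^\epsilon(v_1,v_2)=\int_{\Omega_\epsilon}\nabla v_1\cdot\nabla v_2\,dx+\alpha_\epsilon\int_{\partial D_\epsilon}(v_1-g^\epsilon)v_2\,dS+\alpha\int_{\partial\Omega}(v_1-g^\epsilon)v_2\,dS,$$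 and let $B^\epsilon$ be the same expression with $g^\epsilon$ replaced by $0$. Assume: 1. (Coercivity) There is $c>0$ with $B^\epsilon(v,v)\ge c\|v\|_{H^1(\Omega_\epsilon)}^2$ for all $\epsilon>0$ and $v\in H^1(\Omega_\epsilon)$. 2. (Extension operators) There are bounded linear maps $T^\epsilon:H^1(\Omega_\epsilon)\to H^1(\Omega)$ with $T^\epsilon v=v$ on $\Omega_\epsilon$ and $\limsup_{\epsilon\to0}\|T^\epsilon\|<\infty$. Moreover, writing $Z^\epsilon$ for extension by zero, whenever $v^\epsilon\in H^1(\Omega_\epsilon)$ $(\epsilon>0)$ are such that $a^\epsilon(v^\epsilon,v^\epsilon)$ is bounded above as $\epsilon\to0$ and $Z^\epsilon v^\epsilon$ converges in $L^2(\Omega)$, then $\|T^\epsilon v^\epsilon-Z^\epsilon v^\epsilon\|_{L^2(\Omega)}\to0$. 3. (Auxiliary functions) There are $q^\epsilon\in W^{1,\infty}(\Omega_\epsilon)$ with $q^\epsilon=1$ on $\partial\Omega$, with $T^\epsilon q^\epsilon\rightharpoonup1$ weakly in $H^1(\Omega)$ as $\epsilon\to0$, and with $a^\epsilon(q^\epsilon,q^\epsilon)$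 bounded above as $\epsilon\to0$. 4. (Functional $\eta$) For every $v\in W^{1,1}(\Omega)$ and every family $v^\epsilon\in W^{1,1}(\Omega)$ converging weakly to $v$ in $W^{1,1}(\Omega)$ as $\epsilon\to0$, the quantity $\int_{\Omega_\epsilon}\nabla v^\epsilon\cdot\nabla q^\epsilon\,dx+\alpha_\epsilon\int_{\partial D_\epsilon}v^\epsilon q^\epsilon\,dS$ converges as $\epsilon\to0$ to a limit $\eta[v]\in\mathbb R$ that does not depend on the choice of $(v^\epsilon)$. 5. (Functional $\gamma$) For every $\zeta\in C^\infty(\overline\Omega)$ (the restrictions to $\overline\Omega$ of functions in $C^\infty(\mathbb R^N)$), the quantity $\alpha_\epsilon\int_{\partial D_\epsilon}\zeta g^\epsilon q^\epsilon\,dS$ converges as $\epsilon\to0$ to a limit $\gamma[\zeta]\in\mathbb R$. Let $f\in L^2(\Omega)$ and let $u^\epsilon\in H^1(\Omega_\epsilon)$ satisfy $a^\epsilon(u^\epsilon,v)=\int_{\Omega_\epsilon}fv\,dx$ for all $v\in H^1(\Omega_\epsilon)$ and all $\epsilon>0$. Let $\epsilon_n>0$ with $\epsilon_n\to0$, and suppose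 that $T^{\epsilon_n}u^{\epsilon_n}\rightharpoonup u$ weakly in $H^1(\Omega)$. Then for every $\zeta\in C^\infty(\overline\Omega)$ one has $u\zeta\in W^{1,1}(\Omega)$ and $$\int_\Omega(\nabla u\cdot\nabla\zeta-f\zeta)\,dx+\alpha\int_{\partial\Omega}(u-g)\zeta\,dS+\eta[u\zeta]-\gamma[\zeta]=0.$$ -/

import Mathlib

open MeasureTheory Filter Topology Set
open scoped ENNReal ContDiff

noncomputable section

namespace RobinHomogenisation

/-- Euclidean space of dimension `N`. -/
abbrev E (N : ℕ) := EuclideanSpace ℝ (Fin N)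

/-! ### Boundary regularity -/

/-- Near each of its boundary points, `U` is the set of points lying strictly on one side of
the graph, in some direction `e`, of a function satisfying `P`. The function is evaluated at the
orthogonal projection `y - ⟪e, y⟫ e` of `y` on the hyperplane orthogonal to `e` only. -/
def HasGraphBoundary {N : ℕ} (P : (E N → ℝ) → Prop) (U : Set (E N)) : Prop :=
  ∀ x ∈ frontier U, ∃ e : E N, ‖e‖ = 1 ∧ ∃ h : E N → ℝ, P h ∧ ∃ r > 0,
    ∀ y ∈ Metric.ball x r, y ∈ U ↔ h (y - inner ℝ e y • e) < inner ℝ e y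

/-- Lipschitz continuous boundary. -/
def HasLipschitzBoundary {N : ℕ} (U : Set (E N)) : Prop :=
  HasGraphBoundary (fun h => ∃ K, LipschitzWith K h) U

/-- Smooth boundary. -/
def HasSmoothBoundary {N : ℕ} (U : Set (E N)) : Prop :=
  HasGraphBoundary (fun h => ContDiff ℝ ∞ h) U

/-- The surface measure on a set `S` (a hypersurface): the `(N-1)`-dimensional Hausdorff
measure, normalised so as to agree with Lebesgue measure on hyperplanes. -/
def surf {N : ℕ} (S : Set (E N)) : Measure (E N) :=
  (Measure.euclideanHausdorffMeasure (N - 1)).restrict S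

/-! ### Sobolev spaces -/

/-- `G` is the weak gradient of `f` on the open set `U`. -/
def HasWeakGradient {N : ℕ} (U : Set (E N)) (f : E N → ℝ) (G : E N → E N) : Prop :=
  ∀ φ : E N → ℝ, ContDiff ℝ ∞ φ → HasCompactSupport φ → tsupport φ ⊆ U →
    ∫ x in U, f x • gradient φ x = - ∫ x in U, φ x • G x

theorem continuous_gradient {N : ℕ} {φ : E N → ℝ} (h : ContDiff ℝ ∞ φ) :
    Continuous (gradient φ) :=
  (InnerProductSpace.toDual ℝ (E N)).symm.continuous.comp
    (h.continuous_fderiv (by simp))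

theorem hasCompactSupport_gradient {N : ℕ} {φ : E N → ℝ} (h : HasCompactSupport φ) :
    HasCompactSupport (gradient φ) :=
  (h.fderiv (𝕜 := ℝ)).comp_left (g := (InnerProductSpace.toDual ℝ (E N)).symm) (map_zero _)

theorem HasWeakGradient.congr {N : ℕ} {U : Set (E N)} {f f' : E N → ℝ} {G G' : E N → E N}
    (h : HasWeakGradient U f G) (hf : f =ᵐ[volume.restrict U] f')
    (hG : G =ᵐ[volume.restrict U] G') : HasWeakGradient U f' G' := by
  intro φ h1 h2 h3
  have e1 : ∫ x in U, f' x • gradient φ x = ∫ x in U, f x • gradient φ x :=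
    integral_congr_ae (by filter_upwards [hf] with x hx; rw [hx])
  have e2 : ∫ x in U, φ x • G' x = ∫ x in U, φ x • G x :=
    integral_congr_ae (by filter_upwards [hG] with x hx; rw [hx])
  rw [e1, e2, h φ h1 h2 h3]

/-- The Sobolev space `W^{1,p}(U)`: pairs `(v, ∇v)` in `L^p × L^p` whose second entry is the weak
gradient of the first one. It inherits the norm `(‖v‖_p ^ p + ‖∇v‖_p ^ p) ^ (1/p)`
(the maximum of both for `p = ∞`). -/
def sobolevSubmodule {N : ℕ} (U : Set (E N)) (p : ℝ≥0∞) [Fact (1 ≤ p)] :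
    Submodule ℝ (WithLp p (Lp ℝ p (volume.restrict U) × Lp (E N) p (volume.restrict U))) where
  carrier := {w | HasWeakGradient U w.fst w.snd}
  zero_mem' := by
    have h : HasWeakGradient U (fun _ => (0 : ℝ)) (fun _ => (0 : E N)) := by
      intro φ _ _ _
      simp
    exact h.congr (Lp.coeFn_zero ℝ p _).symm (Lp.coeFn_zero (E N) p _).symm
  add_mem' := by
    intro a b ha hb
    have h : HasWeakGradient U (fun x => a.fst x + b.fst x) (fun x => a.snd x + b.snd x) := by
      intro φ h1 h2 h3
      have hp : (1 : ℝ≥0∞) ≤ p := Fact.out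
      have i1 : ∀ w : Lp ℝ p (volume.restrict U),
          Integrable (fun x => w x • gradient φ x) (volume.restrict U) := fun w =>
        ((Lp.memLp w).locallyIntegrable hp).integrable_smul_right_of_hasCompactSupport
          (continuous_gradient h1) (hasCompactSupport_gradient h2)
      have i2 : ∀ w : Lp (E N) p (volume.restrict U),
          Integrable (fun x => φ x • w x) (volume.restrict U) := fun w =>
        ((Lp.memLp w).locallyIntegrable hp).integrable_smul_left_of_hasCompactSupport
          h1.continuous h2
      simp only [add_smul, smul_add]
      rw [integral_add (i1 _) (i1 _), integral_add (i2 _) (i2 _), ha φ h1 h2 h3, hb φ h1 h2 h3,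
        neg_add]
    exact h.congr (Lp.coeFn_add a.fst b.fst).symm (Lp.coeFn_add a.snd b.snd).symm
  smul_mem' := by
    intro c a ha
    have h : HasWeakGradient U (fun x => c • a.fst x) (fun x => c • a.snd x) := by
      intro φ h1 h2 h3
      have := ha φ h1 h2 h3
      simp only [smul_assoc, smul_comm _ c]
      rw [integral_smul, integral_smul, this, smul_neg]
    exact h.congr (Lp.coeFn_smul c a.fst).symm (Lp.coeFn_smul c a.snd).symm

/-- The Sobolev space `W^{1,p}(U)` as a normed space; `H^1(U)` is `Sobolev U 2`. -/
abbrev Sobolev {N : ℕ} (U : Set (E N)) (p : ℝ≥0∞) [Fact (1 ≤ p)] : Type :=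
  sobolevSubmodule U p

/-- The function underlying an element of `W^{1,p}(U)`. -/
def Sobolev.fn {N : ℕ} {U : Set (E N)} {p : ℝ≥0∞} [Fact (1 ≤ p)] (v : Sobolev U p) : E N → ℝ :=
  v.1.fst

/-- The weak gradient of an element of `W^{1,p}(U)`. -/
def Sobolev.grad {N : ℕ} {U : Set (E N)} {p : ℝ≥0∞} [Fact (1 ≤ p)] (v : Sobolev U p) :
    E N → E N :=
  v.1.snd

/-- Weak convergence in a normed space. -/
def WeakTendsto {ι X : Type*} [SeminormedAddCommGroup X] [NormedSpace ℝ X]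
    (v : ι → X) (l : Filter ι) (w : X) : Prop :=
  ∀ L : X →L[ℝ] ℝ, Tendsto (fun i => L (v i)) l (𝓝 (L w))

/-! ### Traces -/

/-- `τ` is the trace on `∂U` of the function `f` with weak gradient `G` on `U`: some sequence of
functions smooth up to the boundary converges to `f` in `W^{1,1}(U)`, and its restrictions to
`∂U` converge to `τ` in `L^1(∂U)`. (For bounded `U` the spaces `W^{1,p}(U)` lie in `W^{1,1}(U)`
and their traces are the restrictions of the one on `W^{1,1}(U)`.) -/
def IsTrace {N : ℕ} (U : Set (E N)) (f : E N → ℝ) (G : E N → E N) (τ : E N → ℝ) : Prop :=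
  MemLp τ 1 (surf (frontier U)) ∧ ∃ φ : ℕ → E N → ℝ, (∀ k, ContDiff ℝ ∞ (φ k)) ∧
    Tendsto (fun k => eLpNorm (fun x => φ k x - f x) 1 (volume.restrict U)) atTop (𝓝 0) ∧
    Tendsto (fun k => eLpNorm (fun x => gradient (φ k) x - G x) 1 (volume.restrict U))
      atTop (𝓝 0) ∧
    Tendsto (fun k => eLpNorm (fun x => φ k x - τ x) 1 (surf (frontier U))) atTop (𝓝 0)

open Classical in
/-- The trace on `∂U` of the restriction to `U` of a Sobolev function `v ∈ W^{1,p}(V)`, where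
`U ⊆ V`. It exists and is unique up to null sets if `U` is bounded and Lipschitz. -/
def trace {N : ℕ} {V : Set (E N)} {p : ℝ≥0∞} [Fact (1 ≤ p)] (U : Set (E N)) (v : Sobolev V p) :
    E N → ℝ :=
  if h : ∃ τ, IsTrace U v.fn v.grad τ then h.choose else 0

/-! ### The Robin problem in a perforated domain

`Ω` is the full domain, `Ω'` the perforated one, `Ω \ Ω'` the inclusions; `α'` and `α` are the
Robin coefficients on the boundary of the inclusions and on `∂Ω`. -/

/-- The functional `a(v₁, v₂)` of the Robin problem with boundary data `g`. -/
def robinForm {N : ℕ} (Ω Ω' : Set (E N)) (α' α : ℝ) (g : E N → ℝ) (v₁ v₂ : Sobolev Ω' 2) : ℝ :=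
  (∫ x in Ω', inner ℝ (v₁.grad x) (v₂.grad x))
    + α' * ∫ x, (trace Ω' v₁ x - g x) * trace Ω' v₂ x ∂(surf (frontier (Ω \ Ω')))
    + α * ∫ x, (trace Ω' v₁ x - g x) * trace Ω' v₂ x ∂(surf (frontier Ω))

/-- The bilinear form `B(v₁, v₂)` of the homogeneous Robin problem. -/
def robinBilin {N : ℕ} (Ω Ω' : Set (E N)) (α' α : ℝ) (v₁ v₂ : Sobolev Ω' 2) : ℝ :=
  (∫ x in Ω', inner ℝ (v₁.grad x) (v₂.grad x))
    + α' * ∫ x, trace Ω' v₁ x * trace Ω' v₂ x ∂(surf (frontier (Ω \ Ω')))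
    + α * ∫ x, trace Ω' v₁ x * trace Ω' v₂ x ∂(surf (frontier Ω))

/-- The expression `∫_{Ω'} ∇v·∇q + α' ∫_{∂(Ω \ Ω')} v q` whose limit is the functional `η`. -/
def etaForm {N : ℕ} (Ω Ω' : Set (E N)) (α' : ℝ) (q : Sobolev Ω' 2) (v : Sobolev Ω 1) : ℝ :=
  (∫ x in Ω', inner ℝ (v.grad x) (q.grad x))
    + α' * ∫ x, trace Ω' v x * trace Ω' q x ∂(surf (frontier (Ω \ Ω')))

/-- The expression `α' ∫_{∂(Ω \ Ω')} ζ g q` whose limit is the functional `γ`. -/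
def gammaForm {N : ℕ} (Ω Ω' : Set (E N)) (α' : ℝ) (q : Sobolev Ω' 2) (g ζ : E N → ℝ) : ℝ :=
  α' * ∫ x, ζ x * g x * trace Ω' q x ∂(surf (frontier (Ω \ Ω')))

end RobinHomogenisation

end

open RobinHomogenisation

noncomputable section

namespace RobinHomogenisation

variable {N : ℕ}

/-! ### Gradients of smooth functions -/

/-! The equation for u^ε is tested with ζ q^ε. Expanding the gradients on Ω_ε, ∇u·∇(ζq) = ∇(ζu)·∇q -
u ∇ζ·∇q + q ∇ζ·∇u. The first term on the right, joined to the boundary term α_ε ∫_{∂D_ε} ζuq, is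
exactly the expression whose limit is η, taken at ζ T^ε u^ε. The data term on ∂D_ε is the one whose
limit is γ, and on ∂Ω the factor q is 1. This exact identity is `robin_identity`; it hides all
singular behaviour near the inclusions in η and γ.

The remaining terms pass to the limit by soft arguments. Multiplication by ζ is bounded from H^1 to
W^{1,1} (`exists_smoothMul_clm`), so ζ T^ε u^ε converges weakly to ζu in W^{1,1}; once the sequence
is completed to a family (`WeakTendsto.extend`), the η-part tends to η[uζ]. By Rellich
(`WeakTendsto.tendsto_eLpNorm_fn`), T^ε u^ε → u and T^ε q^ε → 1 strongly in L^2, while the gradients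
converge weakly to ∇u and to ∇1 = 0. Hence ∫ u ∇ζ·∇q → 0 and ∫ q ∇ζ·∇u → ∫ ∇ζ·∇u
(`WeakTendsto.tendsto_setIntegral_mul`). The integral of the trace over ∂Ω is a bounded functional
on W^{1,1} (`exists_integral_trace_clm`).

The bulk of the work is the theory of traces and Rellich's theorem on bounded Lipschitz domains.
Both rest on one geometric fact, `HasLipschitzBoundary.exists_patch`: locally the domain is stable
under small shifts in an open set of directions. A mollifier supported in those directions only
reads values inside the domain, so it commutes with the weak gradient up to the boundary. This gives
density of smooth functions in W^{1,1}; with the trace inequality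
`HasLipschitzBoundary.lintegral_frontier_le`, traces exist and are unique. It also gives a
mollification error in L^2 controlled by the gradient (`HasWeakGradient.eLpNorm_mollify_sub_le`),
hence Rellich. Since the trace of ζ T^ε u^ε is only available in L^1, its product with the trace of
q^ε is integrable because the latter is bounded (`Sobolev.memLp_top_trace`). -/

theorem hasGradientAt_of_contDiff {φ : E N → ℝ} (h : ContDiff ℝ ∞ φ) (x : E N) :
    HasGradientAt φ (gradient φ x) x :=
  (h.differentiable (by simp) x).hasGradientAt

theorem gradient_mul {φ ψ : E N → ℝ} (hφ : ContDiff ℝ ∞ φ) (hψ : ContDiff ℝ ∞ ψ) (x : E N) :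
    gradient (fun y => φ y * ψ y) x = φ x • gradient ψ x + ψ x • gradient φ x := by
  apply HasGradientAt.gradient
  rw [hasGradientAt_iff_hasFDerivAt, map_add, map_smul, map_smul]
  exact (hasGradientAt_iff_hasFDerivAt.1 (hasGradientAt_of_contDiff hφ x)).mul
    (hasGradientAt_iff_hasFDerivAt.1 (hasGradientAt_of_contDiff hψ x))

theorem gradient_add {φ ψ : E N → ℝ} (hφ : ContDiff ℝ ∞ φ) (hψ : ContDiff ℝ ∞ ψ) (x : E N) :
    gradient (fun y => φ y + ψ y) x = gradient φ x + gradient ψ x := by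
  apply HasGradientAt.gradient
  rw [hasGradientAt_iff_hasFDerivAt, map_add]
  exact (hasGradientAt_iff_hasFDerivAt.1 (hasGradientAt_of_contDiff hφ x)).add
    (hasGradientAt_iff_hasFDerivAt.1 (hasGradientAt_of_contDiff hψ x))

theorem gradient_sub {φ ψ : E N → ℝ} (hφ : ContDiff ℝ ∞ φ) (hψ : ContDiff ℝ ∞ ψ) (x : E N) :
    gradient (fun y => φ y - ψ y) x = gradient φ x - gradient ψ x := by
  apply HasGradientAt.gradient
  rw [hasGradientAt_iff_hasFDerivAt, map_sub]
  exact (hasGradientAt_iff_hasFDerivAt.1 (hasGradientAt_of_contDiff hφ x)).sub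
    (hasGradientAt_iff_hasFDerivAt.1 (hasGradientAt_of_contDiff hψ x))

theorem norm_gradient (φ : E N → ℝ) (x : E N) : ‖gradient φ x‖ = ‖fderiv ℝ φ x‖ := by
  rw [gradient, LinearIsometryEquiv.norm_map]

theorem gradient_eq_zero_of_notMem_tsupport {φ : E N → ℝ} {x : E N} (hx : x ∉ tsupport φ) :
    gradient φ x = 0 := by
  rw [← norm_eq_zero, norm_gradient, norm_eq_zero]
  exact image_eq_zero_of_notMem_tsupport fun h => hx (tsupport_fderiv_subset ℝ h)

theorem tsupport_mul_subset {φ ψ : E N → ℝ} :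
    tsupport (fun x => φ x * ψ x) ⊆ tsupport φ ∩ tsupport ψ :=
  subset_inter (tsupport_mul_subset_left (f := φ) (g := ψ))
    (tsupport_mul_subset_right (f := φ) (g := ψ))

/-- Integration by parts against the constant 1, in each direction `v` separately. This is what
makes 0 the weak gradient of a constant. -/
theorem integral_gradient_eq_zero {φ : E N → ℝ} (h : ContDiff ℝ ∞ φ) (hc : HasCompactSupport φ) :
    ∫ x, gradient φ x = 0 := by
  have hi : Integrable (gradient φ) :=
    (continuous_gradient h).integrable_of_hasCompactSupport (hasCompactSupport_gradient hc)
  refine ext_inner_left ℝ fun v => ?_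
  rw [← integral_inner hi, inner_zero_right]
  have h1 : ∀ x, inner ℝ v (gradient φ x : E N) = fderiv ℝ φ x v := fun x => by
    rw [(hasGradientAt_of_contDiff h x).fderiv_apply, real_inner_comm]
  simp only [h1]
  have hi' : Integrable (fun x => fderiv ℝ φ x v) := by
    simpa only [h1] using hi.const_inner (𝕜 := ℝ) v
  have := integral_mul_fderiv_eq_neg_fderiv_mul_of_integrable (μ := (volume : Measure (E N)))
    (f := fun _ => (1 : ℝ)) (g := φ) (v := v) (by simp) (by simpa using hi')
    (by simpa using h.continuous.integrable_of_hasCompactSupport hc)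
    (fun _ _ => differentiableAt_const _) (fun x _ => h.differentiable (by simp) x)
  simpa using this

/-! ### Calculus of weak gradients -/

theorem setIntegral_eq_of_eq_zero {F : Type*} [NormedAddCommGroup F] [NormedSpace ℝ F]
    {U V : Set (E N)} {f : E N → F}
    (h : ∀ x, x ∉ U ∩ V → f x = 0) : ∫ x in U, f x = ∫ x in V, f x := by
  have e1 : ∫ x in U, f x = ∫ x, f x :=
    setIntegral_eq_integral_of_forall_compl_eq_zero fun x hx => h x fun hx' => hx hx'.1
  have e2 : ∫ x in V, f x = ∫ x, f x :=
    setIntegral_eq_integral_of_forall_compl_eq_zero fun x hx => h x fun hx' => hx hx'.2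
  rw [e1, e2]

/-- Restriction to a smaller open set. -/
theorem HasWeakGradient.mono {U V : Set (E N)} (hVU : V ⊆ U)
    {f : E N → ℝ} {G : E N → E N} (h : HasWeakGradient U f G) : HasWeakGradient V f G := by
  intro φ h1 h2 h3
  have key := h φ h1 h2 (h3.trans hVU)
  have hx : ∀ x, x ∉ V ∩ U → x ∉ tsupport φ := fun x hx hx' => hx ⟨h3 hx', hVU (h3 hx')⟩
  rw [setIntegral_eq_of_eq_zero (U := V) (V := U), key,
    setIntegral_eq_of_eq_zero (U := V) (V := U)]
  · intro x hxx
    simp [image_eq_zero_of_notMem_tsupport (hx x hxx)]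
  · intro x hxx
    simp [gradient_eq_zero_of_notMem_tsupport (hx x hxx)]

/-- Integration by parts against products `χ φ` supported in `U`. -/
theorem HasWeakGradient.integral_mul {U : Set (E N)} {f : E N → ℝ} {G : E N → E N}
    (h : HasWeakGradient U f G) (hf : LocallyIntegrable f (volume.restrict U))
    (hG : LocallyIntegrable G (volume.restrict U)) {χ φ : E N → ℝ} (hχ : ContDiff ℝ ∞ χ)
    (hφ : ContDiff ℝ ∞ φ) (hc : HasCompactSupport φ)
    (hsupp : tsupport (fun x => χ x * φ x) ⊆ U) :
    ∫ x in U, (χ x * f x) • gradient φ x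
      = - ∫ x in U, φ x • (χ x • G x + f x • gradient χ x) := by
  have hχφ : ContDiff ℝ ∞ fun x => χ x * φ x := hχ.mul hφ
  have hcc : HasCompactSupport fun x => χ x * φ x := HasCompactSupport.mul_left (f := χ) hc
  have key := h _ hχφ hcc hsupp
  simp only [gradient_mul hχ hφ, smul_add] at key
  have hs1 : HasCompactSupport fun x => χ x • gradient φ x :=
    HasCompactSupport.smul_left (f := χ) (hasCompactSupport_gradient hc)
  have hs2 : HasCompactSupport fun x => φ x • gradient χ x :=
    hc.mono fun x hx h => hx (by simp only [h, zero_smul])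
  have i1 : Integrable (fun x => f x • (χ x • gradient φ x)) (volume.restrict U) :=
    hf.integrable_smul_right_of_hasCompactSupport (hχ.continuous.smul (continuous_gradient hφ)) hs1
  have i2 : Integrable (fun x => f x • (φ x • gradient χ x)) (volume.restrict U) :=
    hf.integrable_smul_right_of_hasCompactSupport (hφ.continuous.smul (continuous_gradient hχ)) hs2
  have i3 : Integrable (fun x => (χ x * φ x) • G x) (volume.restrict U) :=
    hG.integrable_smul_left_of_hasCompactSupport hχφ.continuous hcc
  rw [integral_add i1 i2] at key
  have e1 : ∫ x in U, (χ x * f x) • gradient φ x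
      = ∫ x in U, f x • (χ x • gradient φ x) := by
    congr 1 with x : 1
    rw [smul_smul, mul_comm]
  have e2 : ∫ x in U, φ x • (χ x • G x + f x • gradient χ x)
      = ∫ x in U, ((χ x * φ x) • G x + f x • (φ x • gradient χ x)) := by
    congr 1 with x : 1
    rw [smul_add, smul_smul, mul_comm, smul_comm (φ x) (f x)]
  rw [e1, e2, integral_add i3 i2, neg_add, ← key]
  exact (add_neg_cancel_right _ _).symm

/-- The product rule for a Sobolev function and a smooth function. -/
theorem HasWeakGradient.smooth_mul {U : Set (E N)} {f : E N → ℝ} {G : E N → E N}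
    (h : HasWeakGradient U f G) (hf : LocallyIntegrable f (volume.restrict U))
    (hG : LocallyIntegrable G (volume.restrict U)) {χ : E N → ℝ} (hχ : ContDiff ℝ ∞ χ) :
    HasWeakGradient U (fun x => χ x * f x) (fun x => χ x • G x + f x • gradient χ x) :=
  fun _ h1 h2 h3 => h.integral_mul hf hG hχ h1 h2
    ((tsupport_mul_subset.trans inter_subset_right).trans h3)

/-- Localisation: if `U` and `Γ` agree near the support of `χ`, then `χ f`, extended by zero, has
a weak gradient on `Γ`. -/
theorem HasWeakGradient.localize {U Γ B : Set (E N)} (hU : IsOpen U)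
    (hUΓ : U ∩ B = Γ ∩ B) {f : E N → ℝ} {G : E N → E N}
    (h : HasWeakGradient U f G) (hf : LocallyIntegrable f (volume.restrict U))
    (hG : LocallyIntegrable G (volume.restrict U)) {χ : E N → ℝ} (hχ : ContDiff ℝ ∞ χ)
    (hχB : tsupport χ ⊆ B) :
    HasWeakGradient Γ (U.indicator fun x => χ x * f x)
      (U.indicator fun x => χ x • G x + f x • gradient χ x) := by
  intro φ h1 h2 h3
  -- The support of χφ lies in Γ ∩ B = U ∩ B, so χφ is an admissible test function on U although φ
  -- need not be.
  have hs : tsupport (fun x => χ x * φ x) ⊆ U := fun x hx => by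
    have h' := tsupport_mul_subset hx
    have : x ∈ Γ ∩ B := ⟨h3 h'.2, hχB h'.1⟩
    rw [← hUΓ] at this
    exact this.1
  have key := h.integral_mul hf hG hχ h1 h2 hs
  have hx : ∀ x, x ∉ U ∩ Γ → x ∈ U → x ∉ tsupport φ := fun x hx hxU hx' => hx ⟨hxU, h3 hx'⟩
  have e1 : ∀ x, U.indicator (fun x => χ x * f x) x • gradient φ x
      = U.indicator (fun x => (χ x * f x) • gradient φ x) x := fun x => by
    by_cases hxU : x ∈ U <;> simp [hxU]
  have e2 : ∀ x, φ x • U.indicator (fun x => χ x • G x + f x • gradient χ x) x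
      = U.indicator (fun x => φ x • (χ x • G x + f x • gradient χ x)) x := fun x => by
    by_cases hxU : x ∈ U <;> simp [hxU]
  have e3 : ∀ {F : Type} [NormedAddCommGroup F] [NormedSpace ℝ F] (k : E N → F),
      (∀ x ∈ U, x ∉ tsupport φ → k x = 0) →
      ∫ x in Γ, U.indicator k x = ∫ x in U, k x := by
    intro F _ _ k hk
    rw [← setIntegral_congr_fun hU.measurableSet (f := U.indicator k)
      fun x hxU => by simp [hxU]]
    refine (setIntegral_eq_of_eq_zero fun x hxx => ?_).symm
    by_cases hxU : x ∈ U
    · simp [hxU, hk x hxU (hx x hxx hxU)]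
    · simp [hxU]
  simp only [e1, e2]
  rw [e3, e3, key]
  · intro x _ hx'
    simp [image_eq_zero_of_notMem_tsupport hx']
  · intro x _ hx'
    simp [gradient_eq_zero_of_notMem_tsupport hx']

/-- Uniqueness of the weak gradient. -/
theorem HasWeakGradient.unique {U : Set (E N)} (hU : IsOpen U) {f f' : E N → ℝ}
    {G G' : E N → E N} (h : HasWeakGradient U f G) (h' : HasWeakGradient U f' G')
    (hff : f =ᵐ[volume.restrict U] f') (hG : IntegrableOn G U) (hG' : IntegrableOn G' U) :
    G =ᵐ[volume.restrict U] G' := by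
  have key := hU.ae_eq_zero_of_integral_contDiff_smul_eq_zero (μ := (volume : Measure (E N)))
    (f := fun x => G x - G' x) ((hG.sub hG').locallyIntegrableOn) fun φ h1 h2 h3 => by
      have i1 : ∀ {K : E N → E N}, IntegrableOn K U → IntegrableOn (fun x => φ x • K x) U :=
        fun hK => hK.locallyIntegrable.integrable_smul_left_of_hasCompactSupport h1.continuous h2
      have e1 := h φ h1 h2 h3
      have e2 := h' φ h1 h2 h3
      have e3 : ∫ x in U, f x • gradient φ x = ∫ x in U, f' x • gradient φ x :=
        integral_congr_ae (by filter_upwards [hff] with x hx; rw [hx])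
      have e4 : ∫ x, φ x • (G x - G' x) = ∫ x in U, φ x • (G x - G' x) :=
        (setIntegral_eq_integral_of_forall_compl_eq_zero fun x hx => by
          rw [image_eq_zero_of_notMem_tsupport fun h => hx (h3 h), zero_smul]).symm
      rw [e4]
      simp only [smul_sub]
      rw [integral_sub (i1 hG) (i1 hG'), sub_eq_zero]
      exact neg_injective (by rw [← e1, ← e2, e3])
  filter_upwards [ae_restrict_of_ae key, ae_restrict_mem hU.measurableSet] with x hx hxU
  exact sub_eq_zero.1 (hx hxU)

/-! ### Elements of Sobolev spaces -/

theorem Sobolev.memLp_fn {U : Set (E N)} {p : ℝ≥0∞} [Fact (1 ≤ p)] (v : Sobolev U p) :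
    MemLp v.fn p (volume.restrict U) :=
  Lp.memLp _

theorem Sobolev.memLp_grad {U : Set (E N)} {p : ℝ≥0∞} [Fact (1 ≤ p)] (v : Sobolev U p) :
    MemLp v.grad p (volume.restrict U) :=
  Lp.memLp _

theorem Sobolev.hasWeakGradient {U : Set (E N)} {p : ℝ≥0∞} [Fact (1 ≤ p)] (v : Sobolev U p) :
    HasWeakGradient U v.fn v.grad :=
  v.2

/-- The element of `W^{1,p}(U)` given by a function and its weak gradient. -/
def Sobolev.ofPair {U : Set (E N)} {p : ℝ≥0∞} [Fact (1 ≤ p)] {f : E N → ℝ} {G : E N → E N}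
    (hf : MemLp f p (volume.restrict U)) (hG : MemLp G p (volume.restrict U))
    (h : HasWeakGradient U f G) : Sobolev U p :=
  ⟨WithLp.toLp p (hf.toLp f, hG.toLp G), h.congr hf.coeFn_toLp.symm hG.coeFn_toLp.symm⟩

theorem Sobolev.fn_ofPair {U : Set (E N)} {p : ℝ≥0∞} [Fact (1 ≤ p)] {f : E N → ℝ}
    {G : E N → E N} (hf : MemLp f p (volume.restrict U)) (hG : MemLp G p (volume.restrict U))
    (h : HasWeakGradient U f G) : (Sobolev.ofPair hf hG h).fn =ᵐ[volume.restrict U] f :=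
  hf.coeFn_toLp

theorem Sobolev.grad_ofPair {U : Set (E N)} {p : ℝ≥0∞} [Fact (1 ≤ p)] {f : E N → ℝ}
    {G : E N → E N} (hf : MemLp f p (volume.restrict U)) (hG : MemLp G p (volume.restrict U))
    (h : HasWeakGradient U f G) : (Sobolev.ofPair hf hG h).grad =ᵐ[volume.restrict U] G :=
  hG.coeFn_toLp

theorem Sobolev.fn_add {U : Set (E N)} {p : ℝ≥0∞} [Fact (1 ≤ p)] (v w : Sobolev U p) :
    (v + w).fn =ᵐ[volume.restrict U] fun x => v.fn x + w.fn x :=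
  Lp.coeFn_add _ _

theorem Sobolev.grad_add {U : Set (E N)} {p : ℝ≥0∞} [Fact (1 ≤ p)] (v w : Sobolev U p) :
    (v + w).grad =ᵐ[volume.restrict U] fun x => v.grad x + w.grad x :=
  Lp.coeFn_add _ _

theorem Sobolev.fn_sub {U : Set (E N)} {p : ℝ≥0∞} [Fact (1 ≤ p)] (v w : Sobolev U p) :
    (v - w).fn =ᵐ[volume.restrict U] fun x => v.fn x - w.fn x :=
  Lp.coeFn_sub _ _

theorem Sobolev.fn_smul {U : Set (E N)} {p : ℝ≥0∞} [Fact (1 ≤ p)] (c : ℝ) (v : Sobolev U p) :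
    (c • v).fn =ᵐ[volume.restrict U] fun x => c * v.fn x :=
  Lp.coeFn_smul _ _

theorem Sobolev.grad_smul {U : Set (E N)} {p : ℝ≥0∞} [Fact (1 ≤ p)] (c : ℝ) (v : Sobolev U p) :
    (c • v).grad =ᵐ[volume.restrict U] fun x => c • v.grad x :=
  Lp.coeFn_smul _ _

theorem Sobolev.ext {U : Set (E N)} {p : ℝ≥0∞} [Fact (1 ≤ p)] {v w : Sobolev U p}
    (h1 : v.fn =ᵐ[volume.restrict U] w.fn) (h2 : v.grad =ᵐ[volume.restrict U] w.grad) :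
    v = w :=
  Subtype.ext (WithLp.ofLp_injective _ (Prod.ext (Lp.ext h1) (Lp.ext h2)))

theorem Sobolev.eLpNorm_fn_le {U : Set (E N)} {p : ℝ≥0∞} [Fact (1 ≤ p)] (v : Sobolev U p) :
    eLpNorm v.fn p (volume.restrict U) ≤ ‖v‖ₑ := by
  have : eLpNorm v.fn p (volume.restrict U) = ‖v.1.fst‖ₑ := (Lp.enorm_def _).symm
  rw [this]
  exact WithLp.enorm_fst_le _ v.1

theorem Sobolev.eLpNorm_grad_le {U : Set (E N)} {p : ℝ≥0∞} [Fact (1 ≤ p)] (v : Sobolev U p) :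
    eLpNorm v.grad p (volume.restrict U) ≤ ‖v‖ₑ := by
  have : eLpNorm v.grad p (volume.restrict U) = ‖v.1.snd‖ₑ := (Lp.enorm_def _).symm
  rw [this]
  exact WithLp.enorm_snd_le _ v.1

theorem Sobolev.enorm_le_of_one {U : Set (E N)} (v : Sobolev U 1) :
    ‖v‖ₑ ≤ eLpNorm v.fn 1 (volume.restrict U) + eLpNorm v.grad 1 (volume.restrict U) := by
  have h1 : eLpNorm v.fn 1 (volume.restrict U) = ‖v.1.fst‖ₑ := (Lp.enorm_def _).symm
  have h2 : eLpNorm v.grad 1 (volume.restrict U) = ‖v.1.snd‖ₑ := (Lp.enorm_def _).symm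
  have h3 : ‖v‖₊ = ‖v.1.fst‖₊ + ‖v.1.snd‖₊ := WithLp.prod_nnnorm_eq_of_L1 v.1
  rw [h1, h2]
  simp only [enorm, h3]
  push_cast
  rfl

/-- A continuous function is bounded on a bounded set. -/
theorem exists_bound_of_continuous {F : Type*} [NormedAddCommGroup F] {U : Set (E N)}
    (hU : Bornology.IsBounded U) {χ : E N → F} (hχ : Continuous χ) : ∃ C, ∀ x ∈ U, ‖χ x‖ ≤ C := by
  obtain ⟨C, hC⟩ := hU.isCompact_closure.exists_bound_of_continuousOn hχ.continuousOn
  exact ⟨C, fun x hx => hC x (subset_closure hx)⟩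

theorem memLp_top_of_continuous {F : Type*} [NormedAddCommGroup F] [SecondCountableTopology F]
    {U : Set (E N)} (hUm : MeasurableSet U) (hU : Bornology.IsBounded U) {χ : E N → F}
    (hχ : Continuous χ) : MemLp χ ∞ (volume.restrict U) := by
  obtain ⟨C, hC⟩ := exists_bound_of_continuous hU hχ
  exact memLp_top_of_bound hχ.aestronglyMeasurable C
    ((ae_restrict_iff' hUm).2 (Eventually.of_forall hC))

theorem memLp_smooth_mul {U : Set (E N)} (hUm : MeasurableSet U) (hU : Bornology.IsBounded U)
    {p : ℝ≥0∞} {f : E N → ℝ} (hf : MemLp f p (volume.restrict U)) {χ : E N → ℝ}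
    (hχ : ContDiff ℝ ∞ χ) : MemLp (fun x => χ x * f x) p (volume.restrict U) :=
  hf.mul (memLp_top_of_continuous hUm hU hχ.continuous)

theorem memLp_smooth_mul_grad {U : Set (E N)} (hUm : MeasurableSet U)
    (hU : Bornology.IsBounded U) {p : ℝ≥0∞} {f : E N → ℝ} {G : E N → E N}
    (hf : MemLp f p (volume.restrict U)) (hG : MemLp G p (volume.restrict U)) {χ : E N → ℝ}
    (hχ : ContDiff ℝ ∞ χ) :
    MemLp (fun x => χ x • G x + f x • gradient χ x) p (volume.restrict U) :=
  (hG.smul (memLp_top_of_continuous hUm hU hχ.continuous)).add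
    ((memLp_top_of_continuous hUm hU (continuous_gradient hχ)).smul hf)

/-- Multiplication of a Sobolev function by a smooth function. -/
def Sobolev.smoothMul {U : Set (E N)} (hUm : MeasurableSet U) (hU : Bornology.IsBounded U)
    {p : ℝ≥0∞} [Fact (1 ≤ p)] {χ : E N → ℝ} (hχ : ContDiff ℝ ∞ χ) (v : Sobolev U p) :
    Sobolev U p :=
  Sobolev.ofPair (memLp_smooth_mul hUm hU v.memLp_fn hχ)
    (memLp_smooth_mul_grad hUm hU v.memLp_fn v.memLp_grad hχ)
    (v.hasWeakGradient.smooth_mul (v.memLp_fn.locallyIntegrable Fact.out)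
      (v.memLp_grad.locallyIntegrable Fact.out) hχ)

/-- Boundedness is wrapped in `Fact` so that instance search supplies the finite measure needed to
lower Lebesgue exponents. -/
instance isFiniteMeasure_restrict_of_isBounded {U : Set (E N)} [Fact (Bornology.IsBounded U)] :
    IsFiniteMeasure ((volume : Measure (E N)).restrict U) :=
  ⟨by simpa using (Fact.out : Bornology.IsBounded U).measure_lt_top⟩

/-! ### Graphs, epigraphs, and domains with Lipschitz boundary -/

/-- The component of `y` orthogonal to the unit vector `e`. -/
def orthComp (e y : E N) : E N := y - inner ℝ e y • e

theorem orthComp_sub (e y z : E N) : orthComp e (y - z) = orthComp e y - orthComp e z := by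
  simp only [orthComp, inner_sub_right, sub_smul]
  abel

theorem orthComp_smul (e z : E N) (t : ℝ) : orthComp e (t • z) = t • orthComp e z := by
  simp only [orthComp, inner_smul_right, smul_sub, mul_smul]

theorem norm_orthComp_le {e : E N} (he : ‖e‖ = 1) (y : E N) : ‖orthComp e y‖ ≤ ‖y‖ := by
  have h : ‖orthComp e y‖ ^ 2 = ‖y‖ ^ 2 - (inner ℝ e y) ^ 2 := by
    rw [orthComp, norm_sub_sq_real, inner_smul_right, norm_smul, he, real_inner_comm e y]
    simp
    ring
  exact abs_le_of_sq_le_sq' (by nlinarith [sq_nonneg (inner ℝ e y)]) (norm_nonneg _) |>.2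

theorem continuous_orthComp (e : E N) : Continuous (orthComp e) := by
  unfold orthComp
  fun_prop

/-- The region strictly above the graph of `h` in direction `e`. -/
def epigraph (e : E N) (h : E N → ℝ) : Set (E N) := {y | h (orthComp e y) < inner ℝ e y}

theorem isOpen_epigraph {e : E N} {h : E N → ℝ} (hh : Continuous h) : IsOpen (epigraph e h) :=
  isOpen_lt (hh.comp (continuous_orthComp e)) (by fun_prop)

/-- A smooth graph function is Lipschitz on a compact ball and extends from there to a globally
Lipschitz function. Nothing changes near the boundary point, because the orthogonal projection is
nonexpansive and sends the ball of radius `r` into that compact ball. -/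
theorem HasSmoothBoundary.hasLipschitzBoundary {U : Set (E N)} (hU : HasSmoothBoundary U) :
    HasLipschitzBoundary U := by
  intro x hx
  obtain ⟨e, he, h, hh, r, hr, H⟩ := hU x hx
  have h1 : LocallyLipschitz h := (hh.of_le (by simp)).locallyLipschitz
  obtain ⟨K, hK⟩ := (h1.locallyLipschitzOn
    (s := Metric.closedBall (orthComp e x) r)).exists_lipschitzOnWith_of_compact
    (isCompact_closedBall _ _)
  obtain ⟨k, hk, hkh⟩ := hK.extend_real
  refine ⟨e, he, k, ⟨K, hk⟩, r, hr, fun y hy => ?_⟩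
  rw [H y hy, hkh]
  rw [Metric.mem_closedBall, dist_eq_norm]
  change ‖orthComp e y - orthComp e x‖ ≤ r
  rw [← orthComp_sub]
  exact (norm_orthComp_le he _).trans (by rw [← dist_eq_norm]; exact (Metric.mem_ball.1 hy).le)

/-- Strictly above the graph a point lies in the open set U, so not on its boundary. Strictly below,
a whole neighbourhood misses U. -/
theorem eq_of_mem_frontier_graph {U : Set (E N)} (hU : IsOpen U) {x e : E N} {h : E N → ℝ}
    (hh : Continuous h) {r : ℝ}
    (H : ∀ y ∈ Metric.ball x r, y ∈ U ↔ h (y - inner ℝ e y • e) < inner ℝ e y) {y : E N}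
    (hy : y ∈ Metric.ball x r) (hyU : y ∈ frontier U) : h (orthComp e y) = inner ℝ e y := by
  rcases lt_trichotomy (h (orthComp e y)) (inner ℝ e y) with hlt | heq | hgt
  · have : y ∈ U := (H y hy).2 hlt
    exact absurd this (by rw [hU.frontier_eq] at hyU; exact hyU.2)
  · exact heq
  · exfalso
    have hopen : IsOpen {z | inner ℝ e z < h (orthComp e z)} :=
      isOpen_lt (by fun_prop) (hh.comp (continuous_orthComp e))
    obtain ⟨z, ⟨hz1, hz2⟩, hzU⟩ := mem_closure_iff.1 (frontier_subset_closure hyU) _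
      (hopen.inter Metric.isOpen_ball) ⟨hgt, hy⟩
    exact lt_asymm hz1 ((H z hz2).1 hzU)

/-- `Γ` is mapped into itself by all small translations by `-z`, where `z` ranges over balls
arbitrarily close to the origin. -/
def HasShiftDirections (Γ : Set (E N)) : Prop :=
  ∀ δ > 0, ∃ z₀ : E N, ∃ s > 0, Metric.ball z₀ s ⊆ Metric.ball 0 δ ∧
    ∀ z ∈ Metric.ball z₀ s, ∀ t ∈ Icc (0 : ℝ) 1, ∀ y ∈ Γ, y - t • z ∈ Γ

theorem hasShiftDirections_univ : HasShiftDirections (univ : Set (E N)) :=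
  fun δ hδ => ⟨0, δ, hδ, subset_rfl, fun _ _ _ _ _ _ => mem_univ _⟩

/-- Shifting by `-t • z` with z = p - a e raises the height by at least t(a - ‖p‖), while the graph
below rises by at most K t ‖p‖. With ‖p‖ ≤ a/(K+1) the gain dominates the loss, since K a/(K+1) = a
- a/(K+1). Taking a = δ/2 keeps the whole ball of directions inside the ball of radius δ. -/
theorem hasShiftDirections_epigraph {e : E N} (he : ‖e‖ = 1) {h : E N → ℝ} {K : NNReal}
    (hh : LipschitzWith K h) : HasShiftDirections (epigraph e h) := by
  intro δ hδ
  set a := δ / 2 with ha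
  have hK : (0 : ℝ) < K + 1 := by positivity
  have hsa : a / (K + 1) ≤ a := div_le_self (by positivity) (by simp)
  refine ⟨-(a • e), a / (K + 1), by positivity, ?_, ?_⟩
  · refine Metric.ball_subset_ball' ?_
    rw [dist_zero_right, norm_neg, norm_smul, he, Real.norm_of_nonneg (by positivity)]
    linarith
  · intro z hz t ht y hy
    rw [epigraph, mem_ofPred_eq] at hy ⊢
    set p := z + a • e with hp
    have hpn : ‖p‖ ≤ a / (K + 1) := by
      rw [Metric.mem_ball, dist_eq_norm, sub_neg_eq_add] at hz
      exact hz.le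
    have hz' : z = p - a • e := by rw [hp]; abel
    have hee : inner ℝ e e = (1 : ℝ) := by rw [real_inner_self_eq_norm_sq, he, one_pow]
    have hPe : orthComp e (a • e) = 0 := by
      rw [orthComp, inner_smul_right, hee, mul_one, sub_self]
    have hPz : orthComp e z = orthComp e p := by rw [hz', orthComp_sub, hPe, sub_zero]
    have hPz' : ‖orthComp e z‖ ≤ a / (K + 1) := by
      rw [hPz]; exact (norm_orthComp_le he p).trans hpn
    have hez : inner ℝ e z ≤ a / (K + 1) - a := by
      rw [hz', inner_sub_right, inner_smul_right, hee, mul_one]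
      have := real_inner_le_norm e p
      rw [he, one_mul] at this
      linarith
    have h1 : h (orthComp e (y - t • z)) - h (orthComp e y) ≤ K * (t * (a / (K + 1))) := by
      refine (le_abs_self _).trans ?_
      rw [← Real.dist_eq]
      refine (hh.dist_le_mul _ _).trans ?_
      rw [orthComp_sub, dist_eq_norm, sub_sub_cancel_left, norm_neg, orthComp_smul, norm_smul,
        Real.norm_of_nonneg ht.1]
      gcongr
      exact ht.1
    have h2 : K * (a / (K + 1)) = a - a / (K + 1) := by
      field_simp
      ring
    rw [inner_sub_right, inner_smul_right]
    have h3 : K * (t * (a / (K + 1))) = t * (a - a / (K + 1)) := by rw [← h2]; ring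
    have h4 : t * inner ℝ e z ≤ t * (a / (K + 1) - a) := mul_le_mul_of_nonneg_left hez ht.1
    nlinarith

/-- Near each point of its closure, a domain with Lipschitz boundary agrees with a set that is
invariant under small translations in an open cone of directions. -/
theorem HasLipschitzBoundary.exists_patch {U : Set (E N)} (hU : IsOpen U)
    (hL : HasLipschitzBoundary U) {x : E N} (hx : x ∈ closure U) :
    ∃ r > 0, ∃ Γ : Set (E N), IsOpen Γ ∧ HasShiftDirections Γ ∧
      U ∩ Metric.ball x r = Γ ∩ Metric.ball x r := by
  by_cases hxU : x ∈ U
  · obtain ⟨r, hr, hrU⟩ := Metric.isOpen_iff.1 hU x hxU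
    exact ⟨r, hr, univ, isOpen_univ, hasShiftDirections_univ,
      by rw [univ_inter, inter_eq_right.2 hrU]⟩
  · obtain ⟨e, he, h, ⟨K, hK⟩, r, hr, H⟩ := hL x (by rw [hU.frontier_eq]; exact ⟨hx, hxU⟩)
    refine ⟨r, hr, epigraph e h, isOpen_epigraph hK.continuous,
      hasShiftDirections_epigraph he hK, ?_⟩
    ext y
    exact and_congr_left fun hy => H y hy

/-! ### Traces on Lipschitz graphs -/

/-- The linear isomorphism `(z, t) ↦ z + t e` from `e^⊥ × ℝ` to the whole space. -/
def orthProdEquiv {e : E N} (he : ‖e‖ = 1) : ((ℝ ∙ e)ᗮ × ℝ) ≃L[ℝ] E N :=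
  LinearEquiv.toContinuousLinearEquiv <| LinearEquiv.ofLinearMap
    ((ℝ ∙ e)ᗮ.subtype.coprod (LinearMap.toSpanSingleton ℝ (E N) e))
    (LinearMap.prod
      (LinearMap.codRestrict (ℝ ∙ e)ᗮ (LinearMap.id - (innerₛₗ ℝ e).smulRight e) fun y => by
        rw [Submodule.mem_orthogonal_singleton_iff_inner_right]
        simp [inner_sub_right, inner_smul_right, he])
      (innerₛₗ ℝ e))
    (by ext y; simp)
    (by
      have hz : ∀ z : (ℝ ∙ e)ᗮ, inner ℝ e (z : E N) = 0 := fun z =>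
        Submodule.mem_orthogonal_singleton_iff_inner_right.1 z.2
      refine LinearMap.ext fun ⟨z, t⟩ => Prod.ext (Subtype.ext ?_) ?_ <;>
        simp [inner_add_right, inner_smul_right, hz, he])

theorem orthProdEquiv_apply {e : E N} (he : ‖e‖ = 1) (z : (ℝ ∙ e)ᗮ) (t : ℝ) :
    orthProdEquiv he (z, t) = z + t • e := by
  simp [orthProdEquiv]

/-- The fundamental theorem of calculus along the ray going up from the point; compact support
removes the contribution at infinity. -/
theorem enorm_le_lintegral_ray {e : E N} (he : ‖e‖ = 1) {ψ : E N → ℝ} (hψ : ContDiff ℝ ∞ ψ)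
    (hc : HasCompactSupport ψ) (z : E N) (a : ℝ) :
    ‖ψ (z + a • e)‖ₑ ≤ ∫⁻ t in Ioi a, ‖gradient ψ (z + t • e)‖ₑ := by
  have hline : ContDiff ℝ ∞ fun s : ℝ => z - s • e := by fun_prop
  have hemb : IsClosedEmbedding fun s : ℝ => z - s • e := by
    have he0 : e ≠ 0 := by rintro rfl; simp at he
    have h1 : IsClosedEmbedding fun s : ℝ => s • e := isClosedEmbedding_smul_left he0
    exact (Homeomorph.subLeft z).isClosedEmbedding.comp h1
  -- The ray is run backwards, s = -t, because the one-dimensional estimate integrates over a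
  -- half-line `Iic`; the reflection is undone in `hneg`.
  have hf : ContDiff ℝ 1 fun s : ℝ => ψ (z - s • e) := (hψ.comp hline).of_le (by simp)
  have key := HasCompactSupport.enorm_le_lintegral_Ici_deriv hf
    (hc.comp_isClosedEmbedding hemb) (-a)
  have hd : ∀ s : ℝ, ‖deriv (fun s : ℝ => ψ (z - s • e)) s‖ₑ
      ≤ ‖gradient ψ (z + (-s) • e)‖ₑ := by
    intro s
    have h1 : HasDerivAt (fun s : ℝ => z - s • e) (-e) s := by
      simpa using ((hasDerivAt_id s).smul_const e).const_sub z
    have h2 := ((hψ.differentiable (by simp) (z - s • e)).hasFDerivAt).comp_hasDerivAt s h1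
    have h3 : deriv (fun s : ℝ => ψ (z - s • e)) s = fderiv ℝ ψ (z - s • e) (-e) := h2.deriv
    rw [h3, neg_smul, ← sub_eq_add_neg, enorm_le_iff_norm_le, norm_gradient]
    simpa [he] using (fderiv ℝ ψ (z - s • e)).le_opNorm (-e)
  have hneg := (Measure.measurePreserving_neg (volume : Measure ℝ)).setLIntegral_comp_preimage
    (s := Ici a) measurableSet_Ici
    (f := fun t => ‖gradient ψ (z + t • e)‖ₑ)
    (((continuous_gradient hψ).comp (by fun_prop)).enorm.measurable)
  have hset : (Neg.neg ⁻¹' Ici a : Set ℝ) = Iic (-a) := by ext; simp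
  rw [hset] at hneg
  rw [sub_eq_add_neg, ← neg_smul, neg_neg] at key
  refine (key.trans (lintegral_mono hd)).trans ?_
  rw [hneg, setLIntegral_congr Ioi_ae_eq_Ici]

/-- The value at each graph point is bounded by the integral of the gradient along the ray above it,
and these rays sweep out the epigraph. The Lipschitz parametrisation of the graph over e^⊥ increases
(N-1)-dimensional measure by at most (1+K)^(N-1), and Fubini turns the iterated integral over e^⊥
and the rays into a volume integral. -/
theorem lintegral_graph_le {e : E N} (he : ‖e‖ = 1) {h : E N → ℝ} {K : NNReal}
    (hh : LipschitzWith K h) : ∃ C : ℝ≥0∞, C ≠ ⊤ ∧ ∀ ψ : E N → ℝ, ContDiff ℝ ∞ ψ →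
      HasCompactSupport ψ →
      ∫⁻ y in {y | h (orthComp e y) = inner ℝ e y}, ‖ψ y‖ₑ
          ∂(Measure.euclideanHausdorffMeasure (N - 1))
        ≤ C * ∫⁻ y in epigraph e h, ‖gradient ψ y‖ₑ := by
  have he0 : e ≠ 0 := by rintro rfl; simp at he
  obtain ⟨n, rfl⟩ : ∃ n, N = n + 1 := by
    refine Nat.exists_eq_succ_of_ne_zero ?_
    rintro rfl
    exact he0 (Subsingleton.elim _ _)
  have hfin : Module.finrank ℝ (ℝ ∙ e)ᗮ = n := by
    have : Fact (Module.finrank ℝ (E (n + 1)) = n + 1) := ⟨by simp⟩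
    exact Submodule.finrank_orthogonal_span_singleton he0
  let ν : Measure (ℝ ∙ e)ᗮ := Measure.euclideanHausdorffMeasure n
  have : ν.IsAddHaarMeasure := by
    have := isAddHaarMeasure_euclideanHausdorffMeasure (E := (ℝ ∙ e)ᗮ)
    rwa [hfin] at this
  rw [Nat.add_sub_cancel]
  set S : Set (E (n + 1)) := {y | h (orthComp e y) = inner ℝ e y} with hS
  have hz : ∀ z : (ℝ ∙ e)ᗮ, inner ℝ e (z : E (n + 1)) = 0 := fun z =>
    Submodule.mem_orthogonal_singleton_iff_inner_right.1 z.2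
  have hee : inner ℝ e e = (1 : ℝ) := by rw [real_inner_self_eq_norm_sq, he, one_pow]
  -- the parametrisation of the graph
  let γ : (ℝ ∙ e)ᗮ → E (n + 1) := fun z => z + h z • e
  have hγ : LipschitzWith (1 + K) γ := by
    have h1 : LipschitzWith 1 (fun z : (ℝ ∙ e)ᗮ => (z : E (n + 1))) := LipschitzWith.subtype_val _
    have h2 : LipschitzWith K fun z : (ℝ ∙ e)ᗮ => h z • e := by
      refine LipschitzWith.of_dist_le_mul fun x y => ?_
      rw [dist_eq_norm, ← sub_smul, norm_smul, he, mul_one, ← dist_eq_norm]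
      exact hh.dist_le_mul _ _
    exact h1.add h2
  have hSγ : ∀ A : Set (E (n + 1)), A ∩ S ⊆ γ '' (γ ⁻¹' A) := by
    rintro A y ⟨hyA, hyS⟩
    have hmem : orthComp e y ∈ (ℝ ∙ e)ᗮ := by
      rw [Submodule.mem_orthogonal_singleton_iff_inner_right, orthComp, inner_sub_right,
        inner_smul_right, hee, mul_one, sub_self]
    have hy : γ ⟨orthComp e y, hmem⟩ = y := by
      change orthComp e y + h (orthComp e y) • e = y
      rw [show h (orthComp e y) = inner ℝ e y from hyS, orthComp, sub_add_cancel]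
    exact ⟨⟨orthComp e y, hmem⟩, by rw [mem_preimage, hy]; exact hyA, hy⟩
  have hmeas : (Measure.euclideanHausdorffMeasure n : Measure (E (n + 1))).restrict S
      ≤ ((1 + K : NNReal) ^ (n : ℝ) : ℝ≥0∞) • Measure.map γ ν := by
    refine Measure.le_iff.2 fun A hA => ?_
    rw [Measure.restrict_apply hA, Measure.smul_apply, Measure.map_apply hγ.continuous.measurable hA]
    refine (measure_mono (hSγ A)).trans ?_
    have h1 := hγ.hausdorffMeasure_image_le (d := (n : ℝ)) (by positivity) (γ ⁻¹' A)
    simp only [ν, Measure.euclideanHausdorffMeasure_def, Measure.smul_apply, ENNReal.smul_def,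
      smul_eq_mul] at h1 ⊢
    rw [mul_left_comm]
    gcongr
  -- Fubini
  let Φ := orthProdEquiv he
  -- The product measure, transported to the whole space, is again a Haar measure, hence a multiple
  -- of Lebesgue measure. The factor only has to be finite, so its value is not computed.
  have hΦ : Measure.map Φ (ν.prod volume) = (Measure.map Φ (ν.prod volume)).addHaarScalarFactor
      volume • (volume : Measure (E (n + 1))) := by
    have : (Measure.map Φ (ν.prod volume)).IsAddHaarMeasure := Φ.isAddHaarMeasure_map _
    exact Measure.isAddLeftInvariant_eq_smul _ _
  set c := (Measure.map Φ (ν.prod volume)).addHaarScalarFactor (volume : Measure (E (n + 1)))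
  refine ⟨((1 + K : NNReal) ^ (n : ℝ) : ℝ≥0∞) * c, ENNReal.mul_ne_top
    (ENNReal.rpow_ne_top_of_nonneg (by positivity) ENNReal.coe_ne_top) ENNReal.coe_ne_top, ?_⟩
  intro ψ hψ hc
  have hψm : Measurable fun y => ‖ψ y‖ₑ := hψ.continuous.enorm.measurable
  have hgm : Measurable ((epigraph e h).indicator fun y => ‖gradient ψ y‖ₑ) :=
    (continuous_gradient hψ).enorm.measurable.indicator
      (isOpen_epigraph hh.continuous).measurableSet
  have hpt : ∀ z : (ℝ ∙ e)ᗮ, ‖ψ (γ z)‖ₑ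
      ≤ ∫⁻ t, (epigraph e h).indicator (fun y => ‖gradient ψ y‖ₑ) (Φ (z, t)) := by
    intro z
    refine (enorm_le_lintegral_ray he hψ hc z (h z)).trans (le_of_eq ?_)
    rw [← lintegral_indicator measurableSet_Ioi]
    congr 1 with t
    have hin : inner ℝ e ((z : E (n + 1)) + t • e) = t := by
      rw [inner_add_right, inner_smul_right, hz, hee, mul_one, zero_add]
    have hiff : Φ (z, t) ∈ epigraph e h ↔ t ∈ Ioi (h z) := by
      simp only [Φ, orthProdEquiv_apply, epigraph, mem_ofPred_eq, mem_Ioi, orthComp, hin,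
        add_sub_cancel_right]
    by_cases ht : t ∈ Ioi (h z)
    · rw [indicator_of_mem ht, indicator_of_mem (hiff.2 ht), orthProdEquiv_apply]
    · rw [indicator_of_notMem ht, indicator_of_notMem (fun h' => ht (hiff.1 h'))]
  calc ∫⁻ y in S, ‖ψ y‖ₑ ∂(Measure.euclideanHausdorffMeasure n)
      ≤ ((1 + K : NNReal) ^ (n : ℝ) : ℝ≥0∞) * ∫⁻ z, ‖ψ (γ z)‖ₑ ∂ν := by
        refine (lintegral_mono' hmeas le_rfl).trans ?_
        rw [lintegral_smul_measure, lintegral_map hψm hγ.continuous.measurable, smul_eq_mul]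
    _ ≤ ((1 + K : NNReal) ^ (n : ℝ) : ℝ≥0∞) * ∫⁻ z, (∫⁻ t,
          (epigraph e h).indicator (fun y => ‖gradient ψ y‖ₑ) (Φ (z, t))) ∂ν := by
        gcongr with z
        exact hpt z
    _ = ((1 + K : NNReal) ^ (n : ℝ) : ℝ≥0∞) * ∫⁻ y,
          (epigraph e h).indicator (fun y => ‖gradient ψ y‖ₑ) y
            ∂(Measure.map Φ (ν.prod volume)) := by
        rw [lintegral_map hgm Φ.continuous.measurable, lintegral_prod
          (fun p => (epigraph e h).indicator (fun y => ‖gradient ψ y‖ₑ) (Φ p))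
          (hgm.comp Φ.continuous.measurable).aemeasurable]
    _ = _ := by
        rw [hΦ, lintegral_smul_measure, lintegral_indicator
          (isOpen_epigraph hh.continuous).measurableSet, ENNReal.smul_def, smul_eq_mul, mul_assoc]

/-- The trace inequality in `W^{1,1}` for functions that are smooth up to the boundary. -/
theorem HasLipschitzBoundary.lintegral_frontier_le {U : Set (E N)} (hU : IsOpen U)
    (hb : Bornology.IsBounded U) (hL : HasLipschitzBoundary U) :
    ∃ C : ℝ≥0∞, C ≠ ⊤ ∧ ∀ φ : E N → ℝ, ContDiff ℝ ∞ φ →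
      ∫⁻ y, ‖φ y‖ₑ ∂(surf (frontier U))
        ≤ C * ((∫⁻ y in U, ‖φ y‖ₑ) + ∫⁻ y in U, ‖gradient φ y‖ₑ) := by
  have hK : IsCompact (frontier U) :=
    hb.isCompact_closure.of_isClosed_subset isClosed_frontier frontier_subset_closure
  -- By compactness the estimate need only hold near each boundary point: it passes to subsets and,
  -- adding constants, to unions.
  have main := hK.induction_on (p := fun S => ∃ C : ℝ≥0∞, C ≠ ⊤ ∧ ∀ φ : E N → ℝ, ContDiff ℝ ∞ φ →
      ∫⁻ y in S ∩ frontier U, ‖φ y‖ₑ ∂(Measure.euclideanHausdorffMeasure (N - 1))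
        ≤ C * ((∫⁻ y in U, ‖φ y‖ₑ) + ∫⁻ y in U, ‖gradient φ y‖ₑ))
    ⟨0, by simp, by simp⟩
    (fun S T hST ⟨C, hC, h⟩ => ⟨C, hC, fun φ hφ =>
      (lintegral_mono_set (inter_subset_inter_left _ hST)).trans (h φ hφ)⟩)
    (fun S T ⟨C, hC, h⟩ ⟨C', hC', h'⟩ => ⟨C + C', ENNReal.add_ne_top.2 ⟨hC, hC'⟩, fun φ hφ => by
      rw [union_inter_distrib_right, add_mul]
      exact (lintegral_union_le _ _ _).trans (add_le_add (h φ hφ) (h' φ hφ))⟩)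
    (fun x hx => by
      obtain ⟨e, he, h, ⟨K, hh⟩, r, hr, H⟩ := hL x hx
      obtain ⟨C, hC, hCψ⟩ := lintegral_graph_le he hh
      let χ : ContDiffBump x := ⟨r / 2, 3 * r / 4, by positivity, by linarith⟩
      have hχs : ContDiff ℝ ∞ χ := χ.contDiff
      obtain ⟨M, hM⟩ := (hasCompactSupport_gradient χ.hasCompactSupport).exists_bound_of_continuous
        (continuous_gradient hχs)
      have hM' : ∀ y, ‖gradient χ y‖ₑ ≤ ENNReal.ofReal M := fun y => by
        rw [← ofReal_norm]
        exact ENNReal.ofReal_le_ofReal (hM y)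
      have hsub : tsupport χ ⊆ Metric.ball x r := by
        rw [χ.tsupport_eq]
        exact Metric.closedBall_subset_ball (by change 3 * r / 4 < r; linarith)
      refine ⟨Metric.ball x (r / 2), mem_nhdsWithin_of_mem_nhds (Metric.ball_mem_nhds _ (by positivity)),
        C * (ENNReal.ofReal M + 1), ENNReal.mul_ne_top hC (by simp), fun φ hφ => ?_⟩
      have hψ : ContDiff ℝ ∞ fun y => χ y * φ y := hχs.mul hφ
      have hψc : HasCompactSupport fun y => χ y * φ y :=
        HasCompactSupport.mul_right (f := χ) χ.hasCompactSupport
      have hψg : ∀ y, ‖gradient (fun y => χ y * φ y) y‖ₑ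
          ≤ ENNReal.ofReal M * ‖φ y‖ₑ + ‖gradient φ y‖ₑ := fun y => by
        rw [gradient_mul hχs hφ, add_comm]
        refine (enorm_add_le _ _).trans (add_le_add ?_ ?_)
        · rw [enorm_smul, mul_comm]
          gcongr
          exact hM' y
        · rw [enorm_smul]
          refine mul_le_of_le_one_left' ?_
          rw [← ofReal_norm, Real.norm_of_nonneg χ.nonneg]
          exact ENNReal.ofReal_le_one.2 χ.le_one
      calc ∫⁻ y in Metric.ball x (r / 2) ∩ frontier U, ‖φ y‖ₑ
            ∂(Measure.euclideanHausdorffMeasure (N - 1))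
          = ∫⁻ y in Metric.ball x (r / 2) ∩ frontier U, ‖χ y * φ y‖ₑ
            ∂(Measure.euclideanHausdorffMeasure (N - 1)) := by
            refine setLIntegral_congr_fun
              (Metric.isOpen_ball.measurableSet.inter isClosed_frontier.measurableSet) fun y hy => ?_
            simp only [χ.one_of_mem_closedBall (Metric.ball_subset_closedBall hy.1), one_mul]
        _ ≤ ∫⁻ y in {y | h (orthComp e y) = inner ℝ e y}, ‖χ y * φ y‖ₑ
            ∂(Measure.euclideanHausdorffMeasure (N - 1)) :=
            lintegral_mono_set fun y hy => eq_of_mem_frontier_graph hU hh.continuous H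
              (Metric.ball_subset_ball (by linarith) hy.1) hy.2
        _ ≤ C * ∫⁻ y in epigraph e h, ‖gradient (fun y => χ y * φ y) y‖ₑ := hCψ _ hψ hψc
        -- Inside the ball the epigraph and U coincide; outside it the gradient of χφ vanishes.
        _ ≤ C * ∫⁻ y in U, ‖gradient (fun y => χ y * φ y) y‖ₑ := by
            gcongr 1
            rw [← lintegral_indicator (isOpen_epigraph hh.continuous).measurableSet,
              ← lintegral_indicator hU.measurableSet]
            refine lintegral_mono fun y => ?_
            by_cases hyB : y ∈ Metric.ball x r
            · by_cases hyU : y ∈ U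
              · rw [indicator_of_mem hyU]
                exact indicator_le_self _ _ _
              · have hyE : y ∉ epigraph e h := fun h' => hyU ((H y hyB).2 h')
                rw [indicator_of_notMem hyE]
                exact zero_le
            · refine (indicator_le_self _ _ _).trans ?_
              rw [gradient_eq_zero_of_notMem_tsupport
                fun h' => hyB (hsub (tsupport_mul_subset h').1), enorm_zero]
              exact zero_le
        _ ≤ C * ∫⁻ y in U, ((ENNReal.ofReal M + 1) * ‖φ y‖ₑ
              + (ENNReal.ofReal M + 1) * ‖gradient φ y‖ₑ) := by
            gcongr with y
            refine (hψg y).trans (add_le_add ?_ ?_)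
            · gcongr
              exact le_self_add
            · exact le_mul_of_one_le_left' (by simp)
        _ = _ := by
            rw [lintegral_add_left (hφ.continuous.enorm.measurable.const_mul _),
              lintegral_const_mul _ hφ.continuous.enorm.measurable,
              lintegral_const_mul _ (continuous_gradient hφ).enorm.measurable, ← mul_add, mul_assoc])
  simpa only [inter_self, surf] using main

/-! ### Mollification by kernels supported in shift directions -/

/-- A mollification kernel at scale `δ` all of whose shifts preserve `Γ`. -/
structure IsShiftKernel (Γ : Set (E N)) (δ : ℝ) (k : E N → ℝ) : Prop where
  contDiff : ContDiff ℝ ∞ k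
  hasCompactSupport : HasCompactSupport k
  nonneg : ∀ z, 0 ≤ k z
  integral_eq_one : ∫ z, k z = 1
  tsupport_subset : tsupport k ⊆ Metric.ball 0 δ
  shift : ∀ z ∈ tsupport k, ∀ t ∈ Icc (0 : ℝ) 1, ∀ y ∈ Γ, y - t • z ∈ Γ

/-- A normalised bump centred at `z₀`, the centre of the ball of admissible directions, instead of
at the origin. -/
theorem HasShiftDirections.exists_kernel {Γ : Set (E N)} (hΓ : HasShiftDirections Γ) {δ : ℝ}
    (hδ : 0 < δ) : ∃ k : E N → ℝ, IsShiftKernel Γ δ k := by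
  obtain ⟨z₀, s, hs, hsub, H⟩ := hΓ δ hδ
  let χ : ContDiffBump z₀ := ⟨s / 3, s / 2, by positivity, by linarith⟩
  have ht : tsupport (χ.normed volume) ⊆ Metric.ball z₀ s := by
    rw [χ.tsupport_normed_eq]
    exact Metric.closedBall_subset_ball (by change s / 2 < s; linarith)
  exact ⟨χ.normed volume, χ.contDiff_normed, χ.hasCompactSupport_normed, χ.nonneg_normed,
    χ.integral_normed, ht.trans hsub, fun z hz => H z (ht hz)⟩

/-- The convolution `(k ⋆ w)(y) = ∫ k(t) w(y - t) dt`. -/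
def mollify {F : Type*} [NormedAddCommGroup F] [NormedSpace ℝ F] (k : E N → ℝ) (w : E N → F) :
    E N → F :=
  fun y => ∫ t, k t • w (y - t)

theorem contDiff_mollify {k : E N → ℝ} (hk : ContDiff ℝ ∞ k) (hc : HasCompactSupport k)
    {w : E N → ℝ} (hw : LocallyIntegrable w) : ContDiff ℝ ∞ (mollify k w) :=
  hc.contDiff_convolution_left (ContinuousLinearMap.lsmul ℝ ℝ) hk hw

theorem integrable_mollify_integrand {F : Type*} [NormedAddCommGroup F] [NormedSpace ℝ F]
    {k : E N → ℝ} (hk : Continuous k) (hc : HasCompactSupport k) {w : E N → F}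
    (hw : LocallyIntegrable w) (y : E N) : Integrable fun t => k t • w (y - t) :=
  hc.convolutionExists_left (ContinuousLinearMap.lsmul ℝ ℝ) hk hw y

theorem hasGradientAt_mollify {k : E N → ℝ} (hk : ContDiff ℝ ∞ k) (hc : HasCompactSupport k)
    {w : E N → ℝ} (hw : LocallyIntegrable w) (y : E N) :
    HasGradientAt (mollify k w) (∫ t, w (y - t) • gradient k t) y := by
  have h := hc.hasFDerivAt_convolution_left (ContinuousLinearMap.lsmul ℝ ℝ)
    (hk.of_le (by simp)) hw y
  rw [hasGradientAt_iff_hasFDerivAt]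
  convert! h using 1
  rw [← LinearIsometryEquiv.coe_toContinuousLinearEquiv, ← ContinuousLinearEquiv.integral_comp_comm]
  refine integral_congr_ae (Eventually.of_forall fun t => ?_)
  ext v
  simp [mul_comm]

/-- The gradient of a mollification is the mollification of the weak gradient, at each point `y`
for which `k(y - ·)` is supported in `Γ`. -/
theorem HasWeakGradient.gradient_mollify_of_tsupport {Γ : Set (E N)} {k : E N → ℝ}
    (hk : ContDiff ℝ ∞ k) (hc : HasCompactSupport k) {w : E N → ℝ} {W : E N → E N}
    (h : HasWeakGradient Γ w W) (hw : LocallyIntegrable w) {y : E N}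
    (hts : tsupport (fun x => k (y - x)) ⊆ Γ) :
    gradient (mollify k w) y = mollify k W y := by
  rw [(hasGradientAt_mollify hk hc hw y).gradient]
  let φ : E N → ℝ := fun x => k (y - x)
  have hφ : ContDiff ℝ ∞ φ := hk.comp (by fun_prop)
  have hφc : HasCompactSupport φ := hc.comp_homeomorph (Homeomorph.subLeft y)
  have hgr : ∀ x, gradient φ x = - gradient k (y - x) := fun x => by
    apply HasGradientAt.gradient
    rw [hasGradientAt_iff_hasFDerivAt, map_neg]
    have h1 := hasGradientAt_iff_hasFDerivAt.1 (hasGradientAt_of_contDiff hk (y - x))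
    have h2 : HasFDerivAt (fun x : E N => y - x) (-ContinuousLinearMap.id ℝ (E N)) x :=
      (hasFDerivAt_id x).const_sub y
    convert! h1.comp x h2 using 1
    ext v
    simp
  have key := h φ hφ hφc hts
  rw [setIntegral_eq_integral_of_forall_compl_eq_zero fun x hx => by
      rw [gradient_eq_zero_of_notMem_tsupport fun h' => hx (hts h'), smul_zero],
    setIntegral_eq_integral_of_forall_compl_eq_zero fun x hx => by
      rw [image_eq_zero_of_notMem_tsupport (f := φ) fun h' => hx (hts h'), zero_smul]] at key
  simp only [hgr, smul_neg, integral_neg, neg_inj] at key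
  rw [mollify, ← integral_sub_left_eq_self (fun t => w (y - t) • gradient k t) volume y,
    ← integral_sub_left_eq_self (fun t => k t • W (y - t)) volume y]
  simpa only [sub_sub_cancel] using key

/-- Mollification along shift directions commutes with the weak gradient on `Γ`. -/
theorem HasWeakGradient.gradient_mollify {Γ : Set (E N)} {δ : ℝ} {k : E N → ℝ}
    (hk : IsShiftKernel Γ δ k) {w : E N → ℝ} {W : E N → E N} (h : HasWeakGradient Γ w W)
    (hw : LocallyIntegrable w) {y : E N} (hy : y ∈ Γ) :
    gradient (mollify k w) y = mollify k W y := by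
  refine h.gradient_mollify_of_tsupport hk.contDiff hk.hasCompactSupport hw fun x hx => ?_
  have h1 : y - x ∈ tsupport k :=
    tsupport_comp_subset_preimage k (f := fun x => y - x) (by fun_prop) hx
  simpa using hk.shift _ h1 1 ⟨zero_le_one, le_rfl⟩ y hy

/-! ### Convergence of mollifications in `L^1` -/

/-- Continuity of translations in L^1. The sign in `DomAddAct.mk (-t)` arises because this action
precomposes with addition. -/
theorem exists_eLpNorm_translate_le {F : Type*} [NormedAddCommGroup F] {w : E N → F}
    (hw : MemLp w 1 volume) {ε : ℝ≥0∞} (hε : ε ≠ 0) :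
    ∃ δ > 0, ∀ t : E N, ‖t‖ < δ → eLpNorm (fun y => w (y - t) - w y) 1 volume ≤ ε := by
  have : Fact ((1 : ℝ≥0∞) ≠ ⊤) := ⟨by simp⟩
  have hcont : Continuous fun t : E N => DomAddAct.mk (-t) +ᵥ hw.toLp w :=
    Continuous.vadd (DomAddAct.continuous_mk.comp continuous_neg) continuous_const
  have hev := hcont.tendsto 0 (Metric.closedEBall_mem_nhds _ (pos_iff_ne_zero.2 hε))
  obtain ⟨δ, hδ, H⟩ := Metric.eventually_nhds_iff.1 hev
  refine ⟨δ, hδ, fun t ht => ?_⟩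
  have h1 : DomAddAct.mk (-t) +ᵥ hw.toLp w ∈
      Metric.closedEBall (DomAddAct.mk (-0 : E N) +ᵥ hw.toLp w) ε := H (by rwa [dist_zero_right])
  rw [Metric.mem_closedEBall, neg_zero, DomAddAct.mk_vadd_toLp, DomAddAct.mk_vadd_toLp,
    Lp.edist_toLp_toLp] at h1
  refine le_trans (le_of_eq ?_) h1
  congr 1
  ext y
  simp [sub_eq_neg_add]

/-- Since `k` is a probability density, the error is an average of the differences w(· - t) - w over
‖t‖ < δ; exchanging the integrals bounds its norm by ε. -/
theorem eLpNorm_mollify_sub_le {F : Type*} [NormedAddCommGroup F] [NormedSpace ℝ F]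
    [CompleteSpace F] {w : E N → F} (hw : MemLp w 1 volume) {ε : ℝ≥0∞} {δ : ℝ}
    (hδ : ∀ t : E N, ‖t‖ < δ → eLpNorm (fun y => w (y - t) - w y) 1 volume ≤ ε)
    {Γ : Set (E N)} {k : E N → ℝ} (hk : IsShiftKernel Γ δ k) :
    eLpNorm (fun y => mollify k w y - w y) 1 volume ≤ ε := by
  have hli : LocallyIntegrable w := hw.locallyIntegrable le_rfl
  have hki : Integrable k := hk.contDiff.continuous.integrable_of_hasCompactSupport
    hk.hasCompactSupport
  have hk1 : ∫⁻ t, ‖k t‖ₑ = 1 := by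
    have := ofReal_integral_norm_eq_lintegral_enorm hki
    rw [← this]
    simp [Real.norm_of_nonneg (hk.nonneg _), hk.integral_eq_one]
  have hpt : ∀ y, ‖mollify k w y - w y‖ₑ ≤ ∫⁻ t, ‖k t‖ₑ * ‖w (y - t) - w y‖ₑ := by
    intro y
    have e1 : mollify k w y - w y = ∫ t, k t • (w (y - t) - w y) := by
      simp only [smul_sub]
      rw [integral_sub (integrable_mollify_integrand hk.contDiff.continuous hk.hasCompactSupport
        hli y) (hki.smul_const _), integral_smul_const, hk.integral_eq_one, one_smul, mollify]
    rw [e1]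
    refine (enorm_integral_le_lintegral_enorm _).trans (le_of_eq ?_)
    simp only [enorm_smul]
  have hm : AEMeasurable (Function.uncurry fun y t => ‖k t‖ₑ * ‖w (y - t) - w y‖ₑ)
      ((volume : Measure (E N)).prod volume) := by
    have h1 : AEStronglyMeasurable (fun p : E N × E N => w (p.1 - p.2)) (volume.prod volume) :=
      hw.1.comp_quasiMeasurePreserving (quasiMeasurePreserving_sub_of_right_invariant _ _)
    have h2 : AEStronglyMeasurable (fun p : E N × E N => w p.1) (volume.prod volume) :=
      hw.1.comp_fst
    exact ((hk.contDiff.continuous.comp continuous_snd).enorm.measurable.aemeasurable).mul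
      (h1.sub h2).enorm
  rw [eLpNorm_one_eq_lintegral_enorm]
  calc ∫⁻ y, ‖mollify k w y - w y‖ₑ
      ≤ ∫⁻ y, (∫⁻ t, ‖k t‖ₑ * ‖w (y - t) - w y‖ₑ) := lintegral_mono hpt
    _ = ∫⁻ t, (∫⁻ y, ‖k t‖ₑ * ‖w (y - t) - w y‖ₑ) := lintegral_lintegral_swap hm
    _ ≤ ∫⁻ t, ‖k t‖ₑ * ε := by
        refine lintegral_mono fun t => ?_
        by_cases ht : t ∈ tsupport k
        · rw [lintegral_const_mul' _ _ enorm_ne_top, ← eLpNorm_one_eq_lintegral_enorm]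
          gcongr
          exact hδ t (by simpa using hk.tsupport_subset ht)
        · simp [image_eq_zero_of_notMem_tsupport ht]
    _ = ε := by rw [lintegral_mul_const _ hk.contDiff.continuous.enorm.measurable, hk1, one_mul]

/-! ### Density of functions smooth up to the boundary -/

/-- `f ∈ W^{1,1}(U)` with weak gradient `G`. -/
structure IsSobolevPair (U : Set (E N)) (f : E N → ℝ) (G : E N → E N) : Prop where
  memLp_fn : MemLp f 1 (volume.restrict U)
  memLp_grad : MemLp G 1 (volume.restrict U)
  hasWeakGradient : HasWeakGradient U f G

/-- `(f, G)` is a limit in `L^1(U)` of pairs `(φ, ∇φ)` with `φ` smooth on the whole space. -/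
def IsSmoothLimit (U : Set (E N)) (f : E N → ℝ) (G : E N → E N) : Prop :=
  ∀ ε : ℝ≥0∞, ε ≠ 0 → ∃ φ : E N → ℝ, ContDiff ℝ ∞ φ ∧
    eLpNorm (fun x => φ x - f x) 1 (volume.restrict U) ≤ ε ∧
    eLpNorm (fun x => gradient φ x - G x) 1 (volume.restrict U) ≤ ε

theorem IsSobolevPair.smooth_mul {U : Set (E N)} (hUm : MeasurableSet U)
    (hb : Bornology.IsBounded U) {f : E N → ℝ} {G : E N → E N} (h : IsSobolevPair U f G)
    {χ : E N → ℝ} (hχ : ContDiff ℝ ∞ χ) :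
    IsSobolevPair U (fun x => χ x * f x) (fun x => χ x • G x + f x • gradient χ x) :=
  ⟨memLp_smooth_mul hUm hb h.memLp_fn hχ,
    memLp_smooth_mul_grad hUm hb h.memLp_fn h.memLp_grad hχ,
    h.hasWeakGradient.smooth_mul (h.memLp_fn.locallyIntegrable le_rfl)
      (h.memLp_grad.locallyIntegrable le_rfl) hχ⟩

theorem IsSmoothLimit.congr {U : Set (E N)} {f f' : E N → ℝ} {G G' : E N → E N}
    (h : IsSmoothLimit U f G) (hf : f =ᵐ[volume.restrict U] f')
    (hG : G =ᵐ[volume.restrict U] G') : IsSmoothLimit U f' G' := by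
  intro ε hε
  obtain ⟨φ, hφ, h1, h2⟩ := h ε hε
  refine ⟨φ, hφ, ?_, ?_⟩
  · rwa [eLpNorm_congr_ae (g := fun x => φ x - f x)
      (by filter_upwards [hf] with x hx; rw [hx])]
  · rwa [eLpNorm_congr_ae (g := fun x => gradient φ x - G x)
      (by filter_upwards [hG] with x hx; rw [hx])]

theorem IsSmoothLimit.add {U : Set (E N)} {f f' : E N → ℝ} {G G' : E N → E N}
    (hp : IsSobolevPair U f G) (hp' : IsSobolevPair U f' G')
    (h : IsSmoothLimit U f G) (h' : IsSmoothLimit U f' G') :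
    IsSmoothLimit U (fun x => f x + f' x) (fun x => G x + G' x) := by
  intro ε hε
  have hε2 : ε / 2 ≠ 0 := (ENNReal.half_pos hε).ne'
  obtain ⟨φ, hφ, h1, h2⟩ := h _ hε2
  obtain ⟨ψ, hψ, h3, h4⟩ := h' _ hε2
  refine ⟨fun x => φ x + ψ x, hφ.add hψ, ?_, ?_⟩
  · have : (fun x => φ x + ψ x - (f x + f' x))
        = (fun x => φ x - f x) + fun x => ψ x - f' x := by
      ext x; simp only [Pi.add_apply]; ring
    rw [this]
    refine (eLpNorm_add_le (hφ.continuous.aestronglyMeasurable.sub hp.memLp_fn.1)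
      (hψ.continuous.aestronglyMeasurable.sub hp'.memLp_fn.1) le_rfl).trans ?_
    rw [← ENNReal.add_halves ε]
    exact add_le_add h1 h3
  · have : (fun x => gradient (fun x => φ x + ψ x) x - (G x + G' x))
        = (fun x => gradient φ x - G x) + fun x => gradient ψ x - G' x := by
      ext1 x
      simp only [Pi.add_apply, gradient_add hφ hψ]
      abel
    rw [this]
    refine (eLpNorm_add_le ((continuous_gradient hφ).aestronglyMeasurable.sub hp.memLp_grad.1)
      ((continuous_gradient hψ).aestronglyMeasurable.sub hp'.memLp_grad.1) le_rfl).trans ?_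
    rw [← ENNReal.add_halves ε]
    exact add_le_add h2 h4

/-- Approximation of Sobolev functions localised in a patch. -/
theorem IsSobolevPair.isSmoothLimit_of_patch {U Γ : Set (E N)} (hU : IsOpen U)
    (hb : Bornology.IsBounded U) {x : E N} {r : ℝ} (hr : 0 < r)
    (hΓ : HasShiftDirections Γ) (hUΓ : U ∩ Metric.ball x r = Γ ∩ Metric.ball x r)
    {f : E N → ℝ} {G : E N → E N} (hp : IsSobolevPair U f G) {χ : E N → ℝ}
    (hχ : ContDiff ℝ ∞ χ) (hsupp : tsupport χ ⊆ Metric.closedBall x (r / 2)) :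
    IsSmoothLimit U (fun x => χ x * f x) (fun x => χ x • G x + f x • gradient χ x) := by
  intro ε hε
  set w : E N → ℝ := U.indicator fun x => χ x * f x with hw
  set W : E N → E N := U.indicator fun x => χ x • G x + f x • gradient χ x with hW
  have hp' := hp.smooth_mul hU.measurableSet hb hχ
  have hwm : MemLp w 1 volume := (memLp_indicator_iff_restrict hU.measurableSet).2 hp'.memLp_fn
  have hWm : MemLp W 1 volume := (memLp_indicator_iff_restrict hU.measurableSet).2 hp'.memLp_grad
  have hgrad : HasWeakGradient Γ w W := hp.hasWeakGradient.localize hU hUΓ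
    (hp.memLp_fn.locallyIntegrable le_rfl) (hp.memLp_grad.locallyIntegrable le_rfl) hχ
    (hsupp.trans (Metric.closedBall_subset_ball (by linarith)))
  obtain ⟨δ₁, hδ₁, H₁⟩ := exists_eLpNorm_translate_le hwm hε
  obtain ⟨δ₂, hδ₂, H₂⟩ := exists_eLpNorm_translate_le hWm hε
  -- The bound r/2 keeps the mollified function inside the ball of radius r, as χ is supported
  -- within distance r/2 of the centre.
  set δ := min (min δ₁ δ₂) (r / 2) with hδ
  obtain ⟨k, hk⟩ := hΓ.exists_kernel (δ := δ) (by positivity)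
  have hwl : LocallyIntegrable w := hwm.locallyIntegrable le_rfl
  have h1 : eLpNorm (fun y => mollify k w y - w y) 1 volume ≤ ε :=
    eLpNorm_mollify_sub_le hwm (fun t ht => H₁ t (ht.trans_le (by simp [hδ]))) hk
  have h2 : eLpNorm (fun y => mollify k W y - W y) 1 volume ≤ ε :=
    eLpNorm_mollify_sub_le hWm (fun t ht => H₂ t (ht.trans_le (by simp [hδ]))) hk
  -- away from the patch everything vanishes
  have hout : ∀ y ∉ Metric.ball x r, ∀ t ∈ tsupport k, y - t ∉ tsupport χ := by
    intro y hy t ht hyt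
    have h3 := hsupp hyt
    have h4 := hk.tsupport_subset ht
    rw [Metric.mem_closedBall, dist_eq_norm] at h3
    rw [Metric.mem_ball, dist_zero_right] at h4
    rw [Metric.mem_ball, dist_eq_norm, not_lt] at hy
    have h5 : ‖y - x‖ ≤ ‖y - t - x‖ + ‖t‖ := by
      refine le_trans (le_of_eq ?_) (norm_add_le _ _)
      congr 1
      abel
    have : δ ≤ r / 2 := min_le_right _ _
    linarith
  have hw0 : ∀ y ∉ tsupport χ, w y = 0 := fun y hy => by
    by_cases hyU : y ∈ U
    · simp [hw, hyU, image_eq_zero_of_notMem_tsupport hy]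
    · simp [hw, hyU]
  have hW0 : ∀ y ∉ tsupport χ, W y = 0 := fun y hy => by
    by_cases hyU : y ∈ U
    · simp [hW, hyU, image_eq_zero_of_notMem_tsupport hy, gradient_eq_zero_of_notMem_tsupport hy]
    · simp [hW, hyU]
  -- In the ball, U agrees with Γ and mollification commutes with the gradient; elsewhere U and Γ
  -- may differ, but both sides are 0.
  have hg : ∀ y ∈ U, gradient (mollify k w) y = mollify k W y := by
    intro y hy
    by_cases hyB : y ∈ Metric.ball x r
    · have : y ∈ Γ ∩ Metric.ball x r := hUΓ ▸ ⟨hy, hyB⟩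
      exact hgrad.gradient_mollify hk hwl this.1
    · rw [(hasGradientAt_mollify hk.contDiff hk.hasCompactSupport hwl y).gradient, mollify]
      congr 1 with t : 1
      by_cases ht : t ∈ tsupport k
      · rw [hw0 _ (hout y hyB t ht), hW0 _ (hout y hyB t ht), zero_smul, smul_zero]
      · rw [gradient_eq_zero_of_notMem_tsupport ht, image_eq_zero_of_notMem_tsupport ht,
          zero_smul, smul_zero]
  refine ⟨mollify k w, contDiff_mollify hk.contDiff hk.hasCompactSupport hwl, ?_, ?_⟩
  · refine le_trans (le_of_eq ?_) ((eLpNorm_mono_measure _ (Measure.restrict_le_self (s := U))).trans h1)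
    refine eLpNorm_congr_ae ?_
    filter_upwards [ae_restrict_mem hU.measurableSet] with y hy
    rw [hw, indicator_of_mem hy]
  · refine le_trans (le_of_eq ?_) ((eLpNorm_mono_measure _ (Measure.restrict_le_self (s := U))).trans h2)
    refine eLpNorm_congr_ae ?_
    filter_upwards [ae_restrict_mem hU.measurableSet] with y hy
    rw [hg y hy, hW, indicator_of_mem hy]

/-- On bounded Lipschitz domains, functions smooth up to the boundary are dense in `W^{1,1}`. -/
theorem IsSobolevPair.isSmoothLimit {U : Set (E N)} (hU : IsOpen U)
    (hb : Bornology.IsBounded U) (hL : HasLipschitzBoundary U) {f : E N → ℝ} {G : E N → E N}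
    (hp : IsSobolevPair U f G) : IsSmoothLimit U f G := by
  -- In place of a partition of unity, two cutoffs merge into ψ + ψ'(1 - ψ), which is 1 wherever
  -- either of them is. The property quantifies over all Sobolev pairs so that the one for ψ' can be
  -- applied to (1 - ψ) f.
  have main := hb.isCompact_closure.induction_on
    (p := fun S => ∃ ψ : E N → ℝ, ContDiff ℝ ∞ ψ ∧ (∀ y ∈ S, ψ y = 1) ∧
      ∀ (f : E N → ℝ) (G : E N → E N), IsSobolevPair U f G →
        IsSmoothLimit U (fun x => ψ x * f x) (fun x => ψ x • G x + f x • gradient ψ x))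
    ⟨fun _ => 0, contDiff_const, by simp, fun f G _ ε _ =>
      ⟨fun _ => 0, contDiff_const, by simp, by simp⟩⟩
    (fun S T hST ⟨ψ, hψ, h1, h2⟩ => ⟨ψ, hψ, fun y hy => h1 y (hST hy), h2⟩)
    (fun S T ⟨ψ, hψ, h1, h2⟩ ⟨ψ', hψ', h1', h2'⟩ => by
      have hs : ContDiff ℝ ∞ fun x => 1 - ψ x := contDiff_const.sub hψ
      have hg : ∀ x, gradient (fun x => 1 - ψ x) x = - gradient ψ x := fun x => by
        rw [gradient_sub contDiff_const hψ, gradient_fun_const, zero_sub]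
      refine ⟨fun x => ψ x + ψ' x * (1 - ψ x), hψ.add (hψ'.mul hs), ?_, fun f G hp => ?_⟩
      · rintro y (hy | hy)
        · simp [h1 y hy]
        · simp [h1' y hy]
      · have hp' := hp.smooth_mul hU.measurableSet hb hs
        have := (h2 f G hp).add (hp.smooth_mul hU.measurableSet hb hψ)
          (hp'.smooth_mul hU.measurableSet hb hψ') (h2' _ _ hp')
        refine this.congr (Eventually.of_forall fun x => ?_) (Eventually.of_forall fun x => ?_)
        · ring
        · simp only
          rw [gradient_add hψ (hψ'.mul hs), gradient_mul hψ' hs, hg]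
          module)
    (fun x hx => by
      obtain ⟨r, hr, Γ, -, hΓ, hUΓ⟩ := hL.exists_patch hU hx
      let χ : ContDiffBump x := ⟨r / 4, r / 2, by positivity, by linarith⟩
      refine ⟨Metric.ball x (r / 4), mem_nhdsWithin_of_mem_nhds
        (Metric.ball_mem_nhds _ (by positivity)), χ, χ.contDiff,
        fun y hy => χ.one_of_mem_closedBall (Metric.ball_subset_closedBall hy), fun f G hp =>
        hp.isSmoothLimit_of_patch hU hb hr hΓ hUΓ χ.contDiff χ.tsupport_eq.subset⟩)
  obtain ⟨ψ, hψ, h1, h2⟩ := main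
  refine (h2 f G hp).congr ?_ ?_
  · filter_upwards [ae_restrict_mem hU.measurableSet] with y hy
    rw [h1 y (subset_closure hy), one_mul]
  · filter_upwards [ae_restrict_mem hU.measurableSet] with y hy
    have : ψ =ᶠ[𝓝 y] fun _ => 1 := by
      filter_upwards [hU.mem_nhds hy] with z hz using h1 z (subset_closure hz)
    rw [this.gradient_eq, gradient_fun_const, h1 y (subset_closure hy)]
    simp

/-! ### Properties of traces -/

theorem HasLipschitzBoundary.exists_trace_bound {U : Set (E N)} (hU : IsOpen U)
    (hb : Bornology.IsBounded U) (hL : HasLipschitzBoundary U) :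
    ∃ C : ℝ≥0∞, C ≠ ⊤ ∧ ∀ φ : E N → ℝ, ContDiff ℝ ∞ φ → eLpNorm φ 1 (surf (frontier U))
      ≤ C * (eLpNorm φ 1 (volume.restrict U) + eLpNorm (gradient φ) 1 (volume.restrict U)) := by
  simpa only [eLpNorm_one_eq_lintegral_enorm] using hL.lintegral_frontier_le hU hb

/-- The right-hand side of the trace inequality is finite, φ and its gradient being bounded on U. No
prior knowledge of the boundary area is needed. -/
theorem memLp_surf_of_contDiff {U : Set (E N)} (hU : IsOpen U) (hb : Bornology.IsBounded U)
    (hL : HasLipschitzBoundary U) {φ : E N → ℝ} (hφ : ContDiff ℝ ∞ φ) :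
    MemLp φ 1 (surf (frontier U)) := by
  obtain ⟨C, hC, H⟩ := hL.exists_trace_bound hU hb
  have : Fact (Bornology.IsBounded U) := ⟨hb⟩
  refine ⟨hφ.continuous.aestronglyMeasurable, (H φ hφ).trans_lt (ENNReal.mul_lt_top hC.lt_top
    (ENNReal.add_lt_top.2 ⟨?_, ?_⟩))⟩
  · exact ((memLp_top_of_continuous hU.measurableSet hb hφ.continuous).mono_exponent le_top).2
  · exact ((memLp_top_of_continuous hU.measurableSet hb
      (continuous_gradient hφ)).mono_exponent le_top).2

/-- The trace inequality applied to the constant 1. -/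
theorem isFiniteMeasure_surf {U : Set (E N)} (hU : IsOpen U) (hb : Bornology.IsBounded U)
    (hL : HasLipschitzBoundary U) : IsFiniteMeasure (surf (frontier U)) := by
  have := (memLp_surf_of_contDiff hU hb hL (contDiff_const (c := (1 : ℝ)))).2
  rw [eLpNorm_one_eq_lintegral_enorm] at this
  exact ⟨by simpa using this⟩

theorem IsTrace.congr {U : Set (E N)} {f f' : E N → ℝ} {G G' : E N → E N} {τ : E N → ℝ}
    (h : IsTrace U f G τ) (hf : f =ᵐ[volume.restrict U] f')
    (hG : G =ᵐ[volume.restrict U] G') : IsTrace U f' G' τ := by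
  obtain ⟨h1, φ, h2, h3, h4, h5⟩ := h
  refine ⟨h1, φ, h2, ?_, ?_, h5⟩
  · refine h3.congr fun k => eLpNorm_congr_ae ?_
    filter_upwards [hf] with x hx
    rw [hx]
  · refine h4.congr fun k => eLpNorm_congr_ae ?_
    filter_upwards [hG] with x hx
    rw [hx]

theorem isTrace_of_contDiff {U : Set (E N)} (hU : IsOpen U) (hb : Bornology.IsBounded U)
    (hL : HasLipschitzBoundary U) {φ : E N → ℝ} (hφ : ContDiff ℝ ∞ φ) :
    IsTrace U φ (gradient φ) φ :=
  ⟨memLp_surf_of_contDiff hU hb hL hφ, fun _ => φ, fun _ => hφ, by simp, by simp, by simp⟩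

theorem tendsto_eLpNorm_add {α F : Type*} [MeasurableSpace α] [NormedAddCommGroup F]
    {μ : Measure α} {u v w : ℕ → α → F} (hu : ∀ k, AEStronglyMeasurable (u k) μ)
    (hv : ∀ k, AEStronglyMeasurable (v k) μ) (hw : ∀ k x, w k x = u k x + v k x)
    (h1 : Tendsto (fun k => eLpNorm (u k) 1 μ) atTop (𝓝 0))
    (h2 : Tendsto (fun k => eLpNorm (v k) 1 μ) atTop (𝓝 0)) :
    Tendsto (fun k => eLpNorm (w k) 1 μ) atTop (𝓝 0) := by
  refine tendsto_of_tendsto_of_tendsto_of_le_of_le tendsto_const_nhds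
    (by simpa using h1.add h2) (fun _ => zero_le) fun k => ?_
  have : w k = u k + v k := funext (hw k)
  rw [this]
  exact eLpNorm_add_le (hu k) (hv k) le_rfl

theorem IsTrace.add {U : Set (E N)} {f f' : E N → ℝ} {G G' : E N → E N} {τ τ' : E N → ℝ}
    (h : IsTrace U f G τ) (h' : IsTrace U f' G' τ') (hf : MemLp f 1 (volume.restrict U))
    (hf' : MemLp f' 1 (volume.restrict U)) (hG : MemLp G 1 (volume.restrict U))
    (hG' : MemLp G' 1 (volume.restrict U)) :
    IsTrace U (fun x => f x + f' x) (fun x => G x + G' x) (fun x => τ x + τ' x) := by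
  obtain ⟨h1, φ, h2, h3, h4, h5⟩ := h
  obtain ⟨h1', φ', h2', h3', h4', h5'⟩ := h'
  refine ⟨h1.add h1', fun k x => φ k x + φ' k x, fun k => (h2 k).add (h2' k), ?_, ?_, ?_⟩
  · exact tendsto_eLpNorm_add (fun k => (h2 k).continuous.aestronglyMeasurable.sub hf.1)
      (fun k => (h2' k).continuous.aestronglyMeasurable.sub hf'.1)
      (fun k x => by simp only [Pi.sub_apply]; ring) h3 h3'
  · exact tendsto_eLpNorm_add
      (fun k => (continuous_gradient (h2 k)).aestronglyMeasurable.sub hG.1)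
      (fun k => (continuous_gradient (h2' k)).aestronglyMeasurable.sub hG'.1)
      (fun k x => by simp only [gradient_add (h2 k) (h2' k), Pi.sub_apply]; abel) h4 h4'
  · exact tendsto_eLpNorm_add (fun k => (h2 k).continuous.aestronglyMeasurable.sub h1.1)
      (fun k => (h2' k).continuous.aestronglyMeasurable.sub h1'.1)
      (fun k x => by simp only [Pi.sub_apply]; ring) h5 h5'

theorem tendsto_eLpNorm_smul {α F F' : Type*} [MeasurableSpace α] [NormedAddCommGroup F]
    [NormedAddCommGroup F'] {μ : Measure α} {u : ℕ → α → F} {w : ℕ → α → F'} {M : ℝ}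
    (hw : ∀ᵐ x ∂μ, ∀ k, ‖w k x‖ ≤ M * ‖u k x‖)
    (h1 : Tendsto (fun k => eLpNorm (u k) 1 μ) atTop (𝓝 0)) :
    Tendsto (fun k => eLpNorm (w k) 1 μ) atTop (𝓝 0) := by
  refine tendsto_of_tendsto_of_tendsto_of_le_of_le tendsto_const_nhds
    (by simpa using ENNReal.Tendsto.const_mul h1 (Or.inr (ENNReal.ofReal_ne_top (r := M))))
    (fun _ => zero_le) fun k => ?_
  exact eLpNorm_le_mul_eLpNorm_of_ae_le_mul (hw.mono fun x hx => hx k) 1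

theorem ae_mem_frontier_surf (U : Set (E N)) : ∀ᵐ x ∂(surf (frontier U)), x ∈ frontier U :=
  ae_restrict_mem isClosed_frontier.measurableSet

theorem IsTrace.smooth_mul {U : Set (E N)} (hUm : MeasurableSet U) (hb : Bornology.IsBounded U)
    {f : E N → ℝ} {G : E N → E N} {τ : E N → ℝ} (h : IsTrace U f G τ)
    (hf : MemLp f 1 (volume.restrict U)) (hG : MemLp G 1 (volume.restrict U)) {χ : E N → ℝ}
    (hχ : ContDiff ℝ ∞ χ) :
    IsTrace U (fun x => χ x * f x) (fun x => χ x • G x + f x • gradient χ x)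
      (fun x => χ x * τ x) := by
  obtain ⟨h1, φ, h2, h3, h4, h5⟩ := h
  obtain ⟨M, hM⟩ := exists_bound_of_continuous hb.closure hχ.continuous
  obtain ⟨M', hM'⟩ := exists_bound_of_continuous hb.closure (continuous_gradient hχ)
  have hMU : ∀ᵐ x ∂(volume.restrict U), ‖χ x‖ ≤ M ∧ ‖gradient χ x‖ ≤ M' := by
    filter_upwards [ae_restrict_mem hUm] with x hx
    exact ⟨hM x (subset_closure hx), hM' x (subset_closure hx)⟩
  have hMs : ∀ᵐ x ∂(surf (frontier U)), ‖χ x‖ ≤ M := by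
    filter_upwards [ae_mem_frontier_surf U] with x hx using hM x (frontier_subset_closure hx)
  refine ⟨h1.mul (memLp_top_of_bound hχ.continuous.aestronglyMeasurable M hMs),
    fun k x => χ x * φ k x, fun k => hχ.mul (h2 k), ?_, ?_, ?_⟩
  · refine tendsto_eLpNorm_smul (M := M) ?_ h3
    filter_upwards [hMU] with x hx k
    rw [← mul_sub, norm_mul]
    gcongr
    exact hx.1
  · refine tendsto_eLpNorm_add
      (u := fun k x => χ x • (gradient (φ k) x - G x)) (v := fun k x => (φ k x - f x) • gradient χ x)
      (fun k => hχ.continuous.aestronglyMeasurable.smul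
        ((continuous_gradient (h2 k)).aestronglyMeasurable.sub hG.1))
      (fun k => ((h2 k).continuous.aestronglyMeasurable.sub hf.1).smul
        (continuous_gradient hχ).aestronglyMeasurable)
      (fun k x => by simp only [gradient_mul hχ (h2 k)]; module)
      (tendsto_eLpNorm_smul (M := M) ?_ h4) (tendsto_eLpNorm_smul (M := M') ?_ h3)
    · filter_upwards [hMU] with x hx k
      rw [norm_smul]
      gcongr
      exact hx.1
    · filter_upwards [hMU] with x hx k
      rw [norm_smul, mul_comm]
      gcongr
      exact hx.2
  · refine tendsto_eLpNorm_smul (M := M) ?_ h5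
    filter_upwards [hMs] with x hx k
    rw [← mul_sub, norm_mul]
    gcongr

theorem IsTrace.const_mul {U : Set (E N)} (hUm : MeasurableSet U) (hb : Bornology.IsBounded U)
    {f : E N → ℝ} {G : E N → E N} {τ : E N → ℝ} (h : IsTrace U f G τ)
    (hf : MemLp f 1 (volume.restrict U)) (hG : MemLp G 1 (volume.restrict U)) (c : ℝ) :
    IsTrace U (fun x => c * f x) (fun x => c • G x) (fun x => c * τ x) := by
  simpa [gradient_fun_const] using h.smooth_mul hUm hb hf hG (contDiff_const (c := c))

theorem IsTrace.sub {U : Set (E N)} (hUm : MeasurableSet U) (hb : Bornology.IsBounded U)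
    {f f' : E N → ℝ} {G G' : E N → E N} {τ τ' : E N → ℝ}
    (h : IsTrace U f G τ) (h' : IsTrace U f' G' τ') (hf : MemLp f 1 (volume.restrict U))
    (hf' : MemLp f' 1 (volume.restrict U)) (hG : MemLp G 1 (volume.restrict U))
    (hG' : MemLp G' 1 (volume.restrict U)) :
    IsTrace U (fun x => f x - f' x) (fun x => G x - G' x) (fun x => τ x - τ' x) := by
  have := h.add (h'.const_mul hUm hb hf' hG' (-1)) hf (hf'.const_mul (-1)) hG
    (hG'.const_smul (-1 : ℝ))
  simpa [sub_eq_add_neg] using this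

/-- The trace inequality. -/
theorem IsTrace.eLpNorm_le {U : Set (E N)} {C : ℝ≥0∞} (hC : C ≠ ⊤)
    (H : ∀ φ : E N → ℝ, ContDiff ℝ ∞ φ → eLpNorm φ 1 (surf (frontier U))
      ≤ C * (eLpNorm φ 1 (volume.restrict U) + eLpNorm (gradient φ) 1 (volume.restrict U)))
    {f : E N → ℝ} {G : E N → E N} {τ : E N → ℝ} (h : IsTrace U f G τ)
    (hf : MemLp f 1 (volume.restrict U)) (hG : MemLp G 1 (volume.restrict U)) :
    eLpNorm τ 1 (surf (frontier U))
      ≤ C * (eLpNorm f 1 (volume.restrict U) + eLpNorm G 1 (volume.restrict U)) := by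
  obtain ⟨h1, φ, h2, h3, h4, h5⟩ := h
  have key : ∀ k, eLpNorm τ 1 (surf (frontier U)) ≤
      C * ((eLpNorm f 1 (volume.restrict U) + eLpNorm (fun x => φ k x - f x) 1 (volume.restrict U))
        + (eLpNorm G 1 (volume.restrict U)
          + eLpNorm (fun x => gradient (φ k) x - G x) 1 (volume.restrict U)))
      + eLpNorm (fun x => φ k x - τ x) 1 (surf (frontier U)) := by
    intro k
    have e1 : τ = φ k - fun x => φ k x - τ x := by ext x; simp
    have e2 : φ k = f + fun x => φ k x - f x := by ext x; simp
    have e3 : gradient (φ k) = G + fun x => gradient (φ k) x - G x := by ext1 x; simp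
    have m1 := (h2 k).continuous.aestronglyMeasurable (μ := surf (frontier U))
    have m2 := (h2 k).continuous.aestronglyMeasurable (μ := volume.restrict U)
    have m3 := (continuous_gradient (h2 k)).aestronglyMeasurable (μ := volume.restrict U)
    calc eLpNorm τ 1 (surf (frontier U))
        ≤ eLpNorm (φ k) 1 (surf (frontier U))
          + eLpNorm (fun x => φ k x - τ x) 1 (surf (frontier U)) := by
          conv_lhs => rw [e1]
          exact eLpNorm_sub_le m1 (m1.sub h1.1) le_rfl
      _ ≤ _ := by
          gcongr
          refine (H _ (h2 k)).trans ?_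
          gcongr
          · conv_lhs => rw [e2]
            exact eLpNorm_add_le hf.1 (m2.sub hf.1) le_rfl
          · conv_lhs => rw [e3]
            exact eLpNorm_add_le hG.1 (m3.sub hG.1) le_rfl
  have lim := (ENNReal.Tendsto.const_mul (((tendsto_const_nhds
    (x := eLpNorm f 1 (volume.restrict U))).add h3).add ((tendsto_const_nhds
    (x := eLpNorm G 1 (volume.restrict U))).add h4)) (Or.inr hC)).add h5
  simp only [add_zero] at lim
  exact ge_of_tendsto' lim key

/-- The difference of the two traces is a trace of 0, and the trace inequality forces it to vanish.
-/
theorem IsTrace.ae_eq {U : Set (E N)} (hU : IsOpen U) (hb : Bornology.IsBounded U)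
    (hL : HasLipschitzBoundary U) {f f' : E N → ℝ} {G G' : E N → E N} {τ τ' : E N → ℝ}
    (h : IsTrace U f G τ) (h' : IsTrace U f' G' τ') (hf : MemLp f 1 (volume.restrict U))
    (hG : MemLp G 1 (volume.restrict U)) (hff : f =ᵐ[volume.restrict U] f')
    (hGG : G =ᵐ[volume.restrict U] G') : τ =ᵐ[surf (frontier U)] τ' := by
  obtain ⟨C, hC, H⟩ := hL.exists_trace_bound hU hb
  have h0 := h.sub hU.measurableSet hb (h'.congr hff.symm hGG.symm) hf hf hG hG
  have := h0.eLpNorm_le hC H (by simp) (by simp)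
  simp only [sub_self] at this
  have h00 : eLpNorm (fun x => τ x - τ' x) 1 (surf (frontier U)) = 0 := by
    refine le_antisymm (this.trans (le_of_eq ?_)) zero_le
    simp
  have h01 := (eLpNorm_eq_zero_iff (f := fun x => τ x - τ' x) (h.1.1.sub h'.1.1)
    one_ne_zero).1 h00
  filter_upwards [h01] with x hx using sub_eq_zero.1 hx

/-- Existence of traces on bounded Lipschitz domains. -/
theorem IsSobolevPair.exists_isTrace {U : Set (E N)} (hU : IsOpen U)
    (hb : Bornology.IsBounded U) (hL : HasLipschitzBoundary U) {f : E N → ℝ} {G : E N → E N}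
    (hp : IsSobolevPair U f G) : ∃ τ, IsTrace U f G τ := by
  obtain ⟨C, hC, H⟩ := hL.exists_trace_bound hU hb
  have hε : ∀ k : ℕ, ((2 : ℝ≥0∞)⁻¹ ^ k) ≠ 0 := fun k => pow_ne_zero _ (by simp)
  choose φ hφ h1 h2 using fun k => hp.isSmoothLimit hU hb hL _ (hε k)
  have hlim : Tendsto (fun k : ℕ => (2 : ℝ≥0∞)⁻¹ ^ k) atTop (𝓝 0) :=
    ENNReal.tendsto_pow_atTop_nhds_zero_of_lt_one (by norm_num)
  have hclose : ∀ {F : Type} [NormedAddCommGroup F] {a b c : E N → F} {η : ℝ≥0∞},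
      AEStronglyMeasurable a (volume.restrict U) → AEStronglyMeasurable b (volume.restrict U) →
      AEStronglyMeasurable c (volume.restrict U) →
      eLpNorm (fun x => a x - c x) 1 (volume.restrict U) ≤ η →
      eLpNorm (fun x => b x - c x) 1 (volume.restrict U) ≤ η →
      eLpNorm (fun x => a x - b x) 1 (volume.restrict U) ≤ η + η := by
    intro F _ a b c η ha hb hc h h'
    have : (fun x => a x - b x) = (fun x => a x - c x) - fun x => b x - c x := by
      ext1 x; simp
    rw [this]
    exact (eLpNorm_sub_le (ha.sub hc) (hb.sub hc) le_rfl).trans (add_le_add h h')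
  obtain ⟨τ, hτ, hτlim⟩ := Lp.cauchy_complete_eLpNorm (p := 1) le_rfl
    (fun k => memLp_surf_of_contDiff hU hb hL (hφ k))
    -- Four errors of size at most 2^(-k), two for the functions and two for the gradients, give 4C;
    -- the extra 1 makes the required inequality strict.
    (B := fun k => (4 * C + 1) * (2 : ℝ≥0∞)⁻¹ ^ k)
    (by
      rw [ENNReal.tsum_mul_left, ENNReal.tsum_geometric]
      refine ENNReal.mul_ne_top ?_ ?_
      · exact ENNReal.add_ne_top.2 ⟨ENNReal.mul_ne_top (by simp) hC, by simp⟩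
      · rw [ENNReal.one_sub_inv_two, inv_inv]; simp)
    (fun k n m hn hm => by
      have hmono : ∀ {j}, k ≤ j → (2 : ℝ≥0∞)⁻¹ ^ j ≤ 2⁻¹ ^ k := fun hj =>
        pow_le_pow_right_of_le_one' (by norm_num) hj
      have m1 := fun j => (hφ j).continuous.aestronglyMeasurable (μ := volume.restrict U)
      have m2 := fun j => (continuous_gradient (hφ j)).aestronglyMeasurable
        (μ := volume.restrict U)
      have b1 := hclose (m1 n) (m1 m) hp.memLp_fn.1 ((h1 n).trans (hmono hn))
        ((h1 m).trans (hmono hm))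
      have b2 := hclose (m2 n) (m2 m) hp.memLp_grad.1 ((h2 n).trans (hmono hn))
        ((h2 m).trans (hmono hm))
      have b3 := H _ ((hφ n).sub (hφ m))
      have e3 : gradient (fun x => φ n x - φ m x) = fun x => gradient (φ n) x - gradient (φ m) x :=
        funext fun x => gradient_sub (hφ n) (hφ m) x
      rw [e3] at b3
      have hfin : (2 : ℝ≥0∞)⁻¹ ^ k ≠ ⊤ := ENNReal.pow_ne_top (by simp)
      calc eLpNorm (φ n - φ m) 1 (surf (frontier U))
          ≤ C * ((2⁻¹ ^ k + 2⁻¹ ^ k) + (2⁻¹ ^ k + 2⁻¹ ^ k)) := b3.trans (by gcongr)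
        _ = 4 * C * 2⁻¹ ^ k := by ring
        _ < 4 * C * 2⁻¹ ^ k + 2⁻¹ ^ k :=
            ENNReal.lt_add_right (ENNReal.mul_ne_top (ENNReal.mul_ne_top (by simp) hC) hfin)
              (hε k)
        _ = (4 * C + 1) * 2⁻¹ ^ k := by ring)
  exact ⟨τ, hτ, φ, hφ, tendsto_of_tendsto_of_tendsto_of_le_of_le tendsto_const_nhds hlim
    (fun _ => zero_le) h1, tendsto_of_tendsto_of_tendsto_of_le_of_le tendsto_const_nhds hlim
    (fun _ => zero_le) h2, hτlim⟩

/-- Restriction of a Sobolev function to a bounded open subset. -/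
theorem Sobolev.isSobolevPair {U V : Set (E N)} (hb : Bornology.IsBounded U)
    (hUV : U ⊆ V) {p : ℝ≥0∞} [hp : Fact (1 ≤ p)] (v : Sobolev V p) :
    IsSobolevPair U v.fn v.grad := by
  have : Fact (Bornology.IsBounded U) := ⟨hb⟩
  exact ⟨(v.memLp_fn.mono_measure (Measure.restrict_mono hUV le_rfl)).mono_exponent hp.out,
    (v.memLp_grad.mono_measure (Measure.restrict_mono hUV le_rfl)).mono_exponent hp.out,
    v.hasWeakGradient.mono hUV⟩

theorem Sobolev.isTrace_trace {U V : Set (E N)} (hU : IsOpen U) (hb : Bornology.IsBounded U)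
    (hL : HasLipschitzBoundary U) (hUV : U ⊆ V) {p : ℝ≥0∞} [Fact (1 ≤ p)] (v : Sobolev V p) :
    IsTrace U v.fn v.grad (trace U v) := by
  have h := (v.isSobolevPair hb hUV).exists_isTrace hU hb hL
  rw [trace, dif_pos h]
  exact h.choose_spec

theorem Sobolev.trace_ae_eq {U V : Set (E N)} (hU : IsOpen U) (hb : Bornology.IsBounded U)
    (hL : HasLipschitzBoundary U) (hUV : U ⊆ V) {p : ℝ≥0∞} [Fact (1 ≤ p)] (v : Sobolev V p)
    {f : E N → ℝ} {G : E N → E N} {τ : E N → ℝ} (h : IsTrace U f G τ)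
    (hf : v.fn =ᵐ[volume.restrict U] f) (hG : v.grad =ᵐ[volume.restrict U] G) :
    trace U v =ᵐ[surf (frontier U)] τ :=
  (v.isTrace_trace hU hb hL hUV).ae_eq hU hb hL h (v.isSobolevPair hb hUV).memLp_fn
    (v.isSobolevPair hb hUV).memLp_grad hf hG

/-- The trace from a smaller domain agrees with the one from a larger domain on the common part
of the boundary. -/
theorem IsTrace.ae_eq_of_subset {U V : Set (E N)} (hU : IsOpen U) (hb : Bornology.IsBounded U)
    (hL : HasLipschitzBoundary U) (hUV : U ⊆ V) (hfr : frontier V ⊆ frontier U)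
    {f : E N → ℝ} {G : E N → E N} {τ σ : E N → ℝ} (h : IsTrace U f G τ) (h' : IsTrace V f G σ)
    (hf : MemLp f 1 (volume.restrict U)) (hG : MemLp G 1 (volume.restrict U)) :
    τ =ᵐ[surf (frontier V)] σ := by
  obtain ⟨C, hC, H⟩ := hL.exists_trace_bound hU hb
  obtain ⟨hσ, φ, h2, h3, h4, h5⟩ := h'
  have hmono : surf (frontier V) ≤ surf (frontier U) := Measure.restrict_mono hfr le_rfl
  have hmonoU : volume.restrict U ≤ volume.restrict V := Measure.restrict_mono hUV le_rfl
  have : Fact (Bornology.IsBounded U) := ⟨hb⟩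
  have hm1 : ∀ k, MemLp (φ k) 1 (volume.restrict U) := fun k =>
    (memLp_top_of_continuous hU.measurableSet hb (h2 k).continuous).mono_exponent le_top
  have hm2 : ∀ k, MemLp (gradient (φ k)) 1 (volume.restrict U) := fun k =>
    (memLp_top_of_continuous hU.measurableSet hb
      (continuous_gradient (h2 k))).mono_exponent le_top
  -- The approximants coming from the larger domain also approximate on U. The trace inequality on
  -- U, applied to φ_k - f with trace φ_k - τ, compares τ with σ through φ_k.
  have key : ∀ k, eLpNorm (fun x => τ x - σ x) 1 (surf (frontier V)) ≤
      C * (eLpNorm (fun x => φ k x - f x) 1 (volume.restrict V)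
        + eLpNorm (fun x => gradient (φ k) x - G x) 1 (volume.restrict V))
      + eLpNorm (fun x => φ k x - σ x) 1 (surf (frontier V)) := by
    intro k
    have h0 := (isTrace_of_contDiff hU hb hL (h2 k)).sub hU.measurableSet hb h (hm1 k) hf
      (hm2 k) hG
    have h1 := h0.eLpNorm_le hC H ((hm1 k).sub hf) ((hm2 k).sub hG)
    have e1 : (fun x => τ x - σ x) = (fun x => φ k x - σ x) - fun x => φ k x - τ x := by
      ext x; simp
    have m1 := (h2 k).continuous.aestronglyMeasurable (μ := surf (frontier V))
    rw [e1]
    refine (eLpNorm_sub_le (m1.sub hσ.1) (m1.sub (h.1.1.mono_measure hmono)) le_rfl).trans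
      (le_of_eq_of_le (add_comm _ _) (add_le_add ?_ le_rfl))
    exact (eLpNorm_mono_measure _ hmono).trans (h1.trans (by
      gcongr))
  have lim := (ENNReal.Tendsto.const_mul (h3.add h4) (Or.inr hC)).add h5
  simp only [add_zero, mul_zero] at lim
  have h00 := le_antisymm (ge_of_tendsto' lim key) zero_le
  have h01 := (eLpNorm_eq_zero_iff (f := fun x => τ x - σ x)
    ((h.1.1.mono_measure hmono).sub hσ.1) one_ne_zero).1 h00
  filter_upwards [h01] with x hx using sub_eq_zero.1 hx

/-! ### Traces of bounded functions -/

/-- A smooth substitute for the positive part of s - M: its composition with a smooth function is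
smooth, so the trace inequality applies directly. The derivative vanishes for s ≤ M and s ≥ M + 1,
where extreme values are attained, and is therefore bounded. -/
theorem exists_cutoff (M : ℝ) : ∃ (F : ℝ → ℝ) (L : ℝ), ContDiff ℝ ∞ F ∧ (∀ s, F s = 0 ↔ s ≤ M) ∧
    (∀ s t, ‖F s - F t‖ ≤ L * ‖s - t‖) ∧ (∀ s, ‖deriv F s‖ ≤ L) ∧ ∀ s ≤ M, deriv F s = 0 := by
  let F : ℝ → ℝ := fun s => Real.smoothTransition (s - M)
  have hF : ContDiff ℝ ∞ F := Real.smoothTransition.contDiff.comp (contDiff_id.sub contDiff_const)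
  have hF0 : ∀ s, F s = 0 ↔ s ≤ M := fun s => by
    refine ⟨fun h => ?_, fun h => Real.smoothTransition.zero_of_nonpos (by linarith)⟩
    by_contra hs
    exact (Real.smoothTransition.pos_of_pos (x := s - M) (by linarith)).ne' h
  have hd0 : ∀ s ≤ M, deriv F s = 0 := fun s hs => by
    refine IsLocalMin.deriv_eq_zero (Eventually.of_forall fun t => ?_)
    rw [(hF0 s).2 hs]
    exact Real.smoothTransition.nonneg _
  have hd1 : ∀ s, M + 1 ≤ s → deriv F s = 0 := fun s hs => by
    refine IsLocalMax.deriv_eq_zero (Eventually.of_forall fun t => ?_)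
    have : F s = 1 := Real.smoothTransition.one_of_one_le (by linarith)
    rw [this]
    exact Real.smoothTransition.le_one _
  obtain ⟨L, hL⟩ := (isCompact_Icc (a := M) (b := M + 1)).exists_bound_of_continuousOn
    (hF.continuous_deriv (by simp)).continuousOn
  have hL0 : 0 ≤ L := (norm_nonneg _).trans (hL M ⟨le_rfl, by linarith⟩)
  have hLd : ∀ s, ‖deriv F s‖ ≤ L := fun s => by
    rcases le_or_gt s M with h | h
    · rwa [hd0 s h, norm_zero]
    · rcases le_or_gt (M + 1) s with h' | h'
      · rwa [hd1 s h', norm_zero]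
      · exact hL s ⟨h.le, h'.le⟩
  refine ⟨F, L, hF, hF0, fun s t => ?_, hLd, hd0⟩
  exact Convex.norm_image_sub_le_of_norm_deriv_le (s := univ)
    (fun x _ => (hF.differentiable (by simp)) x) (fun x _ => hLd x) convex_univ
    (mem_univ t) (mem_univ s)

theorem gradient_comp {F : ℝ → ℝ} (hF : ContDiff ℝ ∞ F) {φ : E N → ℝ} (hφ : ContDiff ℝ ∞ φ)
    (x : E N) : gradient (fun y => F (φ y)) x = deriv F (φ x) • gradient φ x := by
  apply HasGradientAt.gradient
  rw [hasGradientAt_iff_hasFDerivAt, map_smul]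
  exact ((hF.differentiable (by simp)) (φ x)).hasDerivAt.comp_hasFDerivAt x
    (hasGradientAt_iff_hasFDerivAt.1 (hasGradientAt_of_contDiff hφ x))

/-- With F vanishing exactly on (-∞, M] and φ_k smooth approximants of f, the functions F(φ_k) tend
to F(f) = 0 in W^{1,1}. By the trace inequality they tend to 0 on the boundary, where they also tend
to F(τ). Hence F(τ) = 0, that is, τ ≤ M. -/
theorem IsTrace.ae_le {U : Set (E N)} (hU : IsOpen U) (hb : Bornology.IsBounded U)
    (hL : HasLipschitzBoundary U) {f : E N → ℝ} {G : E N → E N} {τ : E N → ℝ}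
    (h : IsTrace U f G τ) (hf : MemLp f 1 (volume.restrict U))
    (hG : MemLp G 1 (volume.restrict U)) {M : ℝ} (hM : ∀ᵐ x ∂(volume.restrict U), f x ≤ M) :
    ∀ᵐ x ∂(surf (frontier U)), τ x ≤ M := by
  obtain ⟨C, hC, H⟩ := hL.exists_trace_bound hU hb
  obtain ⟨F, L, hF, hF0, hFL, hFd, hFd0⟩ := exists_cutoff M
  obtain ⟨hτ, φ₀, h2₀, h3₀, h4₀, h5₀⟩ := h
  -- An a.e. convergent subsequence is needed for dominated convergence in F'(φ_k) G → F'(f) G = 0.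
  obtain ⟨ns, hns, hae⟩ := (tendstoInMeasure_of_tendsto_eLpNorm one_ne_zero
    (fun k => (h2₀ k).continuous.aestronglyMeasurable) hf.1 h3₀).exists_seq_tendsto_ae
  set φ : ℕ → E N → ℝ := fun k => φ₀ (ns k) with hφ
  have h2 : ∀ k, ContDiff ℝ ∞ (φ k) := fun k => h2₀ (ns k)
  have h3 := h3₀.comp hns.tendsto_atTop
  have h4 := h4₀.comp hns.tendsto_atTop
  have h5 := h5₀.comp hns.tendsto_atTop
  have hFc : ∀ k, ContDiff ℝ ∞ fun x => F (φ k x) := fun k => hF.comp (h2 k)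
  -- the compositions tend to zero in `W^{1,1}(U)`
  have t1 : Tendsto (fun k => eLpNorm (fun x => F (φ k x)) 1 (volume.restrict U)) atTop (𝓝 0) := by
    refine tendsto_eLpNorm_smul (M := L) ?_ h3
    filter_upwards [hM] with x hx k
    have := hFL (φ k x) (f x)
    rwa [(hF0 (f x)).2 hx, sub_zero] at this
  have t2 : Tendsto (fun k => eLpNorm (fun x => deriv F (φ k x) • G x) 1 (volume.restrict U))
      atTop (𝓝 0) := by
    simp only [eLpNorm_one_eq_lintegral_enorm]
    rw [← lintegral_zero (μ := volume.restrict U)]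
    refine tendsto_lintegral_of_dominated_convergence' (fun x => ENNReal.ofReal L * ‖G x‖ₑ)
      (fun k => (((hF.continuous_deriv (by simp)).comp
        (h2 k).continuous).aestronglyMeasurable.smul hG.1).enorm)
      (fun k => Eventually.of_forall fun x => ?_) ?_ ?_
    · simp only [enorm_smul]
      rw [← ofReal_norm (deriv F (φ k x))]
      gcongr
      exact hFd _
    · rw [lintegral_const_mul' _ _ ENNReal.ofReal_ne_top]
      refine ENNReal.mul_ne_top ENNReal.ofReal_ne_top ?_
      rw [← eLpNorm_one_eq_lintegral_enorm]
      exact hG.2.ne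
    · filter_upwards [hae, hM] with x hx hxM
      have l1 : Tendsto (fun k => deriv F (φ k x) • G x) atTop (𝓝 (deriv F (f x) • G x)) :=
        (((hF.continuous_deriv (by simp)).tendsto (f x)).comp hx).smul_const _
      rw [hFd0 _ hxM, zero_smul] at l1
      simpa using l1.enorm
  have t3 : Tendsto (fun k => eLpNorm (gradient fun x => F (φ k x)) 1 (volume.restrict U))
      atTop (𝓝 0) := by
    refine tendsto_eLpNorm_add
      (u := fun k x => deriv F (φ k x) • (gradient (φ k) x - G x))
      (v := fun k x => deriv F (φ k x) • G x)
      (fun k => ((hF.continuous_deriv (by simp)).comp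
        (h2 k).continuous).aestronglyMeasurable.smul
        ((continuous_gradient (h2 k)).aestronglyMeasurable.sub hG.1))
      (fun k => ((hF.continuous_deriv (by simp)).comp
        (h2 k).continuous).aestronglyMeasurable.smul hG.1)
      (fun k x => by rw [gradient_comp hF (h2 k), smul_sub, sub_add_cancel])
      (tendsto_eLpNorm_smul (M := L) (Eventually.of_forall fun x k => ?_) h4) t2
    rw [norm_smul]
    gcongr
    exact hFd _
  have t4 : Tendsto (fun k => eLpNorm (fun x => F (φ k x)) 1 (surf (frontier U)))
      atTop (𝓝 0) := by
    have lim := ENNReal.Tendsto.const_mul (t1.add t3) (Or.inr hC)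
    simp only [add_zero, mul_zero] at lim
    exact tendsto_of_tendsto_of_tendsto_of_le_of_le tendsto_const_nhds lim (fun _ => zero_le)
      fun k => H _ (hFc k)
  have hFτ : AEStronglyMeasurable (fun x => F (τ x)) (surf (frontier U)) :=
    hF.continuous.comp_aestronglyMeasurable hτ.1
  have t5 : Tendsto (fun k => eLpNorm (fun x => F (φ k x) - F (τ x)) 1 (surf (frontier U)))
      atTop (𝓝 0) :=
    tendsto_eLpNorm_smul (M := L) (Eventually.of_forall fun x k => hFL _ _) h5
  have t6 := tendsto_eLpNorm_add (w := fun _ x => F (τ x))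
    (u := fun k x => F (φ k x)) (v := fun k x => -(F (φ k x) - F (τ x)))
    (fun k => (hFc k).continuous.aestronglyMeasurable)
    (fun k => ((hFc k).continuous.aestronglyMeasurable.sub hFτ).neg)
    (fun k x => by ring) t4 (by
      refine t5.congr fun k => ?_
      exact (eLpNorm_neg (fun x => F (φ k x) - F (τ x)) 1 _).symm)
  filter_upwards [(eLpNorm_eq_zero_iff hFτ one_ne_zero).1
    (tendsto_nhds_unique tendsto_const_nhds t6)] with x hx using (hF0 _).1 hx

theorem IsTrace.ae_norm_le {U : Set (E N)} (hU : IsOpen U) (hb : Bornology.IsBounded U)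
    (hL : HasLipschitzBoundary U) {f : E N → ℝ} {G : E N → E N} {τ : E N → ℝ}
    (h : IsTrace U f G τ) (hf : MemLp f 1 (volume.restrict U))
    (hG : MemLp G 1 (volume.restrict U)) {M : ℝ} (hM : ∀ᵐ x ∂(volume.restrict U), ‖f x‖ ≤ M) :
    ∀ᵐ x ∂(surf (frontier U)), ‖τ x‖ ≤ M := by
  have h1 := h.ae_le hU hb hL hf hG (hM.mono fun x hx => (le_abs_self _).trans hx)
  have h2 := (h.const_mul hU.measurableSet hb hf hG (-1)).ae_le hU hb hL (hf.const_mul (-1))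
    (hG.const_smul (-1 : ℝ)) (hM.mono fun x hx => by
      rw [neg_one_mul]; exact (neg_le_abs _).trans hx)
  filter_upwards [h1, h2] with x hx1 hx2
  exact abs_le.2 ⟨by linarith, hx1⟩

/-- The trace of an essentially bounded Sobolev function is essentially bounded. -/
theorem Sobolev.memLp_top_trace {U : Set (E N)} (hU : IsOpen U) (hb : Bornology.IsBounded U)
    (hL : HasLipschitzBoundary U) {p : ℝ≥0∞} [Fact (1 ≤ p)] (v : Sobolev U p)
    (hv : MemLp v.fn ∞ (volume.restrict U)) : MemLp (trace U v) ⊤ (surf (frontier U)) := by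
  have hp := v.isSobolevPair hb subset_rfl
  have ht := v.isTrace_trace hU hb hL subset_rfl
  refine memLp_top_of_bound ht.1.1 (eLpNormEssSup v.fn (volume.restrict U)).toReal
    (ht.ae_norm_le hU hb hL hp.memLp_fn hp.memLp_grad ?_)
  have hfin : eLpNormEssSup v.fn (volume.restrict U) ≠ ⊤ := by
    rw [← eLpNorm_exponent_top]; exact hv.2.ne
  filter_upwards [enorm_ae_le_eLpNormEssSup v.fn (volume.restrict U)] with x hx
  rw [← toReal_enorm]
  exact ENNReal.toReal_mono hfin hx

/-! ### Compactness of the embedding of `H^1` in `L^2` -/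

theorem norm_mollify_le {F : Type*} [NormedAddCommGroup F] [NormedSpace ℝ F] {k : E N → ℝ}
    {w : E N → F} (hk : MemLp k 2 volume) (hw : MemLp w 2 volume) (y : E N) :
    ‖mollify k w y‖ ≤ (eLpNorm k 2 volume).toReal * (eLpNorm w 2 volume).toReal := by
  have hmp : MeasurePreserving (fun t : E N => y - t) volume volume :=
    Measure.measurePreserving_sub_left volume y
  have hwy : MemLp (fun t => w (y - t)) 2 volume := hw.comp_measurePreserving hmp
  have h1 : eLpNorm (fun t => k t • w (y - t)) 1 volume
      ≤ eLpNorm k 2 volume * eLpNorm w 2 volume := by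
    refine (eLpNorm_smul_le_mul_eLpNorm (p := 2) (q := 2) hwy.1 hk.1).trans (le_of_eq ?_)
    congr 1
    exact eLpNorm_comp_measurePreserving hw.1 hmp
  rw [← ENNReal.toReal_mul, mollify, ← toReal_enorm]
  refine ENNReal.toReal_mono (ENNReal.mul_ne_top hk.2.ne hw.2.ne)
    ((enorm_integral_le_lintegral_enorm _).trans ?_)
  rwa [← eLpNorm_one_eq_lintegral_enorm]

/-- Difference quotients of a Sobolev function, tested against functions supported in `Γ`, are
controlled by the gradient. -/
theorem HasWeakGradient.abs_translate_sub_le {Γ : Set (E N)} {w : E N → ℝ} {W : E N → E N}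
    (h : HasWeakGradient Γ w W) (hw : MemLp w 2 volume) (hW : MemLp W 2 volume)
    {φ : E N → ℝ} (hφ : ContDiff ℝ ∞ φ) (hc : HasCompactSupport φ) (hφΓ : tsupport φ ⊆ Γ)
    {z : E N} (hz : ∀ t ∈ Icc (0 : ℝ) 1, ∀ y ∈ Γ, y - t • z ∈ Γ) :
    |(∫ y, w (y - z) * φ y) - ∫ y, w y * φ y|
      ≤ (eLpNorm φ 2 volume).toReal * (eLpNorm W 2 volume).toReal * ‖z‖ := by
  -- With the reflected test function as kernel, the pairing ∫ w(y - a) φ(y) dy is a mollification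
  -- of w evaluated at -a. The claim becomes a mean value inequality on the segment from 0 to -z.
  let k : E N → ℝ := fun x => φ (-x)
  have hk : ContDiff ℝ ∞ k := hφ.comp contDiff_neg
  have hkc : HasCompactSupport k := hc.comp_homeomorph (Homeomorph.neg (E N))
  have hwl : LocallyIntegrable w := hw.locallyIntegrable one_le_two
  have hk2 : MemLp k 2 volume := hk.continuous.memLp_of_hasCompactSupport hkc
  have hkn : eLpNorm k 2 volume = eLpNorm φ 2 volume :=
    eLpNorm_comp_measurePreserving hφ.continuous.aestronglyMeasurable
      (Measure.measurePreserving_neg volume)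
  have hval : ∀ a : E N, mollify k w (-a) = ∫ y, w (y - a) * φ y := by
    intro a
    rw [mollify, ← integral_neg_eq_self]
    refine integral_congr_ae (Eventually.of_forall fun t => ?_)
    simp only [k, neg_neg, smul_eq_mul, mul_comm, sub_neg_eq_add]
    rw [neg_add_eq_sub]
  have hgrad : ∀ y ∈ segment ℝ (0 : E N) (-z), ‖fderiv ℝ (mollify k w) y‖
      ≤ (eLpNorm φ 2 volume).toReal * (eLpNorm W 2 volume).toReal := by
    intro y hy
    obtain ⟨t, ht, rfl⟩ : ∃ t ∈ Icc (0 : ℝ) 1, -(t • z) = y := by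
      rw [segment_eq_image'] at hy
      obtain ⟨t, ht, rfl⟩ := hy
      exact ⟨t, ht, by simp⟩
    rw [← norm_gradient, h.gradient_mollify_of_tsupport hk hkc hwl, ← hkn]
    · exact norm_mollify_le hk2 hW _
    · intro x hx
      have h1 : x + t • z ∈ tsupport φ := by
        have e : (fun x => k (-(t • z) - x)) = fun x => φ (x + t • z) := by
          ext x
          simp only [k]
          congr 1
          abel
        rw [e] at hx
        exact tsupport_comp_subset_preimage φ (f := fun x => x + t • z) (by fun_prop) hx
      simpa using hz t ht _ (hφΓ h1)
  have key := (convex_segment (0 : E N) (-z)).norm_image_sub_le_of_norm_fderiv_le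
    (𝕜 := ℝ) (f := mollify k w)
    (fun y _ => (contDiff_mollify hk hkc hwl).differentiable (by simp) y) hgrad
    (left_mem_segment ℝ _ _) (right_mem_segment ℝ _ _)
  rw [hval z, ← neg_zero, hval 0, neg_zero, sub_zero, norm_neg] at key
  simpa using key

/-- A function in `L^2(Γ)` whose pairings with test functions are bounded by `C ‖φ‖` has norm at
most `C`. -/
theorem eLpNorm_le_of_forall_test {Γ : Set (E N)} (hΓ : IsOpen Γ) {h : E N → ℝ}
    (hh : MemLp h 2 (volume.restrict Γ)) {C : ℝ} (hC : 0 ≤ C)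
    (H : ∀ φ : E N → ℝ, ContDiff ℝ ∞ φ → HasCompactSupport φ → tsupport φ ⊆ Γ →
      |∫ y, h y * φ y| ≤ C * (eLpNorm φ 2 volume).toReal) :
    eLpNorm h 2 (volume.restrict Γ) ≤ ENNReal.ofReal C := by
  let S : Submodule ℝ (Lp ℝ 2 (volume.restrict Γ)) :=
    { carrier := {g | ∃ φ : E N → ℝ, ContDiff ℝ ∞ φ ∧ HasCompactSupport φ ∧ tsupport φ ⊆ Γ ∧
        g =ᵐ[volume.restrict Γ] φ}
      zero_mem' := ⟨0, contDiff_const, HasCompactSupport.zero, by simp, Lp.coeFn_zero _ _ _⟩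
      add_mem' := by
        rintro g g' ⟨φ, h1, h2, h3, h4⟩ ⟨φ', h1', h2', h3', h4'⟩
        refine ⟨φ + φ', h1.add h1', h2.add h2',
          (tsupport_add φ φ').trans (union_subset h3 h3'), ?_⟩
        filter_upwards [Lp.coeFn_add g g', h4, h4'] with x e1 e2 e3
        rw [e1, Pi.add_apply, Pi.add_apply, e2, e3]
      smul_mem' := by
        rintro c g ⟨φ, h1, h2, h3, h4⟩
        refine ⟨fun x => c * φ x, contDiff_const.mul h1, HasCompactSupport.mul_left h2,
          (tsupport_mul_subset_right (f := fun _ => c) (g := φ)).trans h3, ?_⟩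
        filter_upwards [Lp.coeFn_smul c g, h4] with x e1 e2
        rw [e1, Pi.smul_apply, e2, smul_eq_mul] }
  have hbd : ∀ (f : E N → ℝ) (φ : E N → ℝ), tsupport φ ⊆ Γ →
      ∫ y in Γ, φ y * f y = ∫ y, φ y * f y := fun f φ hφ =>
    setIntegral_eq_integral_of_forall_compl_eq_zero fun x hx => by
      rw [image_eq_zero_of_notMem_tsupport fun h' => hx (hφ h'), zero_mul]
  have hinner : ∀ (f g : Lp ℝ 2 (volume.restrict Γ)) (φ : E N → ℝ),
      g =ᵐ[volume.restrict Γ] φ → inner ℝ g f = ∫ y in Γ, φ y * f y := by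
    intro f g φ hg
    rw [L2.inner_def]
    refine integral_congr_ae ?_
    filter_upwards [hg] with x hx
    rw [hx]
    simp [mul_comm]
  -- A function orthogonal to all test functions vanishes by the fundamental lemma of the calculus
  -- of variations.
  have hdense : S.topologicalClosure = ⊤ := by
    rw [Submodule.topologicalClosure_eq_top_iff, Submodule.eq_bot_iff]
    intro f hf
    rw [Submodule.mem_orthogonal] at hf
    have h0 := hΓ.ae_eq_zero_of_integral_contDiff_smul_eq_zero (μ := (volume : Measure (E N)))
      (f := f) (locallyIntegrableOn_of_locallyIntegrable_restrict
        ((Lp.memLp f).locallyIntegrable one_le_two)) fun φ h1 h2 h3 => by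
        have hφ2 : MemLp φ 2 (volume.restrict Γ) :=
          (h1.continuous.memLp_of_hasCompactSupport h2).restrict Γ
        have := hf (hφ2.toLp φ) ⟨φ, h1, h2, h3, hφ2.coeFn_toLp⟩
        rw [hinner f _ φ hφ2.coeFn_toLp, hbd _ _ h3] at this
        simpa only [smul_eq_mul] using this
    refine Lp.ext ?_
    filter_upwards [Lp.coeFn_zero ℝ 2 (volume.restrict Γ), ae_restrict_of_ae h0,
      ae_restrict_mem hΓ.measurableSet] with x e1 e2 e3
    rw [e1, e2 e3, Pi.zero_apply]
  set g₀ := hh.toLp h with hg₀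
  have hle : ∀ g : Lp ℝ 2 (volume.restrict Γ), |inner ℝ g g₀| ≤ C * ‖g‖ := by
    have hcl : IsClosed {g : Lp ℝ 2 (volume.restrict Γ) | |inner ℝ g g₀| ≤ C * ‖g‖} :=
      isClosed_le (by fun_prop) (by fun_prop)
    have hsub : (S : Set (Lp ℝ 2 (volume.restrict Γ)))
        ⊆ {g : Lp ℝ 2 (volume.restrict Γ) | |inner ℝ g g₀| ≤ C * ‖g‖} := by
      rintro g ⟨φ, h1, h2, h3, h4⟩
      have e1 : inner ℝ g g₀ = ∫ y, h y * φ y := by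
        rw [hinner _ _ φ h4]
        have : ∫ y in Γ, φ y * g₀ y = ∫ y in Γ, φ y * h y := by
          refine integral_congr_ae ?_
          filter_upwards [hh.coeFn_toLp] with x hx
          rw [hg₀, hx]
        rw [this, hbd _ _ h3]
        simp only [mul_comm]
      have e2 : eLpNorm φ 2 volume = eLpNorm g 2 (volume.restrict Γ) := by
        rw [eLpNorm_congr_ae h4, eLpNorm_restrict_eq_of_support_subset
          ((subset_tsupport φ).trans h3)]
      rw [mem_ofPred_eq, e1, Lp.norm_def, ← e2]
      exact H φ h1 h2 h3
    intro g
    have hg : g ∈ S.topologicalClosure := hdense ▸ Submodule.mem_top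
    exact closure_minimal hsub hcl hg
  -- By density h itself may serve as test function: ‖h‖² ≤ C‖h‖.
  have hfin := hle g₀
  rw [real_inner_self_eq_norm_sq, abs_of_nonneg (by positivity), sq] at hfin
  have hn : ‖g₀‖ ≤ C := by
    by_contra! hlt
    have hpos : 0 < ‖g₀‖ := hC.trans_lt hlt
    exact absurd (le_of_mul_le_mul_right hfin hpos) (not_le.2 hlt)
  rw [Lp.norm_toLp] at hn
  exact (ENNReal.le_ofReal_iff_toReal_le hh.2.ne hC).2 hn

/-- A mollification along shift directions at scale `δ` is close in `L^2(Γ)`. -/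
theorem HasWeakGradient.eLpNorm_mollify_sub_le {Γ : Set (E N)} (hΓ : IsOpen Γ) {w : E N → ℝ}
    {W : E N → E N} (h : HasWeakGradient Γ w W) (hw1 : MemLp w 1 volume) (hw : MemLp w 2 volume)
    (hW : MemLp W 2 volume) {δ : ℝ} (hδ : 0 ≤ δ) {k : E N → ℝ} (hk : IsShiftKernel Γ δ k) :
    eLpNorm (fun y => mollify k w y - w y) 2 (volume.restrict Γ)
      ≤ ENNReal.ofReal (δ * (eLpNorm W 2 volume).toReal) := by
  have hwl : LocallyIntegrable w := hw.locallyIntegrable one_le_two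
  have hki : Integrable k := hk.contDiff.continuous.integrable_of_hasCompactSupport
    hk.hasCompactSupport
  have hk2 : MemLp k 2 volume :=
    hk.contDiff.continuous.memLp_of_hasCompactSupport hk.hasCompactSupport
  have hkw : Integrable (mollify k w) :=
    hki.integrable_convolution (ContinuousLinearMap.lsmul ℝ ℝ) (memLp_one_iff_integrable.1 hw1)
  -- Bounded and integrable, hence square integrable.
  have hkwm : MemLp (mollify k w) 2 volume := by
    have hmeas : AEStronglyMeasurable (mollify k w) volume := hkw.1
    rw [memLp_two_iff_integrable_sq hmeas]
    simp only [sq]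
    exact hkw.bdd_mul hmeas (Eventually.of_forall (norm_mollify_le hk2 hw))
  refine eLpNorm_le_of_forall_test hΓ ((hkwm.sub hw).restrict Γ) (by positivity)
    fun φ h1 h2 h3 => ?_
  have hφ2 : MemLp φ 2 volume := h1.continuous.memLp_of_hasCompactSupport h2
  -- Fubini
  have hF : Integrable (fun p : E N × E N => φ p.1 * (k p.2 * w (p.1 - p.2)))
      (volume.prod volume) := by
    obtain ⟨M, hM⟩ := h2.exists_bound_of_continuous h1.continuous
    exact (hki.convolution_integrand (ContinuousLinearMap.lsmul ℝ ℝ)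
      (memLp_one_iff_integrable.1 hw1)).bdd_mul
      (h1.continuous.comp continuous_fst).aestronglyMeasurable
      (Eventually.of_forall fun p => hM p.1)
  have e1 : ∫ y, mollify k w y * φ y = ∫ z, k z * ∫ y, w (y - z) * φ y := by
    calc ∫ y, mollify k w y * φ y = ∫ y, (∫ z, φ y * (k z * w (y - z))) := by
          congr 1 with y
          rw [integral_const_mul, mul_comm]
          rfl
      _ = ∫ z, (∫ y, φ y * (k z * w (y - z))) := integral_integral_swap hF
      _ = _ := by
          congr 1 with z
          rw [← integral_const_mul]
          congr 1 with y
          ring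
  have hψi : Integrable fun z => k z * ∫ y, w (y - z) * φ y := by
    refine hF.integral_prod_right.congr (Eventually.of_forall fun z => ?_)
    simp only
    rw [← integral_const_mul]
    congr 1 with y
    ring
  have i1 : Integrable fun y => mollify k w y * φ y := hkwm.integrable_mul hφ2
  have i2 : Integrable fun y => w y * φ y := hw.integrable_mul hφ2
  -- The pairing of the error with φ is a k-average of translation differences, each at most δ‖W‖‖φ‖
  -- by `HasWeakGradient.abs_translate_sub_le`.
  have e2 : ∫ y, (mollify k w y - w y) * φ y
      = ∫ z, k z * ((∫ y, w (y - z) * φ y) - ∫ y, w y * φ y) := by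
    simp only [sub_mul, mul_sub]
    rw [integral_sub i1 i2, integral_sub hψi (hki.mul_const _), e1, integral_mul_const,
      hk.integral_eq_one, one_mul]
  simp only [Pi.sub_apply]
  rw [e2, ← Real.norm_eq_abs]
  set A := (eLpNorm φ 2 volume).toReal * (eLpNorm W 2 volume).toReal with hA
  have hA0 : 0 ≤ A := by positivity
  have hb : ∀ z, ‖k z * ((∫ y, w (y - z) * φ y) - ∫ y, w y * φ y)‖ ≤ k z * (A * δ) := by
    intro z
    rw [norm_mul, Real.norm_of_nonneg (hk.nonneg z)]
    by_cases hz : z ∈ tsupport k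
    · have hzδ : ‖z‖ ≤ δ := by simpa using (Metric.mem_ball.1 (hk.tsupport_subset hz)).le
      refine mul_le_mul_of_nonneg_left ?_ (hk.nonneg z)
      exact (h.abs_translate_sub_le hw hW h1 h2 h3 (hk.shift z hz)).trans (by gcongr)
    · rw [image_eq_zero_of_notMem_tsupport hz, zero_mul, zero_mul]
  refine (norm_integral_le_of_norm_le (hki.mul_const _) (Eventually.of_forall hb)).trans
    (le_of_eq ?_)
  rw [integral_mul_const, hk.integral_eq_one, hA]
  ring

/-! ### Weak convergence in Sobolev spaces -/

/-- The uniform boundedness principle in the bidual, into which the space embeds isometrically. It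
needs a sequence: a family converging along a general filter may be unbounded. -/
theorem WeakTendsto.exists_norm_le {X : Type*} [NormedAddCommGroup X] [NormedSpace ℝ X]
    {v : ℕ → X} {w : X} (h : WeakTendsto v atTop w) : ∃ M, ∀ n, ‖v n‖ ≤ M := by
  obtain ⟨M, hM⟩ := banach_steinhaus (g := fun n => NormedSpace.inclusionInDoubleDual ℝ X (v n))
    fun L => by
      obtain ⟨C, hC⟩ := (h L).norm.bddAbove_range
      exact ⟨C, fun n => hC ⟨n, rfl⟩⟩
  refine ⟨M, fun n => ?_⟩
  have := hM n
  rwa [← (NormedSpace.inclusionInDoubleDualLi ℝ (E := X)).norm_map (v n)]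

/-- The functional `v ↦ ∫ h v` on `H^1(U)`. -/
theorem WeakTendsto.integral_fn {ι : Type*} {l : Filter ι} {U : Set (E N)} {v : ι → Sobolev U 2}
    {w : Sobolev U 2} (hv : WeakTendsto v l w) {h : E N → ℝ} (hh : MemLp h 2 (volume.restrict U)) :
    Tendsto (fun i => ∫ x in U, h x * (v i).fn x) l (𝓝 (∫ x in U, h x * w.fn x)) := by
  let L : Sobolev U 2 →L[ℝ] ℝ := (innerSL ℝ (hh.toLp h)).comp
    ((WithLp.fstL 2 ℝ (Lp ℝ 2 (volume.restrict U)) (Lp (E N) 2 (volume.restrict U))).comp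
      (sobolevSubmodule U 2).subtypeL)
  have hL : ∀ u : Sobolev U 2, L u = ∫ x in U, h x * u.fn x := by
    intro u
    change inner ℝ (hh.toLp h) u.1.fst = _
    rw [L2.inner_def]
    refine integral_congr_ae ?_
    filter_upwards [hh.coeFn_toLp] with x hx
    rw [hx]
    exact mul_comm _ _
  simpa only [hL] using hv L

/-- The functional `v ↦ ∫ H · ∇v` on `H^1(U)`. -/
theorem WeakTendsto.integral_grad {ι : Type*} {l : Filter ι} {U : Set (E N)}
    {v : ι → Sobolev U 2} {w : Sobolev U 2} (hv : WeakTendsto v l w) {H : E N → E N}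
    (hH : MemLp H 2 (volume.restrict U)) :
    Tendsto (fun i => ∫ x in U, inner ℝ (H x) ((v i).grad x)) l
      (𝓝 (∫ x in U, inner ℝ (H x) (w.grad x))) := by
  let L : Sobolev U 2 →L[ℝ] ℝ := (innerSL ℝ (hH.toLp H)).comp
    ((WithLp.sndL 2 ℝ (Lp ℝ 2 (volume.restrict U)) (Lp (E N) 2 (volume.restrict U))).comp
      (sobolevSubmodule U 2).subtypeL)
  have hL : ∀ u : Sobolev U 2, L u = ∫ x in U, inner ℝ (H x) (u.grad x) := by
    intro u
    change inner ℝ (hH.toLp H) u.1.snd = _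
    rw [L2.inner_def]
    refine integral_congr_ae ?_
    filter_upwards [hH.coeFn_toLp] with x hx
    rw [hx]
    rfl
  simpa only [hL] using hv L

/-! ### The Rellich theorem -/

theorem eLpNorm_two_restrict_union_le {s t : Set (E N)} (f : E N → ℝ) :
    eLpNorm f 2 (volume.restrict (s ∪ t))
      ≤ eLpNorm f 2 (volume.restrict s) + eLpNorm f 2 (volume.restrict t) := by
  simp only [eLpNorm_eq_lintegral_rpow_enorm_toReal two_ne_zero ENNReal.ofNat_ne_top]
  refine le_trans ?_ (ENNReal.rpow_add_le_add_rpow _ _ (by norm_num) (by norm_num))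
  gcongr
  exact lintegral_union_le _ _ _

theorem tendsto_eLpNorm_two_of_bounded {U : Set (E N)} (hb : Bornology.IsBounded U)
    {u : ℕ → E N → ℝ} (hm : ∀ n, AEStronglyMeasurable (u n) (volume.restrict U)) {M : ℝ}
    (hM : ∀ n x, ‖u n x‖ ≤ M) (hu : ∀ x, Tendsto (fun n => u n x) atTop (𝓝 0)) :
    Tendsto (fun n => eLpNorm (u n) 2 (volume.restrict U)) atTop (𝓝 0) := by
  have : Fact (Bornology.IsBounded U) := ⟨hb⟩
  have key : Tendsto (fun n => ∫⁻ x in U, ‖u n x‖ₑ ^ (2 : ℝ)) atTop (𝓝 0) := by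
    rw [← lintegral_zero (μ := volume.restrict U)]
    refine tendsto_lintegral_of_dominated_convergence' (fun _ => ENNReal.ofReal M ^ (2 : ℝ))
      (fun n => (hm n).enorm.pow_const _) (fun n => Eventually.of_forall fun x => ?_) ?_
      (Eventually.of_forall fun x => ?_)
    · simp only
      gcongr
      rw [← ofReal_norm]
      exact ENNReal.ofReal_le_ofReal (hM n x)
    · rw [lintegral_const]
      exact ENNReal.mul_ne_top (by simp) (measure_ne_top _ _)
    · have := ((ENNReal.continuous_rpow_const (y := 2)).tendsto 0).comp
        (by simpa using (hu x).enorm : Tendsto (fun n => ‖u n x‖ₑ) atTop (𝓝 0))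
      rwa [ENNReal.zero_rpow_of_pos (by norm_num)] at this
  simp only [eLpNorm_eq_lintegral_rpow_enorm_toReal two_ne_zero ENNReal.ofNat_ne_top]
  have := ((ENNReal.continuous_rpow_const (y := 1 / 2)).tendsto 0).comp key
  rw [ENNReal.zero_rpow_of_pos (by norm_num)] at this
  simpa [Function.comp_def] using this

/-- At a fixed scale the mollifications of χ d_n tend to 0 strongly: pointwise by weak convergence,
and dominated by a constant. The mollification error on Γ is at most δ times a gradient bound that
is uniform in n, so δ is chosen first and n afterwards. -/
theorem rellich_patch {U Γ : Set (E N)} (hU : IsOpen U) (hb : Bornology.IsBounded U) {x : E N}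
    {r : ℝ} (hΓo : IsOpen Γ) (hΓ : HasShiftDirections Γ)
    (hUΓ : U ∩ Metric.ball x r = Γ ∩ Metric.ball x r) {d : ℕ → Sobolev U 2}
    (hd : WeakTendsto d atTop 0) {χ : E N → ℝ} (hχ : ContDiff ℝ ∞ χ)
    (hsupp : tsupport χ ⊆ Metric.ball x r) :
    Tendsto (fun n => eLpNorm (fun y => χ y * (d n).fn y) 2 (volume.restrict U)) atTop (𝓝 0) := by
  have : Fact (Bornology.IsBounded U) := ⟨hb⟩
  obtain ⟨M, hM⟩ := hd.exists_norm_le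
  have hMe : ∀ n, ‖d n‖ₑ ≤ ENNReal.ofReal M := fun n => by
    rw [← ofReal_norm]; exact ENNReal.ofReal_le_ofReal (hM n)
  obtain ⟨A, hA⟩ := exists_bound_of_continuous hb hχ.continuous
  obtain ⟨A', hA'⟩ := exists_bound_of_continuous hb (continuous_gradient hχ)
  set w : ℕ → E N → ℝ := fun n => U.indicator fun y => χ y * (d n).fn y with hw
  set W : ℕ → E N → E N := fun n =>
    U.indicator fun y => χ y • (d n).grad y + (d n).fn y • gradient χ y with hW
  have hwr : ∀ n, MemLp (fun y => χ y * (d n).fn y) 2 (volume.restrict U) := fun n =>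
    memLp_smooth_mul hU.measurableSet hb (d n).memLp_fn hχ
  have hw2 : ∀ n, MemLp (w n) 2 volume := fun n =>
    (memLp_indicator_iff_restrict hU.measurableSet).2 (hwr n)
  have hw1 : ∀ n, MemLp (w n) 1 volume := fun n =>
    (memLp_indicator_iff_restrict hU.measurableSet).2 ((hwr n).mono_exponent one_le_two)
  have hW2 : ∀ n, MemLp (W n) 2 volume := fun n =>
    (memLp_indicator_iff_restrict hU.measurableSet).2
      (memLp_smooth_mul_grad hU.measurableSet hb (d n).memLp_fn (d n).memLp_grad hχ)
  have hgrad : ∀ n, HasWeakGradient Γ (w n) (W n) := fun n =>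
    (d n).hasWeakGradient.localize hU hUΓ ((d n).memLp_fn.locallyIntegrable one_le_two)
      ((d n).memLp_grad.locallyIntegrable one_le_two) hχ hsupp
  -- uniform bounds
  have hin : ∀ᵐ y ∂(volume.restrict U), ‖χ y‖ ≤ A ∧ ‖gradient χ y‖ ≤ A' := by
    filter_upwards [ae_restrict_mem hU.measurableSet] with y hy using ⟨hA y hy, hA' y hy⟩
  have hwM : ∀ n, eLpNorm (w n) 2 volume ≤ ENNReal.ofReal A * ENNReal.ofReal M := fun n => by
    rw [hw, eLpNorm_indicator_eq_eLpNorm_restrict hU.measurableSet]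
    refine (eLpNorm_le_mul_eLpNorm_of_ae_le_mul (g := (d n).fn) (c := A) ?_ 2).trans
      (mul_le_mul_right ((d n).eLpNorm_fn_le.trans (hMe n)) _)
    filter_upwards [hin] with y hy
    rw [norm_mul]
    gcongr
    exact hy.1
  have hWM : ∀ n, eLpNorm (W n) 2 volume
      ≤ ENNReal.ofReal A * ENNReal.ofReal M + ENNReal.ofReal A' * ENNReal.ofReal M := fun n => by
    rw [hW, eLpNorm_indicator_eq_eLpNorm_restrict hU.measurableSet]
    refine (eLpNorm_add_le (f := fun y => χ y • (d n).grad y)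
      (g := fun y => (d n).fn y • gradient χ y)
      (hχ.continuous.aestronglyMeasurable.smul (d n).memLp_grad.1)
      ((d n).memLp_fn.1.smul (continuous_gradient hχ).aestronglyMeasurable) one_le_two).trans
      (add_le_add ?_ ?_)
    · refine (eLpNorm_le_mul_eLpNorm_of_ae_le_mul (g := (d n).grad) (c := A) ?_ 2).trans
        (mul_le_mul_right ((d n).eLpNorm_grad_le.trans (hMe n)) _)
      filter_upwards [hin] with y hy
      rw [norm_smul]
      gcongr
      exact hy.1
    · refine (eLpNorm_le_mul_eLpNorm_of_ae_le_mul (g := (d n).fn) (c := A') ?_ 2).trans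
        (mul_le_mul_right ((d n).eLpNorm_fn_le.trans (hMe n)) _)
      filter_upwards [hin] with y hy
      rw [norm_smul, mul_comm]
      gcongr
      exact hy.2
  set B : ℝ≥0∞ := ENNReal.ofReal A * ENNReal.ofReal M + ENNReal.ofReal A' * ENNReal.ofReal M
    with hB
  have hBtop : B ≠ ⊤ := by simp [hB, ENNReal.mul_eq_top]
  -- mollifications converge strongly
  have hmoll : ∀ {δ : ℝ} {k : E N → ℝ}, IsShiftKernel Γ δ k →
      Tendsto (fun n => eLpNorm (mollify k (w n)) 2 (volume.restrict U)) atTop (𝓝 0) := by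
    intro δ k hk
    have hk2 : MemLp k 2 volume :=
      hk.contDiff.continuous.memLp_of_hasCompactSupport hk.hasCompactSupport
    refine tendsto_eLpNorm_two_of_bounded hb (fun n => (contDiff_mollify hk.contDiff
      hk.hasCompactSupport ((hw2 n).locallyIntegrable one_le_two)).continuous.aestronglyMeasurable)
      (M := (eLpNorm k 2 volume).toReal * (ENNReal.ofReal A * ENNReal.ofReal M).toReal)
      (fun n y => (norm_mollify_le hk2 (hw2 n) y).trans ?_) fun y => ?_
    · gcongr
      · exact ENNReal.mul_ne_top ENNReal.ofReal_ne_top ENNReal.ofReal_ne_top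
      · exact hwM n
    · have hky : ContDiff ℝ ∞ fun t => k (y - t) := hk.contDiff.comp (by fun_prop)
      have hky2 : MemLp (fun t => k (y - t) * χ t) 2 (volume.restrict U) :=
        (memLp_top_of_continuous hU.measurableSet hb
          (hky.mul hχ).continuous).mono_exponent le_top
      have h1 := hd.integral_fn hky2
      -- The value at y is the pairing of d_n with the fixed L^2 function k(y - ·)χ, so weak
      -- convergence applies.
      have e1 : ∀ n, mollify k (w n) y = ∫ t in U, k (y - t) * χ t * (d n).fn t := by
        intro n
        rw [mollify, ← integral_sub_left_eq_self _ volume y,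
          ← integral_indicator hU.measurableSet]
        congr 1 with t
        rw [sub_sub_cancel]
        by_cases ht : t ∈ U
        · simp [hw, ht, mul_assoc]
        · simp [hw, ht]
      have e2 : ∫ t in U, k (y - t) * χ t * (0 : Sobolev U 2).fn t = 0 := by
        rw [← integral_zero (E N) ℝ (μ := volume.restrict U)]
        refine integral_congr_ae ?_
        have h0 : (0 : Sobolev U 2).fn =ᵐ[volume.restrict U] 0 := Lp.coeFn_zero _ _ _
        filter_upwards [h0] with t ht
        rw [ht, Pi.zero_apply, mul_zero]
      rw [e2] at h1
      simpa only [e1] using h1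
  rw [ENNReal.tendsto_nhds_zero]
  intro ε hε
  -- choice of the scale
  obtain ⟨δ, hδ, hδε⟩ : ∃ δ > 0, ENNReal.ofReal (δ * B.toReal) ≤ ε / 2 := by
    have hlim : Tendsto (fun δ : ℝ => ENNReal.ofReal (δ * B.toReal)) (𝓝[>] 0) (𝓝 0) := by
      have : Tendsto (fun δ : ℝ => ENNReal.ofReal (δ * B.toReal)) (𝓝 0)
          (𝓝 (ENNReal.ofReal (0 * B.toReal))) :=
        (ENNReal.continuous_ofReal.comp (by fun_prop)).tendsto 0
      rw [zero_mul, ENNReal.ofReal_zero] at this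
      exact this.mono_left nhdsWithin_le_nhds
    have hev := (ENNReal.tendsto_nhds_zero.1 hlim _ (ENNReal.half_pos hε.ne')).and
      self_mem_nhdsWithin
    obtain ⟨δ, h1, h2⟩ := hev.exists
    exact ⟨δ, h2, h1⟩
  obtain ⟨k, hk⟩ := hΓ.exists_kernel hδ
  filter_upwards [ENNReal.tendsto_nhds_zero.1 (hmoll hk) _ (ENNReal.half_pos hε.ne')] with n hn
  have hV : MeasurableSet (U ∩ Metric.ball x r) := hU.measurableSet.inter measurableSet_ball
  -- The error estimate is available on Γ only, which agrees with U inside the ball; χ vanishes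
  -- outside it.
  have e0 : eLpNorm (fun y => χ y * (d n).fn y) 2 (volume.restrict U)
      ≤ eLpNorm (w n) 2 (volume.restrict (U ∩ Metric.ball x r)) := by
    rw [← eLpNorm_indicator_eq_eLpNorm_restrict hU.measurableSet,
      ← eLpNorm_indicator_eq_eLpNorm_restrict hV]
    refine eLpNorm_mono fun y => ?_
    by_cases hy : y ∈ U ∩ Metric.ball x r
    · rw [indicator_of_mem hy]
    · by_cases hyU : y ∈ U
      · have : y ∉ tsupport χ := fun h' => hy ⟨hyU, hsupp h'⟩
        rw [indicator_of_mem hyU, image_eq_zero_of_notMem_tsupport this, zero_mul, norm_zero]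
        exact norm_nonneg _
      · rw [indicator_of_notMem hyU, norm_zero]
        exact norm_nonneg _
  have hmk : AEStronglyMeasurable (mollify k (w n)) volume :=
    (contDiff_mollify hk.contDiff hk.hasCompactSupport
      ((hw2 n).locallyIntegrable one_le_two)).continuous.aestronglyMeasurable
  have e1 : w n = mollify k (w n) - fun y => mollify k (w n) y - w n y := by
    ext y; simp
  calc eLpNorm (fun y => χ y * (d n).fn y) 2 (volume.restrict U)
      ≤ eLpNorm (w n) 2 (volume.restrict (U ∩ Metric.ball x r)) := e0
    _ ≤ eLpNorm (mollify k (w n)) 2 (volume.restrict (U ∩ Metric.ball x r))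
        + eLpNorm (fun y => mollify k (w n) y - w n y) 2
          (volume.restrict (U ∩ Metric.ball x r)) := by
        conv_lhs => rw [e1]
        exact eLpNorm_sub_le hmk.restrict (hmk.sub (hw2 n).1).restrict one_le_two
    _ ≤ ε / 2 + ε / 2 := by
        refine add_le_add ((eLpNorm_mono_measure _
          (Measure.restrict_mono inter_subset_left le_rfl)).trans hn) ?_
        rw [hUΓ]
        refine ((eLpNorm_mono_measure _ (Measure.restrict_mono inter_subset_left le_rfl)).trans
          ((hgrad n).eLpNorm_mollify_sub_le hΓo (hw1 n) (hw2 n) (hW2 n) hδ.le hk)).trans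
          (le_trans (ENNReal.ofReal_le_ofReal ?_) hδε)
        gcongr
        exact hWM n
    _ = ε := ENNReal.add_halves ε

/-- **Rellich's theorem**: on bounded Lipschitz domains, weak convergence in `H^1` implies strong
convergence in `L^2`. -/
theorem WeakTendsto.tendsto_eLpNorm_fn {U : Set (E N)} (hU : IsOpen U)
    (hb : Bornology.IsBounded U) (hL : HasLipschitzBoundary U) {v : ℕ → Sobolev U 2}
    {w : Sobolev U 2} (hv : WeakTendsto v atTop w) :
    Tendsto (fun n => eLpNorm (fun x => (v n).fn x - w.fn x) 2 (volume.restrict U)) atTop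
      (𝓝 0) := by
  have hd : WeakTendsto (fun n => v n - w) atTop 0 := fun L => by
    simpa using (hv L).sub_const (L w)
  have main := hb.isCompact_closure.induction_on
    (p := fun S => Tendsto (fun n => eLpNorm (v n - w).fn 2 (volume.restrict (S ∩ U))) atTop
      (𝓝 0))
    (by simp)
    (fun S T hST h => tendsto_of_tendsto_of_tendsto_of_le_of_le tendsto_const_nhds h
      (fun _ => zero_le) fun n =>
      eLpNorm_mono_measure _ (Measure.restrict_mono (inter_subset_inter_left _ hST) le_rfl))
    (fun S T h h' => tendsto_of_tendsto_of_tendsto_of_le_of_le tendsto_const_nhds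
      (by simpa using h.add h') (fun _ => zero_le) fun n => by
        rw [union_inter_distrib_right]
        exact eLpNorm_two_restrict_union_le _)
    (fun x hx => by
      obtain ⟨r, hr, Γ, hΓo, hΓ, hUΓ⟩ := hL.exists_patch hU hx
      let χ : ContDiffBump x := ⟨r / 4, r / 2, by positivity, by linarith⟩
      refine ⟨Metric.ball x (r / 4), mem_nhdsWithin_of_mem_nhds
        (Metric.ball_mem_nhds _ (by positivity)), ?_⟩
      have hp := rellich_patch hU hb hΓo hΓ hUΓ hd (χ := χ) χ.contDiff (by
        rw [χ.tsupport_eq]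
        exact Metric.closedBall_subset_ball (by change r / 2 < r; linarith))
      refine tendsto_of_tendsto_of_tendsto_of_le_of_le tendsto_const_nhds hp
        (fun _ => zero_le) fun n => ?_
      refine le_trans (le_of_eq (eLpNorm_congr_ae ?_)) (eLpNorm_mono_measure _
        (Measure.restrict_mono inter_subset_right le_rfl))
      filter_upwards [ae_restrict_mem (measurableSet_ball.inter hU.measurableSet)] with y hy
      rw [χ.one_of_mem_closedBall (Metric.ball_subset_closedBall hy.1), one_mul])
  rw [inter_eq_right.2 subset_closure] at main
  refine main.congr fun n => eLpNorm_congr_ae (Sobolev.fn_sub _ _)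

/-! ### Products of strongly and weakly convergent sequences -/

section Products

variable {X F : Type*} [MeasurableSpace X] {μ : Measure X} [NormedAddCommGroup F]
  [InnerProductSpace ℝ F]

theorem eLpNorm_inner_le {a b : X → F} (ha : AEStronglyMeasurable a μ)
    (hb : AEStronglyMeasurable b μ) :
    eLpNorm (fun x => inner ℝ (a x) (b x)) 1 μ ≤ eLpNorm a 2 μ * eLpNorm b 2 μ := by
  simpa using eLpNorm_le_eLpNorm_mul_eLpNorm'_of_norm (p := 2) (q := 2) (r := 1) ha hb
    (fun s t => inner ℝ s t) 1
    (Eventually.of_forall fun x => by simpa using norm_inner_le_norm (𝕜 := ℝ) (a x) (b x))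

theorem integrable_inner_of_memLp {a b : X → F} (ha : MemLp a 2 μ) (hb : MemLp b 2 μ) :
    Integrable (fun x => inner ℝ (a x) (b x)) μ :=
  memLp_one_iff_integrable.1 ⟨ha.1.inner hb.1,
    (eLpNorm_inner_le ha.1 hb.1).trans_lt (ENNReal.mul_lt_top ha.2 hb.2)⟩

/-- Split H_n into H_n - H₀ and H₀: the first part is killed by Cauchy–Schwarz and the uniform bound
on G_n, the second is the assumed convergence. -/
theorem tendsto_integral_inner {H G : ℕ → X → F} {H₀ : X → F} {L : ℝ} {M : ℝ≥0∞}
    (hH : ∀ n, MemLp (H n) 2 μ) (hH₀ : MemLp H₀ 2 μ) (hG : ∀ n, MemLp (G n) 2 μ)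
    (hlim : Tendsto (fun n => eLpNorm (fun x => H n x - H₀ x) 2 μ) atTop (𝓝 0))
    (hM : M ≠ ⊤) (hGM : ∀ n, eLpNorm (G n) 2 μ ≤ M)
    (hL : Tendsto (fun n => ∫ x, inner ℝ (H₀ x) (G n x) ∂μ) atTop (𝓝 L)) :
    Tendsto (fun n => ∫ x, inner ℝ (H n x) (G n x) ∂μ) atTop (𝓝 L) := by
  have h0 : Tendsto (fun n => ∫ x, inner ℝ (H n x - H₀ x) (G n x) ∂μ) atTop (𝓝 0) := by
    rw [tendsto_zero_iff_enorm_tendsto_zero]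
    refine tendsto_of_tendsto_of_tendsto_of_le_of_le tendsto_const_nhds
      (by simpa using ENNReal.Tendsto.mul_const hlim (Or.inr hM)) (fun _ => zero_le) fun n => ?_
    refine (enorm_integral_le_lintegral_enorm _).trans ?_
    rw [← eLpNorm_one_eq_lintegral_enorm]
    refine (eLpNorm_inner_le ((hH n).1.sub hH₀.1) (hG n).1).trans ?_
    gcongr
    exacts [le_rfl, hGM n]
  refine (by simpa using h0.add hL : Tendsto _ _ (𝓝 L)).congr fun n => ?_
  rw [← integral_add (integrable_inner_of_memLp (a := fun x => H n x - H₀ x)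
    ((hH n).sub hH₀) (hG n)) (integrable_inner_of_memLp hH₀ (hG n))]
  exact integral_congr_ae (Eventually.of_forall fun x => by simp [inner_sub_left])

end Products

/-- The hypothesis says that the complements of S_n have measure tending to 0, and the L^2 norm of a
fixed function over sets of small measure is small. -/
theorem tendsto_eLpNorm_indicator_sub {X F : Type*} [MeasurableSpace X] {μ : Measure X}
    [NormedAddCommGroup F] {S : ℕ → Set X} (hS : ∀ n, MeasurableSet (S n))
    (hS1 : Tendsto (fun n => eLpNorm (fun x => (S n).indicator (fun _ => (1 : ℝ)) x - 1) 2 μ)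
      atTop (𝓝 0)) {h : X → F} (hh : MemLp h 2 μ) :
    Tendsto (fun n => eLpNorm (fun x => (S n).indicator h x - h x) 2 μ) atTop (𝓝 0) := by
  have hμ : Tendsto (fun n => μ (S n)ᶜ) atTop (𝓝 0) := by
    have := ((ENNReal.continuous_rpow_const (y := 2)).tendsto 0).comp hS1
    rw [ENNReal.zero_rpow_of_pos (by norm_num)] at this
    refine this.congr fun n => ?_
    have e : eLpNorm (fun x => (S n).indicator (fun _ => (1 : ℝ)) x - 1) 2 μ
        = eLpNorm ((S n)ᶜ.indicator fun _ => (1 : ℝ)) 2 μ := by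
      refine eLpNorm_congr_norm_ae (Eventually.of_forall fun x => ?_)
      by_cases hx : x ∈ S n <;> simp [hx]
    rw [Function.comp_apply, e, eLpNorm_indicator_const (hS n).compl two_ne_zero
      ENNReal.ofNat_ne_top, enorm_one, one_mul, ← ENNReal.rpow_mul]
    simp
  refine ENNReal.tendsto_nhds_zero.2 fun ε hε => ?_
  obtain ⟨r, hr, hrε⟩ : ∃ r : ℝ, 0 < r ∧ ENNReal.ofReal r ≤ ε := by
    obtain ⟨r, hr0, hr⟩ := ENNReal.lt_iff_exists_real_btwn.1 hε
    exact ⟨r, by simpa using hr.1, hr.2.le⟩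
  obtain ⟨δ, hδ, H⟩ := hh.eLpNorm_indicator_le one_le_two ENNReal.ofNat_ne_top hr
  filter_upwards [ENNReal.tendsto_nhds_zero.1 hμ _ (ENNReal.ofReal_pos.2 hδ)] with n hn
  refine le_trans (le_of_eq ?_) ((H _ (hS n).compl hn).trans hrε)
  refine eLpNorm_congr_norm_ae (Eventually.of_forall fun x => ?_)
  by_cases hx : x ∈ S n <;> simp [hx]

/-! ### Weak limits under bounded operators, and limits of integrals over exhausting domains -/

theorem WeakTendsto.map {ι X Y : Type*} [SeminormedAddCommGroup X] [NormedSpace ℝ X]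
    [SeminormedAddCommGroup Y] [NormedSpace ℝ Y] {v : ι → X} {l : Filter ι} {w : X}
    (h : WeakTendsto v l w) (A : X →L[ℝ] Y) : WeakTendsto (fun i => A (v i)) l (A w) :=
  fun L => h (L.comp A)

open Classical in
/-- A weakly convergent sequence indexed by numbers tending to `0`, extended by its limit, is a
weakly convergent family. -/
theorem WeakTendsto.extend {X : Type*} [SeminormedAddCommGroup X] [NormedSpace ℝ X]
    {a : ℝ → X} {w : X} {s : ℕ → ℝ} (hs : ∀ n, 0 < s n)
    (h : WeakTendsto (fun n => a (s n)) atTop w) :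
    WeakTendsto (fun t => if t ∈ range s then a t else w) (𝓝[>] 0) w := by
  refine fun L => tendsto_def.2 fun V hV => ?_
  obtain ⟨n₀, hn₀⟩ := eventually_atTop.1 (h L hV)
  -- Only the finitely many parameters s_n with n < n₀ can be bad; being positive, they stay away
  -- from 0.
  have hfin : (s '' {n | n < n₀}).Finite := (finite_lt_nat n₀).image s
  have h0 : (0 : ℝ) ∈ (s '' {n | n < n₀})ᶜ := by
    rintro ⟨n, -, hn⟩
    exact (hs n).ne' hn
  have h1 : ∀ᶠ t in 𝓝[>] (0 : ℝ), t ∈ (s '' {n | n < n₀})ᶜ :=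
    mem_nhdsWithin_of_mem_nhds (hfin.isClosed.isOpen_compl.mem_nhds h0)
  filter_upwards [h1] with t ht
  by_cases htr : t ∈ range s
  · obtain ⟨n, rfl⟩ := htr
    rw [mem_preimage, if_pos (mem_range_self n)]
    exact hn₀ n (not_lt.1 fun hn => ht ⟨n, hn, rfl⟩)
  · rw [mem_preimage, if_neg htr]
    exact mem_of_mem_nhds hV

/-- The weak gradient of a constant vanishes. -/
theorem Sobolev.grad_eq_zero_of_fn_eq_one {U : Set (E N)} (hU : IsOpen U)
    (hb : Bornology.IsBounded U) (v : Sobolev U 2) (hv : v.fn =ᵐ[volume.restrict U] fun _ => 1) :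
    v.grad =ᵐ[volume.restrict U] 0 := by
  refine v.hasWeakGradient.unique hU (f' := fun _ => 1) (fun φ h1 h2 h3 => ?_) hv
    (memLp_one_iff_integrable.1 (v.isSobolevPair hb subset_rfl).memLp_grad) (integrable_zero _ _ _)
  simp only [one_smul, Pi.zero_apply, smul_zero, integral_zero, neg_zero]
  rw [setIntegral_eq_integral_of_forall_compl_eq_zero fun x hx =>
    gradient_eq_zero_of_notMem_tsupport fun h => hx (h3 h)]
  exact integral_gradient_eq_zero h1 h2

/-- Passage to the limit in the product of a strongly convergent function and a weakly convergent
gradient, on domains exhausting `U`. -/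
theorem WeakTendsto.tendsto_setIntegral_mul {U : Set (E N)} (hU : IsOpen U)
    (hb : Bornology.IsBounded U) (hL : HasLipschitzBoundary U) {S : ℕ → Set (E N)}
    (hS : ∀ n, MeasurableSet (S n)) (hSU : ∀ n, S n ⊆ U)
    (hS1 : Tendsto (fun n => eLpNorm (fun x => (S n).indicator (fun _ => (1 : ℝ)) x - 1) 2
      (volume.restrict U)) atTop (𝓝 0))
    {v w : ℕ → Sobolev U 2} {v₀ w₀ : Sobolev U 2} (hv : WeakTendsto v atTop v₀)
    (hw : WeakTendsto w atTop w₀) {ζ : E N → ℝ} (hζ : ContDiff ℝ ∞ ζ) :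
    Tendsto (fun n => ∫ x in S n, (v n).fn x * inner ℝ (gradient ζ x) ((w n).grad x)) atTop
      (𝓝 (∫ x in U, v₀.fn x * inner ℝ (gradient ζ x) (w₀.grad x))) := by
  have hm : ∀ u : Sobolev U 2, MemLp (fun x => u.fn x • gradient ζ x) 2 (volume.restrict U) :=
    fun u => (memLp_top_of_continuous hU.measurableSet hb (continuous_gradient hζ)).smul u.memLp_fn
  have hmS : ∀ (n) (u : Sobolev U 2),
      MemLp ((S n).indicator fun x => u.fn x • gradient ζ x) 2 (volume.restrict U) := fun n u =>
    (hm u).indicator (hS n)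
  obtain ⟨A, hA⟩ := exists_bound_of_continuous hb (continuous_gradient hζ)
  obtain ⟨M, hM⟩ := hw.exists_norm_le
  -- Strong convergence of 1_{S_n} v_n ∇ζ to v₀ ∇ζ: Rellich handles v_n - v₀, and convergence of the
  -- indicators handles v₀ ∇ζ.
  have hlim : Tendsto (fun n => eLpNorm (fun x =>
      (S n).indicator (fun x => (v n).fn x • gradient ζ x) x - v₀.fn x • gradient ζ x) 2
      (volume.restrict U)) atTop (𝓝 0) := by
    have h1 : Tendsto (fun n => ENNReal.ofReal A * eLpNorm (fun x => (v n).fn x - v₀.fn x) 2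
        (volume.restrict U)) atTop (𝓝 0) := by
      simpa using ENNReal.Tendsto.const_mul (hv.tendsto_eLpNorm_fn hU hb hL)
        (Or.inr (ENNReal.ofReal_ne_top (r := A)))
    have h2 := tendsto_eLpNorm_indicator_sub hS hS1 (hm v₀)
    refine tendsto_of_tendsto_of_tendsto_of_le_of_le tendsto_const_nhds
      (by simpa using h1.add h2) (fun _ => zero_le) fun n => ?_
    have hd : MemLp (fun x => ((v n).fn x - v₀.fn x) • gradient ζ x) 2 (volume.restrict U) :=
      (memLp_top_of_continuous hU.measurableSet hb (continuous_gradient hζ)).smul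
        ((v n).memLp_fn.sub v₀.memLp_fn)
    refine le_trans (le_of_eq ?_) ((eLpNorm_add_le
      (f := (S n).indicator fun x => ((v n).fn x - v₀.fn x) • gradient ζ x)
      (g := fun x => (S n).indicator (fun x => v₀.fn x • gradient ζ x) x - v₀.fn x • gradient ζ x)
      (hd.indicator (hS n)).1 ((hmS n v₀).sub (hm v₀)).1 one_le_two).trans
      (add_le_add (eLpNorm_le_mul_eLpNorm_of_ae_le_mul ?_ 2) le_rfl))
    · congr 1
      funext x
      by_cases hx : x ∈ S n <;> simp [hx, sub_smul]
    · filter_upwards [ae_restrict_mem hU.measurableSet] with x hx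
      by_cases hxS : x ∈ S n
      · rw [indicator_of_mem hxS, norm_smul, mul_comm]
        gcongr
        exact hA x hx
      · rw [indicator_of_notMem hxS, norm_zero]
        exact mul_nonneg ((norm_nonneg _).trans (hA x hx)) (norm_nonneg _)
  have main := tendsto_integral_inner (fun n => hmS n (v n)) (hm v₀) (fun n => (w n).memLp_grad)
    hlim (ENNReal.ofReal_ne_top (r := M)) (fun n => ((w n).eLpNorm_grad_le).trans (by
      rw [← ofReal_norm]; exact ENNReal.ofReal_le_ofReal (hM n))) (hw.integral_grad (hm v₀))
  simp only [real_inner_smul_left] at main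
  refine main.congr fun n => ?_
  rw [← inter_eq_self_of_subset_left (hSU n), ← Measure.restrict_restrict (hS n),
    ← integral_indicator (hS n), inter_eq_self_of_subset_left (hSU n)]
  refine integral_congr_ae (Eventually.of_forall fun x => ?_)
  by_cases hx : x ∈ S n <;> simp [hx, real_inner_smul_left]

/-- Multiplication by a smooth function maps `H^1(U)` continuously to `W^{1,1}(U)`. -/
theorem exists_smoothMul_clm {U : Set (E N)} (hU : MeasurableSet U) (hb : Bornology.IsBounded U)
    {ζ : E N → ℝ} (hζ : ContDiff ℝ ∞ ζ) :
    ∃ A : Sobolev U 2 →L[ℝ] Sobolev U 1, ∀ v,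
      (A v).fn =ᵐ[volume.restrict U] (fun x => ζ x * v.fn x) ∧
      (A v).grad =ᵐ[volume.restrict U] fun x => ζ x • v.grad x + v.fn x • gradient ζ x := by
  have : Fact (Bornology.IsBounded U) := ⟨hb⟩
  have hp := fun v : Sobolev U 2 => (v.isSobolevPair hb subset_rfl).smooth_mul hU hb hζ
  let a : Sobolev U 2 → Sobolev U 1 := fun v =>
    Sobolev.ofPair (hp v).memLp_fn (hp v).memLp_grad (hp v).hasWeakGradient
  have ha1 : ∀ v, (a v).fn =ᵐ[volume.restrict U] (fun x => ζ x * v.fn x) := fun v =>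
    Sobolev.fn_ofPair _ _ _
  have ha2 : ∀ v, (a v).grad =ᵐ[volume.restrict U]
      fun x => ζ x • v.grad x + v.fn x • gradient ζ x := fun v => Sobolev.grad_ofPair _ _ _
  let l : Sobolev U 2 →ₗ[ℝ] Sobolev U 1 :=
    { toFun := a
      map_add' := fun v w => Sobolev.ext
        (by
          filter_upwards [ha1 v, ha1 w, ha1 (v + w), Sobolev.fn_add v w,
            Sobolev.fn_add (a v) (a w)] with x h1 h2 h3 h4 h5
          rw [h3, h4, h5, h1, h2]; ring)
        (by
          filter_upwards [ha2 v, ha2 w, ha2 (v + w), Sobolev.fn_add v w, Sobolev.grad_add v w,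
            Sobolev.grad_add (a v) (a w)] with x h1 h2 h3 h4 h5 h6
          rw [h3, h4, h5, h6, h1, h2]; module)
      map_smul' := fun c v => Sobolev.ext
        (by
          filter_upwards [ha1 v, ha1 (c • v), Sobolev.fn_smul c v,
            Sobolev.fn_smul c (a v)] with x h1 h2 h3 h4
          rw [RingHom.id_apply, h2, h3, h4, h1]; ring)
        (by
          filter_upwards [ha2 v, ha2 (c • v), Sobolev.fn_smul c v, Sobolev.grad_smul c v,
            Sobolev.grad_smul c (a v)] with x h1 h2 h3 h4 h5
          rw [RingHom.id_apply, h2, h3, h4, h5, h1]; module) }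
  have hζ2 : MemLp ζ 2 (volume.restrict U) :=
    (memLp_top_of_continuous hU hb hζ.continuous).mono_exponent le_top
  have hζ2' : MemLp (gradient ζ) 2 (volume.restrict U) :=
    (memLp_top_of_continuous hU hb (continuous_gradient hζ)).mono_exponent le_top
  set Z := eLpNorm ζ 2 (volume.restrict U)
  set Z' := eLpNorm (gradient ζ) 2 (volume.restrict U)
  have hZ : Z + (Z + Z') ≠ ⊤ := by simp [Z, Z', hζ2.2.ne, hζ2'.2.ne]
  -- Hölder with exponents 2 and 2 for each of ζv, ζ∇v and v∇ζ.
  have hbound : ∀ v, ‖a v‖ₑ ≤ (Z + (Z + Z')) * ‖v‖ₑ := fun v => by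
    refine (Sobolev.enorm_le_of_one _).trans ?_
    rw [eLpNorm_congr_ae (ha1 v), eLpNorm_congr_ae (ha2 v), add_mul, add_mul]
    refine add_le_add ?_ ((eLpNorm_add_le (hζ2.1.smul v.memLp_grad.1)
      (v.memLp_fn.1.smul hζ2'.1) le_rfl).trans (add_le_add ?_ ?_))
    · refine (eLpNorm_smul_le_mul_eLpNorm (p := 2) (q := 2) v.memLp_fn.1 hζ2.1).trans ?_
      gcongr
      exact v.eLpNorm_fn_le
    · refine (eLpNorm_smul_le_mul_eLpNorm (p := 2) (q := 2) v.memLp_grad.1 hζ2.1).trans ?_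
      gcongr
      exact v.eLpNorm_grad_le
    · refine (eLpNorm_smul_le_mul_eLpNorm (p := 2) (q := 2) hζ2'.1 v.memLp_fn.1).trans ?_
      rw [mul_comm]
      gcongr
      exact v.eLpNorm_fn_le
  refine ⟨l.mkContinuous (Z + (Z + Z')).toReal fun v => ?_, fun v => ⟨ha1 v, ha2 v⟩⟩
  have := ENNReal.toReal_mono (ENNReal.mul_ne_top hZ enorm_ne_top) (hbound v)
  rwa [ENNReal.toReal_mul, toReal_enorm, toReal_enorm] at this

/-- The integral of the trace over the boundary is a continuous functional on `W^{1,1}(U)`. -/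
theorem exists_integral_trace_clm {U : Set (E N)} (hU : IsOpen U) (hb : Bornology.IsBounded U)
    (hL : HasLipschitzBoundary U) :
    ∃ L : Sobolev U 1 →L[ℝ] ℝ, ∀ v, L v = ∫ x, trace U v x ∂(surf (frontier U)) := by
  obtain ⟨C, hC, H⟩ := hL.exists_trace_bound hU hb
  have ht := fun v : Sobolev U 1 => v.isTrace_trace hU hb hL subset_rfl
  have hi := fun v : Sobolev U 1 => memLp_one_iff_integrable.1 (ht v).1
  let l : Sobolev U 1 →ₗ[ℝ] ℝ :=
    { toFun := fun v => ∫ x, trace U v x ∂(surf (frontier U))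
      map_add' := fun v w => by
        rw [← integral_add (hi v) (hi w)]
        exact integral_congr_ae ((v + w).trace_ae_eq hU hb hL subset_rfl
          ((ht v).add (ht w) v.memLp_fn w.memLp_fn v.memLp_grad w.memLp_grad)
          (Sobolev.fn_add v w) (Sobolev.grad_add v w))
      map_smul' := fun c v => by
        rw [RingHom.id_apply, smul_eq_mul, ← integral_const_mul]
        exact integral_congr_ae ((c • v).trace_ae_eq hU hb hL subset_rfl
          ((ht v).const_mul hU.measurableSet hb v.memLp_fn v.memLp_grad c)
          (Sobolev.fn_smul c v) (Sobolev.grad_smul c v)) }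
  refine ⟨l.mkContinuous (C * 2).toReal fun v => ?_, fun v => rfl⟩
  have : ‖l v‖ₑ ≤ C * 2 * ‖v‖ₑ := by
    refine (enorm_integral_le_lintegral_enorm _).trans ?_
    rw [← eLpNorm_one_eq_lintegral_enorm, mul_assoc, two_mul]
    refine ((ht v).eLpNorm_le hC H v.memLp_fn v.memLp_grad).trans ?_
    gcongr
    exacts [v.eLpNorm_fn_le, v.eLpNorm_grad_le]
  have := ENNReal.toReal_mono
    (ENNReal.mul_ne_top (ENNReal.mul_ne_top hC ENNReal.ofNat_ne_top) enorm_ne_top) this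
  simpa using this

/-- Passage to the limit in integrals over domains exhausting `U`. -/
theorem WeakTendsto.tendsto_setIntegral_fn {U : Set (E N)} {S : ℕ → Set (E N)}
    (hS : ∀ n, MeasurableSet (S n)) (hSU : ∀ n, S n ⊆ U)
    (hS1 : Tendsto (fun n => eLpNorm (fun x => (S n).indicator (fun _ => (1 : ℝ)) x - 1) 2
      (volume.restrict U)) atTop (𝓝 0))
    {v : ℕ → Sobolev U 2} {v₀ : Sobolev U 2} (hv : WeakTendsto v atTop v₀) {h : E N → ℝ}
    (hh : MemLp h 2 (volume.restrict U)) :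
    Tendsto (fun n => ∫ x in S n, h x * (v n).fn x) atTop (𝓝 (∫ x in U, h x * v₀.fn x)) := by
  obtain ⟨M, hM⟩ := hv.exists_norm_le
  have hlim : Tendsto (fun n => ∫ x in U, inner ℝ (h x) ((v n).fn x)) atTop
      (𝓝 (∫ x in U, h x * v₀.fn x)) :=
    (hv.integral_fn hh).congr fun n => by simp only [Real.inner_apply]
  have main := tendsto_integral_inner (F := ℝ) (H := fun n => (S n).indicator h)
    (G := fun n => (v n).fn) (fun n => hh.indicator (hS n)) hh
    (fun n => (v n).memLp_fn) (tendsto_eLpNorm_indicator_sub hS hS1 hh)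
    (ENNReal.ofReal_ne_top (r := M)) (fun n => (Sobolev.eLpNorm_fn_le _).trans (by
      rw [← ofReal_norm]; exact ENNReal.ofReal_le_ofReal (hM n))) hlim
  refine main.congr fun n => ?_
  rw [← inter_eq_self_of_subset_left (hSU n), ← Measure.restrict_restrict (hS n),
    ← integral_indicator (hS n), inter_eq_self_of_subset_left (hSU n)]
  refine integral_congr_ae (Eventually.of_forall fun x => ?_)
  by_cases hx : x ∈ S n <;> simp [hx, mul_comm]

/-! ### Boundaries of perforated domains and the tested Robin equation -/

/-- The closure of Ω is the union of the closures of Ω' and of Ω \ Ω', and the latter does not reach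
∂Ω. -/
theorem frontier_subset_of_disjoint {Ω Ω' : Set (E N)} (hΩ : IsOpen Ω) (hΩ' : IsOpen Ω')
    (hsub : Ω' ⊆ Ω) (hd : Disjoint (closure (Ω \ Ω')) (frontier Ω)) :
    frontier Ω ⊆ frontier Ω' := by
  intro x hx
  rw [hΩ.frontier_eq] at hx
  rw [hΩ'.frontier_eq]
  refine ⟨?_, fun h => hx.2 (hsub h)⟩
  have h1 := hx.1
  rw [← union_sdiff_cancel hsub, closure_union] at h1
  exact h1.resolve_right fun h => disjoint_left.1 hd h (by rwa [hΩ.frontier_eq])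

/-- A boundary point of Ω \ Ω' lies in Ω. Were it outside the closure of Ω', it would be interior to
Ω \ Ω'; and it is not in Ω', which is open and disjoint from Ω \ Ω'. -/
theorem frontier_diff_subset_of_disjoint {Ω Ω' : Set (E N)} (hΩ : IsOpen Ω) (hΩ' : IsOpen Ω')
    (hd : Disjoint (closure (Ω \ Ω')) (frontier Ω)) :
    frontier (Ω \ Ω') ⊆ frontier Ω' := by
  intro x hx
  have hxΩ : x ∈ Ω := by
    by_contra h
    exact disjoint_left.1 hd hx.1 (by
      rw [hΩ.frontier_eq]
      exact ⟨closure_mono sdiff_subset hx.1, h⟩)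
  rw [hΩ'.frontier_eq]
  refine ⟨?_, fun h => ?_⟩
  · by_contra h
    exact hx.2 (mem_interior.2 ⟨Ω \ closure Ω', sdiff_subset_sdiff_right subset_closure,
      hΩ.sdiff isClosed_closure, hxΩ, h⟩)
  · exact disjoint_left.1 (disjoint_sdiff_left.closure_left hΩ') hx.1 h

/-- The weak formulation of the Robin problem, tested with `ζ q`, in terms of extensions `P` and
`Q` of `u` and `q`. -/
theorem robin_identity {Ω Ω' : Set (E N)} (hΩ : IsOpen Ω) (hb : Bornology.IsBounded Ω)
    (hL : HasLipschitzBoundary Ω) (hΩ' : IsOpen Ω') (hsub : Ω' ⊆ Ω)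
    (hL' : HasLipschitzBoundary Ω') (hd : Disjoint (closure (Ω \ Ω')) (frontier Ω))
    {α' α : ℝ} {g f : E N → ℝ} (hg : MemLp g 2 (surf (frontier Ω'))) {u q : Sobolev Ω' 2}
    (hq : MemLp q.fn ⊤ (volume.restrict Ω'))
    (hq1 : trace Ω' q =ᵐ[surf (frontier Ω)] fun _ => 1)
    (hu : ∀ v : Sobolev Ω' 2, robinForm Ω Ω' α' α g u v = ∫ x in Ω', f x * v.fn x)
    {P Q : Sobolev Ω 2} (hP : P.fn =ᵐ[volume.restrict Ω'] u.fn)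
    (hQ : Q.fn =ᵐ[volume.restrict Ω'] q.fn)
    {ζ : E N → ℝ} (hζ : ContDiff ℝ ∞ ζ) {W : Sobolev Ω 1}
    (hW : W.fn =ᵐ[volume.restrict Ω] fun x => ζ x * P.fn x)
    (hW' : W.grad =ᵐ[volume.restrict Ω] fun x => ζ x • P.grad x + P.fn x • gradient ζ x) :
    etaForm Ω Ω' α' q W - (∫ x in Ω', P.fn x * inner ℝ (gradient ζ x) (Q.grad x))
        + (∫ x in Ω', Q.fn x * inner ℝ (gradient ζ x) (P.grad x)) - gammaForm Ω Ω' α' q g ζ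
        + α * ((∫ x, trace Ω W x ∂(surf (frontier Ω))) - ∫ x, g x * ζ x ∂(surf (frontier Ω)))
      = ∫ x in Ω', ζ x * f x * Q.fn x := by
  have hb' : Bornology.IsBounded Ω' := hb.subset hsub
  have hm : volume.restrict Ω' ≤ volume.restrict Ω := Measure.restrict_mono hsub le_rfl
  have hmo : surf (frontier Ω) ≤ surf (frontier Ω') :=
    Measure.restrict_mono (frontier_subset_of_disjoint hΩ hΩ' hsub hd) le_rfl
  have hmi : surf (frontier (Ω \ Ω')) ≤ surf (frontier Ω') :=
    Measure.restrict_mono (frontier_diff_subset_of_disjoint hΩ hΩ' hd) le_rfl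
  have hζm := hΩ'.measurableSet
  -- The extension property concerns functions only; uniqueness of weak gradients on Ω' transfers it
  -- to the gradients.
  have hgP := P.hasWeakGradient.mono hsub |>.unique hΩ' u.hasWeakGradient hP
    (memLp_one_iff_integrable.1 (P.isSobolevPair hb' hsub).memLp_grad)
    (memLp_one_iff_integrable.1 (u.isSobolevPair hb' subset_rfl).memLp_grad)
  have hgQ := Q.hasWeakGradient.mono hsub |>.unique hΩ' q.hasWeakGradient hQ
    (memLp_one_iff_integrable.1 (Q.isSobolevPair hb' hsub).memLp_grad)
    (memLp_one_iff_integrable.1 (q.isSobolevPair hb' subset_rfl).memLp_grad)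
  have hWΩ' := ae_mono hm hW
  have hWgΩ' := ae_mono hm hW'
  -- the test function
  set v : Sobolev Ω' 2 := Sobolev.smoothMul hζm hb' hζ q with hv
  have hvf : v.fn =ᵐ[volume.restrict Ω'] fun x => ζ x * q.fn x := Sobolev.fn_ofPair _ _ _
  have hvg : v.grad =ᵐ[volume.restrict Ω'] fun x => ζ x • q.grad x + q.fn x • gradient ζ x :=
    Sobolev.grad_ofPair _ _ _
  -- traces
  have hpu := u.isSobolevPair hb' subset_rfl
  have hpq := q.isSobolevPair hb' subset_rfl
  have htv : trace Ω' v =ᵐ[surf (frontier Ω')] fun x => ζ x * trace Ω' q x :=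
    v.trace_ae_eq hΩ' hb' hL' subset_rfl ((q.isTrace_trace hΩ' hb' hL' subset_rfl).smooth_mul hζm
      hb' hpq.memLp_fn hpq.memLp_grad hζ) hvf hvg
  -- W equals ζu on Ω', so its trace from Ω' does not depend on how u was extended into the
  -- inclusions.
  have htW : trace Ω' W =ᵐ[surf (frontier Ω')] fun x => ζ x * trace Ω' u x :=
    W.trace_ae_eq hΩ' hb' hL' hsub ((u.isTrace_trace hΩ' hb' hL' subset_rfl).smooth_mul hζm
      hb' hpu.memLp_fn hpu.memLp_grad hζ)
      (by filter_upwards [hWΩ', hP] with x h1 h2; rw [h1, h2])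
      (by filter_upwards [hWgΩ', hP, hgP] with x h1 h2 h3; rw [h1, h2, h3])
  have htWo : trace Ω' W =ᵐ[surf (frontier Ω)] trace Ω W :=
    (W.isTrace_trace hΩ' hb' hL' hsub).ae_eq_of_subset hΩ' hb' hL' hsub
      (frontier_subset_of_disjoint hΩ hΩ' hsub hd) (W.isTrace_trace hΩ hb hL subset_rfl)
      (W.isSobolevPair hb' hsub).memLp_fn (W.isSobolevPair hb' hsub).memLp_grad
  -- integrability on the boundary
  have := isFiniteMeasure_surf hΩ' hb' hL'
  -- The trace of W is only available in L^1, so boundedness of the trace of q is what makes their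
  -- product integrable.
  have htq : MemLp (trace Ω' q) ⊤ (surf (frontier Ω')) := q.memLp_top_trace hΩ' hb' hL' hq
  have hζt : MemLp ζ ⊤ (surf (frontier Ω')) := by
    obtain ⟨C, hC⟩ := exists_bound_of_continuous hb'.closure hζ.continuous
    refine memLp_top_of_bound hζ.continuous.aestronglyMeasurable C ?_
    filter_upwards [ae_mem_frontier_surf Ω'] with x hx using hC x hx.1
  have hgζ : MemLp (fun x => g x * ζ x) 1 (surf (frontier Ω')) :=
    hζt.mul (hg.mono_exponent one_le_two)
  have hWt : MemLp (trace Ω' W) 1 (surf (frontier Ω')) :=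
    (W.isTrace_trace hΩ' hb' hL' hsub).1
  have i1 : Integrable (fun x => trace Ω' W x * trace Ω' q x) (surf (frontier Ω')) :=
    memLp_one_iff_integrable.1 (htq.mul hWt)
  have i2 : Integrable (fun x => g x * ζ x * trace Ω' q x) (surf (frontier Ω')) :=
    memLp_one_iff_integrable.1 (htq.mul hgζ)
  have e1 : ∫ x, (trace Ω' u x - g x) * trace Ω' v x ∂(surf (frontier (Ω \ Ω')))
      = (∫ x, trace Ω' W x * trace Ω' q x ∂(surf (frontier (Ω \ Ω'))))
        - ∫ x, ζ x * g x * trace Ω' q x ∂(surf (frontier (Ω \ Ω'))) := by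
    simp only [mul_comm (ζ _) (g _)]
    rw [← integral_sub (i1.mono_measure hmi) (i2.mono_measure hmi)]
    refine integral_congr_ae ?_
    filter_upwards [ae_mono hmi htv, ae_mono hmi htW] with x h1 h2
    rw [h1, h2]; ring
  -- On ∂Ω the trace of q is 1, and the traces of W from Ω' and from Ω agree.
  have e2 : ∫ x, (trace Ω' u x - g x) * trace Ω' v x ∂(surf (frontier Ω))
      = (∫ x, trace Ω W x ∂(surf (frontier Ω))) - ∫ x, g x * ζ x ∂(surf (frontier Ω)) := by
    rw [← integral_sub (memLp_one_iff_integrable.1 (W.isTrace_trace hΩ hb hL subset_rfl).1)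
      ((memLp_one_iff_integrable.1 hgζ).mono_measure hmo)]
    refine integral_congr_ae ?_
    filter_upwards [ae_mono hmo htv, ae_mono hmo htW, htWo, hq1] with x h1 h2 h3 h4
    rw [h1, ← h3, h2, h4]; ring
  -- the volume integrals
  have hPm := P.memLp_fn.mono_measure hm
  have hQm := Q.memLp_fn.mono_measure hm
  have hPg := P.memLp_grad.mono_measure hm
  have hQg := Q.memLp_grad.mono_measure hm
  have hζg := memLp_top_of_continuous hζm hb' (continuous_gradient hζ)
  have j1 : Integrable (fun x => inner ℝ (W.grad x) (q.grad x)) (volume.restrict Ω') := by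
    refine (integrable_inner_of_memLp
      ((memLp_smooth_mul_grad hζm hb' hPm hPg hζ)) hQg).congr ?_
    filter_upwards [hWgΩ', hgQ] with x h1 h2
    rw [h1, h2]
  have j2 : Integrable (fun x => P.fn x * inner ℝ (gradient ζ x) (Q.grad x))
      (volume.restrict Ω') := by
    refine (integrable_inner_of_memLp (hζg.smul hPm) hQg).congr (Eventually.of_forall fun x => ?_)
    simp [real_inner_smul_left]
  have j3 : Integrable (fun x => Q.fn x * inner ℝ (gradient ζ x) (P.grad x))
      (volume.restrict Ω') := by
    refine (integrable_inner_of_memLp (hζg.smul hQm) hPg).congr (Eventually.of_forall fun x => ?_)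
    simp [real_inner_smul_left]
  have j12 : Integrable (fun x => inner ℝ (W.grad x) (q.grad x)
      - P.fn x * inner ℝ (gradient ζ x) (Q.grad x)) (volume.restrict Ω') := j1.sub j2
  -- The pointwise identity ∇u·∇(ζq) = ∇(ζu)·∇q - u ∇ζ·∇q + q ∇ζ·∇u.
  have e3 : ∫ x in Ω', inner ℝ (u.grad x) (v.grad x)
      = (∫ x in Ω', inner ℝ (W.grad x) (q.grad x))
        - (∫ x in Ω', P.fn x * inner ℝ (gradient ζ x) (Q.grad x))
        + ∫ x in Ω', Q.fn x * inner ℝ (gradient ζ x) (P.grad x) := by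
    rw [← integral_sub j1 j2, ← integral_add j12 j3]
    refine integral_congr_ae ?_
    filter_upwards [hvg, hWgΩ', hP, hQ, hgP, hgQ] with x h1 h2 h3 h4 h5 h6
    simp only [h1, h2, h3, h4, h5, h6, inner_add_left, inner_add_right,
      real_inner_smul_left, real_inner_smul_right, real_inner_comm (gradient ζ x) (u.grad x)]
    ring
  have e4 : ∫ x in Ω', f x * v.fn x = ∫ x in Ω', ζ x * f x * Q.fn x := by
    refine integral_congr_ae ?_
    filter_upwards [hvf, hQ] with x h1 h2
    rw [h1, h2]; ring
  have key := hu v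
  rw [robinForm, e1, e2, e3, e4] at key
  rw [etaForm, gammaForm, ← key]
  ring

end RobinHomogenisation

end

/-! ### Passage to the limit in the tested equation -/

set_option maxHeartbeats 800000 in
theorem mainTheorem1
    {N : ℕ} (hN : 2 ≤ N)
    -- the domain
    (Ω : Set (E N)) (hΩo : IsOpen Ω) (hΩc : IsConnected Ω) (hΩb : Bornology.IsBounded Ω)
    (hΩs : HasSmoothBoundary Ω)
    -- the perforated domains
    (Ωε : ℝ → Set (E N))
    (hΩε_open : ∀ ε > 0, IsOpen (Ωε ε)) (hΩε_sub : ∀ ε > 0, Ωε ε ⊆ Ω)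
    (hΩε_lip : ∀ ε > 0, HasLipschitzBoundary (Ωε ε))
    (hD_bdry : ∀ ε > 0, Disjoint (closure (Ω \ Ωε ε)) (frontier Ω))
    (hD_int : ∀ ε > 0, (interior (Ω \ Ωε ε)).Nonempty)
    (hD_lip : ∀ ε > 0, HasLipschitzBoundary (interior (Ω \ Ωε ε)))
    (hΩε_one : Tendsto
      (fun ε => eLpNorm (fun x => (Ωε ε).indicator (fun _ => (1 : ℝ)) x - 1) 2
        (volume.restrict Ω)) (𝓝[>] 0) (𝓝 0))
    -- Robin coefficients and boundary data
    (α : ℝ) (hα : 0 < α) (αε : ℝ → ℝ) (hαε : ∀ ε > 0, 0 < αε ε)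
    (hαε_lim : ∃ α₀ : ℝ, Tendsto αε (𝓝[>] 0) (𝓝 α₀))
    (g : E N → ℝ) (hg : MemLp g 2 (surf (frontier Ω)))
    (gε : ℝ → E N → ℝ) (hgε : ∀ ε > 0, MemLp (gε ε) 2 (surf (frontier (Ωε ε))))
    (hgε_lim : Tendsto (fun ε => eLpNorm (fun x => gε ε x - g x) 2 (surf (frontier Ω)))
      (𝓝[>] 0) (𝓝 0))
    (hgε_bdd : IsBoundedUnder (· ≤ ·) (𝓝[>] 0)
      (fun ε => αε ε * (eLpNorm (gε ε) 2 (surf (frontier (Ω \ Ωε ε)))).toReal))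
    -- coercivity
    (hcoer : ∃ c > 0, ∀ ε > 0, ∀ v : Sobolev (Ωε ε) 2,
      c * ‖v‖ ^ 2 ≤ robinBilin Ω (Ωε ε) (αε ε) α v v)
    -- extension operators
    (T : ∀ ε, Sobolev (Ωε ε) 2 →L[ℝ] Sobolev Ω 2)
    (hT_ext : ∀ ε > 0, ∀ v, (T ε v).fn =ᵐ[volume.restrict (Ωε ε)] v.fn)
    (hT_bdd : IsBoundedUnder (· ≤ ·) (𝓝[>] 0) (fun ε => ‖T ε‖))
    (hT_zero : ∀ v : ∀ ε, Sobolev (Ωε ε) 2,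
      IsBoundedUnder (· ≤ ·) (𝓝[>] 0)
        (fun ε => robinForm Ω (Ωε ε) (αε ε) α (gε ε) (v ε) (v ε)) →
      (∃ w : E N → ℝ, MemLp w 2 (volume.restrict Ω) ∧
        Tendsto (fun ε => eLpNorm (fun x => (Ωε ε).indicator (v ε).fn x - w x) 2
          (volume.restrict Ω)) (𝓝[>] 0) (𝓝 0)) →
      Tendsto (fun ε => eLpNorm (fun x => (T ε (v ε)).fn x - (Ωε ε).indicator (v ε).fn x) 2
        (volume.restrict Ω)) (𝓝[>] 0) (𝓝 0))
    -- auxiliary functions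
    (q : ∀ ε, Sobolev (Ωε ε) 2)
    (hq_fn : ∀ ε > 0, MemLp (q ε).fn ∞ (volume.restrict (Ωε ε)))
    (hq_grad : ∀ ε > 0, MemLp (q ε).grad ∞ (volume.restrict (Ωε ε)))
    (hq_bdry : ∀ ε > 0, trace (Ωε ε) (q ε) =ᵐ[surf (frontier Ω)] fun _ => 1)
    (hq_lim : ∃ one : Sobolev Ω 2, one.fn =ᵐ[volume.restrict Ω] (fun _ => 1) ∧
      WeakTendsto (fun ε => T ε (q ε)) (𝓝[>] 0) one)
    (hq_bdd : IsBoundedUnder (· ≤ ·) (𝓝[>] 0)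
      (fun ε => robinForm Ω (Ωε ε) (αε ε) α (gε ε) (q ε) (q ε)))
    -- the limit functionals
    (η : Sobolev Ω 1 → ℝ)
    (hη : ∀ (v : Sobolev Ω 1) (vε : ℝ → Sobolev Ω 1), WeakTendsto vε (𝓝[>] 0) v →
      Tendsto (fun ε => etaForm Ω (Ωε ε) (αε ε) (q ε) (vε ε)) (𝓝[>] 0) (𝓝 (η v)))
    (γ : (E N → ℝ) → ℝ)
    (hγ : ∀ ζ : E N → ℝ, ContDiff ℝ ∞ ζ →
      Tendsto (fun ε => gammaForm Ω (Ωε ε) (αε ε) (q ε) (gε ε) ζ) (𝓝[>] 0) (𝓝 (γ ζ)))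
    -- the solutions of the Robin problems
    (f : E N → ℝ) (hf : MemLp f 2 (volume.restrict Ω))
    (u : ∀ ε, Sobolev (Ωε ε) 2)
    (hu : ∀ ε > 0, ∀ v : Sobolev (Ωε ε) 2,
      robinForm Ω (Ωε ε) (αε ε) α (gε ε) (u ε) v = ∫ x in Ωε ε, f x * v.fn x)
    -- a weak limit along a sequence
    (εs : ℕ → ℝ) (hεs_pos : ∀ n, 0 < εs n) (hεs_lim : Tendsto εs atTop (𝓝 0))
    (u₀ : Sobolev Ω 2) (hu₀ : WeakTendsto (fun n => T (εs n) (u (εs n))) atTop u₀) :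
    ∀ ζ : E N → ℝ, ContDiff ℝ ∞ ζ →
      ∃ w : Sobolev Ω 1, w.fn =ᵐ[volume.restrict Ω] (fun x => u₀.fn x * ζ x) ∧
        (∫ x in Ω, (inner ℝ (u₀.grad x) (gradient ζ x) - f x * ζ x))
          + α * (∫ x, (trace Ω u₀ x - g x) * ζ x ∂(surf (frontier Ω)))
          + η w - γ ζ = 0 := by
  intro ζ hζ
  have hL : HasLipschitzBoundary Ω := hΩs.hasLipschitzBoundary
  have hεs : Tendsto εs atTop (𝓝[>] 0) :=
    tendsto_nhdsWithin_iff.2 ⟨hεs_lim, Eventually.of_forall hεs_pos⟩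
  obtain ⟨one, hone, hq_weak⟩ := hq_lim
  have hqw : WeakTendsto (fun n => T (εs n) (q (εs n))) atTop one := fun L => (hq_weak L).comp hεs
  have hone' := one.grad_eq_zero_of_fn_eq_one hΩo hΩb hone
  obtain ⟨A, hA⟩ := exists_smoothMul_clm hΩo.measurableSet hΩb hζ
  obtain ⟨L, hL'⟩ := exists_integral_trace_clm hΩo hΩb hL
  have hAu : WeakTendsto (fun n => A (T (εs n) (u (εs n)))) atTop (A u₀) := hu₀.map A
  have hS : ∀ n, MeasurableSet (Ωε (εs n)) := fun n => (hΩε_open _ (hεs_pos n)).measurableSet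
  have hSΩ : ∀ n, Ωε (εs n) ⊆ Ω := fun n => hΩε_sub _ (hεs_pos n)
  have hS1 : Tendsto (fun n => eLpNorm (fun x => (Ωε (εs n)).indicator (fun _ => (1 : ℝ)) x - 1) 2
      (volume.restrict Ω)) atTop (𝓝 0) := hΩε_one.comp hεs
  -- the limit of each term of the weak formulation
  have l1 : Tendsto (fun n => etaForm Ω (Ωε (εs n)) (αε (εs n)) (q (εs n))
      (A (T (εs n) (u (εs n))))) atTop (𝓝 (η (A u₀))) := by
    -- The property defining η concerns families over all ε, whereas only a sequence converges here;
    -- the missing parameters are filled in with the limit.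
    refine ((hη _ _ (WeakTendsto.extend (a := fun ε => A (T ε (u ε))) hεs_pos hAu)).comp
      hεs).congr fun n => ?_
    rw [Function.comp_apply, if_pos (mem_range_self n)]
  -- In `l2` the strong factor is T^ε u^ε and the weak one ∇T^ε q^ε, whose limit is 0; in `l3` the
  -- roles are exchanged and the strong limit is 1.
  have l2 := hu₀.tendsto_setIntegral_mul hΩo hΩb hL hS hSΩ hS1 hqw hζ
  have l2' : ∫ x in Ω, u₀.fn x * inner ℝ (gradient ζ x) (one.grad x) = 0 := by
    rw [← integral_zero (E N) ℝ (μ := volume.restrict Ω)]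
    refine integral_congr_ae ?_
    filter_upwards [hone'] with x hx
    simp [hx]
  have l3 := hqw.tendsto_setIntegral_mul hΩo hΩb hL hS hSΩ hS1 hu₀ hζ
  have l3' : ∫ x in Ω, one.fn x * inner ℝ (gradient ζ x) (u₀.grad x)
      = ∫ x in Ω, inner ℝ (u₀.grad x) (gradient ζ x) := by
    refine integral_congr_ae ?_
    filter_upwards [hone] with x hx
    rw [hx, one_mul, real_inner_comm]
  have l4 := (hγ ζ hζ).comp hεs
  have l5 : Tendsto (fun n => ∫ x, trace Ω (A (T (εs n) (u (εs n)))) x ∂(surf (frontier Ω))) atTop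
      (𝓝 (∫ x, trace Ω (A u₀) x ∂(surf (frontier Ω)))) := by
    simpa only [hL'] using hAu L
  have l5' : ∫ x, trace Ω (A u₀) x ∂(surf (frontier Ω))
      = ∫ x, ζ x * trace Ω u₀ x ∂(surf (frontier Ω)) := by
    have hp := u₀.isSobolevPair hΩb subset_rfl
    exact integral_congr_ae ((A u₀).trace_ae_eq hΩo hΩb hL subset_rfl
      ((u₀.isTrace_trace hΩo hΩb hL subset_rfl).smooth_mul hΩo.measurableSet hΩb hp.memLp_fn
        hp.memLp_grad hζ) (hA u₀).1 (hA u₀).2)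
  have := isFiniteMeasure_surf hΩo hΩb hL
  have hζt : MemLp ζ ⊤ (surf (frontier Ω)) := by
    obtain ⟨C, hC⟩ := exists_bound_of_continuous hΩb.closure hζ.continuous
    refine memLp_top_of_bound hζ.continuous.aestronglyMeasurable C ?_
    filter_upwards [ae_mem_frontier_surf Ω] with x hx using hC x hx.1
  have hgs : ∀ n, MemLp (gε (εs n)) 2 (surf (frontier Ω)) := fun n =>
    (hgε _ (hεs_pos n)).mono_measure (Measure.restrict_mono (frontier_subset_of_disjoint hΩo
      (hΩε_open _ (hεs_pos n)) (hSΩ n) (hD_bdry _ (hεs_pos n))) le_rfl)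
  have l6 : Tendsto (fun n => ∫ x, gε (εs n) x * ζ x ∂(surf (frontier Ω))) atTop
      (𝓝 (∫ x, g x * ζ x ∂(surf (frontier Ω)))) := by
    have hζ2 : MemLp ζ 2 (surf (frontier Ω)) := hζt.mono_exponent le_top
    have := tendsto_integral_inner hgs hg (fun _ => hζ2) (hgε_lim.comp hεs) hζ2.2.ne
      (fun _ => le_rfl) tendsto_const_nhds
    simpa [mul_comm] using this
  have l7 : Tendsto (fun n => ∫ x in Ωε (εs n), ζ x * f x * (T (εs n) (q (εs n))).fn x) atTop
      (𝓝 (∫ x in Ω, f x * ζ x)) := by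
    have e : ∫ x in Ω, ζ x * f x * one.fn x = ∫ x in Ω, f x * ζ x := by
      refine integral_congr_ae ?_
      filter_upwards [hone] with x hx
      rw [hx, mul_one, mul_comm]
    rw [← e]
    exact hqw.tendsto_setIntegral_fn hS hSΩ hS1
      (memLp_smooth_mul hΩo.measurableSet hΩb hf hζ)
  have lim := (((l1.sub l2).add l3).sub l4).add ((l5.sub l6).const_mul α)
  have hid := fun n => robin_identity hΩo hΩb hL
    (hΩε_open _ (hεs_pos n)) (hSΩ n) (hΩε_lip _ (hεs_pos n)) (hD_bdry _ (hεs_pos n))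
    (hgε _ (hεs_pos n)) (hq_fn _ (hεs_pos n)) (hq_bdry _ (hεs_pos n)) (hu _ (hεs_pos n))
    (hT_ext _ (hεs_pos n) _) (hT_ext _ (hεs_pos n) _) hζ (hA _).1 (hA _).2
  -- The two sides of the tested equation have been given their limits separately; equating them
  -- yields the limit problem.
  have key := tendsto_nhds_unique (lim.congr hid) l7
  rw [l2', l3', l5'] at key
  refine ⟨A u₀, (hA u₀).1.trans (Eventually.of_forall fun x => mul_comm _ _), ?_⟩
  have hζi : MemLp (gradient ζ) 2 (volume.restrict Ω) := by
    have : Fact (Bornology.IsBounded Ω) := ⟨hΩb⟩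
    exact (memLp_top_of_continuous hΩo.measurableSet hΩb
      (continuous_gradient hζ)).mono_exponent le_top
  have hfi : Integrable (fun x => f x * ζ x) (volume.restrict Ω) := by
    have : Fact (Bornology.IsBounded Ω) := ⟨hΩb⟩
    exact memLp_one_iff_integrable.1 ((memLp_top_of_continuous hΩo.measurableSet hΩb
      hζ.continuous).mul (hf.mono_exponent one_le_two))
  have e1 : ∫ x in Ω, (inner ℝ (u₀.grad x) (gradient ζ x) - f x * ζ x)
      = (∫ x in Ω, inner ℝ (u₀.grad x) (gradient ζ x)) - ∫ x in Ω, f x * ζ x :=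
    integral_sub (integrable_inner_of_memLp u₀.memLp_grad hζi) hfi
  have e2 : ∫ x, (trace Ω u₀ x - g x) * ζ x ∂(surf (frontier Ω))
      = (∫ x, ζ x * trace Ω u₀ x ∂(surf (frontier Ω))) - ∫ x, g x * ζ x ∂(surf (frontier Ω)) := by
    have i1 : Integrable (fun x => ζ x * trace Ω u₀ x) (surf (frontier Ω)) :=
      memLp_one_iff_integrable.1 ((u₀.isTrace_trace hΩo hΩb hL subset_rfl).1.mul hζt)
    have i2 : Integrable (fun x => g x * ζ x) (surf (frontier Ω)) :=
      memLp_one_iff_integrable.1 (hζt.mul (hg.mono_exponent one_le_two))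
    rw [← integral_sub i1 i2]
    exact integral_congr_ae (Eventually.of_forall fun x => by ring)
  rw [e1, e2]
  linarith
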